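/- **Setting.** Let $g,n\ge 0$ with $2g-2+n>0$. A graph $G$ is finite, with vertices $V(G)$, half-edges (conjugate pairs of which form the edges $E(G)$) and $n$ legs marked by $1,\dots,n$; vertices carry weights $h(v)\in\mathbb N$, and the genus is $b_1(G)+\sum_v h(v)$. A morphism of graphs is a weighted edge contraction followed by an isomorphism. A connected graph of genus $g$ with $n$ legs is *stable* of type $(g,n)$ if $2h(v)-2+\mathrm{val}(v)>0$ for every vertex $v$, and *quasi-stable* if every vertex of weight $0$ has valence at least $2$, the vertices of weight $0$ and valence $2$ (the *exceptional* vertices) have exactly two edges and no leg incident to them, and distinct exceptional vertices are not adjacent. Its *stabilization* $G^{st}$ is obtained by replacing every exceptional vertex $v$ and its two edges $e_v^1,e_v^2$ by one edge $e_v$ (called exceptional). A divisor $D\in\mathbb Z^{V(G)}$ is *admissible* if $D(v)=1$ at every exceptional vertex. A *universal stability condition* $\phi$ of type $(g,n)$ assigns to every stable graph $G$ of type $(g,n)$ a function $\phi_G:V(G)\to\mathbb R$ with $\sum_v\phi_G(v)\in\mathbb Z$ such that $\phi_{G_2}(v)=\sum_{w\in\pi^{-1}(v)}\phi_{G_1}(w)$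 for every morphism $\pi:G_1\to G_2$; the total is independent of $G$ and is denoted $|\phi|$. Extend $\phi$ to quasi-stable graphs by $\phi_{G^{st}}$ on the non-exceptional vertices and by $0$ on the exceptional ones. An admissible $D$ is *$\phi$-semistable* if $\deg D=|\phi|$ and $|D(S)-\phi_G(S)|\le |E(S,S^c)|/2$ for all $S\subseteq V(G)$. The condition $\phi$ is *general* if, for every quasi-stable $G$ of type $(g,n)$ and every $S\subseteq V(G)$, $\phi_G(S)+|E(S,S^c)|/2\in\mathbb Z$ implies that $S$ or $S^c$ consists of exceptional vertices. Let $\overline\Gamma$ be a stable tropical curve with real edge lengths: a stable graph $\overline G$ of type $(g,n)$ with a metric $d:E(\overline G)\to\mathbb R_{>0}$; it is also regarded as a compact metric graph. Let $\mathrm{Pic}(\overline\Gamma)=\bigsqcup_k\mathrm{Pic}^k(\overline\Gamma)$ be the group of divisors on this metric graph (finite formal integral sums of its points) modulo divisors of continuous piecewise linear functions with integer slopes, each $\mathrm{Pic}^k(\overline\Gamma)$ having the topology of the real torus $H_1(\overline\Gamma,\mathbb R)/H_1(\overline\Gamma,\mathbb Z)$ via the tropical Abel–Jacobi isomorphism.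 Consider triples $(G,D,\rho)$ with $G$ quasi-stable of type $(g,n)$, $D$ admissible and $\rho:\overline G\cong G^{st}$; their morphisms $(G,D,\rho)\to(G',D',\rho')$ are the morphisms of graphs $\pi:G\to G'$ with $\pi_*D=D'$ and $\pi^{st}\circ\rho=\rho'$. Fix an orientation of every edge of $\overline G$; for an exceptional vertex $v$ let $e_v^1$ (resp. $e_v^2$) be the edge of $G$ joining $v$ to the tail (resp. head) of $e_v$, the orientation being transported by $\rho$. Put $P(G,D,\rho)=\prod_{e\in E_{exc}(G^{st})}[0,d(\rho^{-1}(e))]$. A morphism $\pi$ induces $P(\pi):P(G',D',\rho')\to P(G,D,\rho)$, which keeps the coordinates of the edges exceptional for both graphs, and whose coordinate at an edge $e_v$ exceptional for $G$ but not for $G'$ is $0$ if $\pi$ contracts $e_v^1$ and $d(\rho^{-1}(e_v))$ if $\pi$ contracts $e_v^2$. The *Jacobian topological space* $\mathrm{Jac}_{\overline\Gamma}$ is the colimit of the spaces $P(G,D,\rho)$ along the maps $P(\pi)$; $\mathrm{Jac}_{\overline\Gamma,k}$ and $\mathrm{Jac}_{\overline\Gamma}(\phi)$ are the colimits over the full subcategories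 of the triples with $\deg D=k$, respectively with $D$ $\phi$-semistable. **Theorem.** (i) There is a surjective continuous map $\alpha_{\overline\Gamma}:\mathrm{Jac}_{\overline\Gamma}\to\mathrm{Pic}(\overline\Gamma)$ that sends the point of $\mathrm{Jac}_{\overline\Gamma}$ given by $(x_e)_e\in P(G,D,\rho)$ to the class of $$\sum_{e\in E_{exc}(G^{st})}p_{x_e}+\sum_{v\ \text{non-exceptional}}D(v)\,\rho^{-1}(v),$$ where $p_{x_e}$ is the point of the edge $\rho^{-1}(e)$ at distance $x_e$ from its tail. It preserves degrees: it maps the image of $\mathrm{Jac}_{\overline\Gamma,k}$ into $\mathrm{Pic}^k(\overline\Gamma)$ for every $k\in\mathbb Z$. (ii) For every general universal stability condition $\phi$ of type $(g,n)$, the composition of $\alpha_{\overline\Gamma}$ with the canonical map $\mathrm{Jac}_{\overline\Gamma}(\phi)\to\mathrm{Jac}_{\overline\Gamma}$ is a homeomorphism $\mathrm{Jac}_{\overline\Gamma}(\phi)\cong\mathrm{Pic}^{|\phi|}(\overline\Gamma)$. -/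

import Mathlib

namespace TropJac

/-! ### Graphs -/

/-- A (finite) graph: a finite set `X` of vertices and flags, an idempotent root map `r` and an
involution `i` fixing the image of `r`. -/
structure Graph where
  X : Type
  finite : Finite X
  r : X → X
  i : X → X
  r_r : ∀ x, r (r x) = r x
  i_i : ∀ x, i (i x) = x
  i_r : ∀ x, i (r x) = r x

attribute [instance] Graph.finite

namespace Graph

variable (G : Graph)

/-- Vertices are the elements of the image of the root map, i.e. its fixed points. -/
def IsVertex (x : G.X) : Prop := G.r x = x

/-- Flags are the elements that are not vertices. -/
def IsFlag (x : G.X) : Prop := G.r x ≠ x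

/-- Legs are the flags fixed by the involution. -/
def IsLeg (x : G.X) : Prop := G.IsFlag x ∧ G.i x = x

/-- Half-edges are the elements not fixed by the involution (they are automatically flags). -/
def IsHalfEdge (x : G.X) : Prop := G.i x ≠ x

/-- The set of vertices. -/
def V : Type := {x : G.X // G.IsVertex x}

/-- The set of half-edges. -/
def H : Type := {x : G.X // G.IsHalfEdge x}

/-- The set of edges, the quotient of the set of half-edges by the involution. -/
def E : Type := Quot (fun a b : G.H => b.1 = G.i a.1)

instance : Finite G.V := inferInstanceAs (Finite {x : G.X // G.IsVertex x})
instance : Finite G.H := inferInstanceAs (Finite {x : G.X // G.IsHalfEdge x})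
instance : Finite G.E := inferInstanceAs (Finite (Quot (fun a b : G.H => b.1 = G.i a.1)))
noncomputable instance : Fintype G.V := Fintype.ofFinite _
noncomputable instance : Fintype G.E := Fintype.ofFinite _

variable {G}

/-- The root of an element, as a vertex. -/
def root (x : G.X) : G.V := ⟨G.r x, G.r_r x⟩

/-- A half-edge chosen in each edge, once and for all. It orients the edge. -/
noncomputable def rep (e : G.E) : G.X := (Quot.out e).1

/-- The vertex from which the chosen half-edge of `e` emanates. -/
noncomputable def tail (e : G.E) : G.V := root (rep e)

/-- The vertex at the other end of `e`. -/
noncomputable def head (e : G.E) : G.V := root (G.i (rep e))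

/-- The valence: the number of flags (half-edges and legs) rooted at `v`. -/
noncomputable def val (v : G.V) : ℕ := Nat.card {f : G.X // G.IsFlag f ∧ G.r f = v.1}

/-- The number of edges joining a vertex of `S` with a vertex outside `S`. -/
noncomputable def cut (S : Finset G.V) : ℕ :=
  Nat.card {e : G.E // ¬ (tail e ∈ S ↔ head e ∈ S)}

variable (G)

/-- The incidence relation whose classes are the connected components. -/
def Step (x y : G.X) : Prop := y = G.r x ∨ y = G.i x

def Connected : Prop := Nonempty G.X ∧ ∀ x y, Relation.EqvGen G.Step x y

/-- The first Betti number `#edges - #vertices + #components`. -/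
noncomputable def b₁ : ℤ := (Nat.card G.E : ℤ) - Nat.card G.V + Nat.card (Quot G.Step)

/-- The genus of a graph with vertex weights `h`. -/
noncomputable def genus (h : G.V → ℕ) : ℤ := G.b₁ + ∑ v : G.V, (h v : ℤ)

end Graph

/-- An `n`-marked vertex-weighted graph: `h` is the vertex-weight function and `m` the marking of
the legs. -/
structure WGraph (n : ℕ) extends Graph where
  h : toGraph.V → ℕ
  m : Fin n ≃ {x : toGraph.X // toGraph.IsLeg x}

/-- The subgraph formed by the elements lying over a vertex `v` under a map compatible with the
root maps and the involutions. -/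
def fiber {G₁ G₂ : Graph} (f : G₁.X → G₂.X) (map_r : ∀ x, f (G₁.r x) = G₂.r (f x))
    (map_i : ∀ x, f (G₁.i x) = G₂.i (f x)) (v : G₂.V) : Graph where
  X := {x : G₁.X // f x = v.1}
  finite := inferInstance
  r x := ⟨G₁.r x.1, by rw [map_r, x.2]; exact v.2⟩
  i x := ⟨G₁.i x.1, by
    rw [map_i, x.2]
    have h := G₂.i_r v.1
    rwa [show G₂.r v.1 = v.1 from v.2] at h⟩
  r_r x := Subtype.ext (G₁.r_r x.1)
  i_i x := Subtype.ext (G₁.i_i x.1)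
  i_r x := Subtype.ext (G₁.i_r x.1)

/-- A morphism of `n`-marked vertex-weighted graphs. -/
structure Hom {n : ℕ} (G₁ G₂ : WGraph n) where
  toFun : G₁.X → G₂.X
  map_r : ∀ x, toFun (G₁.r x) = G₂.r (toFun x)
  map_i : ∀ x, toFun (G₁.i x) = G₂.i (toFun x)
  /-- the preimage of a flag consists of exactly one element, which is a flag -/
  flag_fiber : ∀ f, G₂.IsFlag f → ∃ x, G₁.IsFlag x ∧ ∀ y, toFun y = f ↔ y = x
  /-- compatibility with the markings; since the markings are bijections, it makes the morphism
  restrict to a bijection between the sets of legs -/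
  map_m : ∀ j, toFun (G₁.m j).1 = (G₂.m j).1
  fiber_connected : ∀ v : G₂.V, (fiber toFun map_r map_i v).Connected
  fiber_genus : ∀ v : G₂.V, (fiber toFun map_r map_i v).genus
    (fun w => G₁.h ⟨w.1.1, congrArg Subtype.val w.2⟩) = G₂.h v

namespace WGraph

variable {n : ℕ} (G : WGraph n)

/-- Stable graphs of type `(g, n)`. -/
structure IsStable (g : ℕ) : Prop where
  connected : G.Connected
  genus_eq : G.genus G.h = g
  pos : ∀ v : G.V, (0 : ℤ) < 2 * (G.h v : ℤ) - 2 + Graph.val v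

/-- Exceptional vertices: genus zero and valence two. -/
def IsExc (v : G.V) : Prop := G.h v = 0 ∧ Graph.val v = 2

/-- Quasi-stable graphs of type `(g, n)`. -/
structure IsQuasiStable (g : ℕ) : Prop where
  connected : G.Connected
  genus_eq : G.genus G.h = g
  two_le_val : ∀ v : G.V, G.h v = 0 → 2 ≤ Graph.val v
  /-- an exceptional vertex has two edges incident to it: the two flags rooted at it are neither
  legs nor the two halves of a loop -/
  exc_edges : ∀ v : G.V, G.IsExc v → ∀ f, G.IsFlag f → Graph.root f = v →
    G.IsHalfEdge f ∧ Graph.root (G.i f) ≠ v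
  /-- distinct exceptional vertices are not adjacent -/
  exc_not_adj : ∀ v w : G.V, G.IsExc v → G.IsExc w → v ≠ w →
    ¬ ∃ f, G.IsHalfEdge f ∧ Graph.root f = v ∧ Graph.root (G.i f) = w

open Classical in
/-- For a flag `x` rooted at a vertex of valence two: the other flag rooted there. -/
noncomputable def other (x : G.X) : G.X :=
  if hx : ∃ y, G.IsFlag y ∧ G.r y = G.r x ∧ y ≠ x then hx.choose else x

variable {G}

theorem isFlag_of_isHalfEdge {x : G.X} (hx : G.IsHalfEdge x) : G.IsFlag x := by
  intro h
  apply hx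
  rw [← h]
  exact G.i_r x

theorem other_spec {x : G.X} (hx : G.IsFlag x) (he : G.IsExc (Graph.root x)) :
    G.IsFlag (G.other x) ∧ G.r (G.other x) = G.r x ∧ G.other x ≠ x ∧
      ∀ y, G.IsFlag y → G.r y = G.r x → y ≠ x → y = G.other x := by
  have h2 := he.2
  unfold Graph.val at h2
  rw [Nat.card_eq_two_iff' (⟨x, hx, rfl⟩ : {f : G.X // G.IsFlag f ∧ G.r f = (Graph.root x).1})]
    at h2
  obtain ⟨y, hy, hu⟩ := h2
  have hex : ∃ y, G.IsFlag y ∧ G.r y = G.r x ∧ y ≠ x :=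
    ⟨y.1, y.2.1, y.2.2, fun h => hy (Subtype.ext h)⟩
  have ho : G.other x = hex.choose := dif_pos hex
  have hs := hex.choose_spec
  rw [← ho] at hs
  refine ⟨hs.1, hs.2.1, hs.2.2, fun z hz hzr hzx => ?_⟩
  have h1 := hu ⟨z, hz, hzr⟩ (fun h => hzx (congrArg Subtype.val h))
  have h3 := hu ⟨G.other x, hs.1, hs.2.1⟩ (fun h => hs.2.2 (congrArg Subtype.val h))
  exact congrArg Subtype.val (h1.trans h3.symm)

theorem root_eq_iff {x y : G.X} : Graph.root x = Graph.root y ↔ G.r x = G.r y :=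
  ⟨fun h => congrArg Subtype.val h, fun h => Subtype.ext h⟩


/-- The involution of the stabilization: the half-edges `i h_v^1` and `i h_v^2` become
conjugate for every exceptional vertex `v` with flags `h_v^1` and `h_v^2`. -/
noncomputable def stI (G : WGraph n) (x : G.X) : G.X :=
  open Classical in
  if G.IsExc (Graph.root (G.i x)) then G.i (G.other (G.i x)) else G.i x

section Stabilization

variable {g : ℕ}

theorem exc_pair (hG : G.IsQuasiStable g) {x : G.X} (hx : ¬ G.IsExc (Graph.root x))
    (hi : G.IsExc (Graph.root (G.i x))) :
    G.other (G.other (G.i x)) = G.i x ∧ G.other (G.i x) ≠ G.i x ∧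
      Graph.root (G.other (G.i x)) = Graph.root (G.i x) ∧
      ¬ G.IsExc (Graph.root (G.i (G.other (G.i x)))) := by
  have ha : G.IsFlag (G.i x) := by
    intro h
    apply hx
    have h1 : G.i (G.i x) = G.i x := by
      have := G.i_r (G.i x)
      rwa [show G.r (G.i x) = G.i x from h] at this
    rw [G.i_i] at h1
    rwa [← h1] at hi
  obtain ⟨hb, hbr, hba, -⟩ := other_spec ha hi
  have hroot : Graph.root (G.other (G.i x)) = Graph.root (G.i x) := root_eq_iff.2 hbr
  have hi' : G.IsExc (Graph.root (G.other (G.i x))) := by rwa [hroot]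
  obtain ⟨-, -, -, hu⟩ := other_spec hb hi'
  refine ⟨(hu _ ha hbr.symm hba.symm).symm, hba, hroot, fun h => ?_⟩
  obtain ⟨hh, hne⟩ := hG.exc_edges _ hi' _ hb rfl
  exact hG.exc_not_adj _ _ hi' h (Ne.symm hne) ⟨_, hh, rfl, rfl⟩

theorem root_stI (hG : G.IsQuasiStable g) {x : G.X} (hx : ¬ G.IsExc (Graph.root x)) :
    ¬ G.IsExc (Graph.root (G.stI x)) := by
  by_cases hi : G.IsExc (Graph.root (G.i x))
  · rw [stI, if_pos hi]
    exact (exc_pair hG hx hi).2.2.2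
  · rwa [stI, if_neg hi]

theorem stI_stI (hG : G.IsQuasiStable g) {x : G.X} (hx : ¬ G.IsExc (Graph.root x)) : G.stI (G.stI x) = x := by
  by_cases hi : G.IsExc (Graph.root (G.i x))
  · obtain ⟨h1, -, h3, -⟩ := exc_pair hG hx hi
    have h4 : G.stI x = G.i (G.other (G.i x)) := by rw [stI, if_pos hi]
    rw [h4, stI, G.i_i, if_pos (by rwa [h3]), h1, G.i_i]
  · have h4 : G.stI x = G.i x := by rw [stI, if_neg hi]
    rw [h4, stI, G.i_i, if_neg hx]

theorem stI_root {x : G.X} (hx : ¬ G.IsExc (Graph.root x)) : G.stI (G.r x) = G.r x := by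
  have h : Graph.root (G.i (G.r x)) = Graph.root x := by
    rw [root_eq_iff, G.i_r, G.r_r]
  rw [stI, h, if_neg hx, G.i_r]

theorem stI_eq_self_iff (hG : G.IsQuasiStable g) {x : G.X} (hx : ¬ G.IsExc (Graph.root x)) :
    G.stI x = x ↔ G.i x = x := by
  by_cases hi : G.IsExc (Graph.root (G.i x))
  · obtain ⟨-, h2, -, -⟩ := exc_pair hG hx hi
    rw [stI, if_pos hi]
    constructor
    · intro h
      have h5 := congrArg G.i h
      rw [G.i_i] at h5
      exact absurd h5 h2
    · intro h
      rw [h] at hi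
      exact absurd hi hx
  · rw [stI, if_neg hi]

theorem root_leg (hG : G.IsQuasiStable g) {x : G.X} (hx : G.IsLeg x) : ¬ G.IsExc (Graph.root x) :=
  fun h => (hG.exc_edges _ h x hx.1 rfl).1 hx.2

/-- The stabilization of a quasi-stable graph, as a graph. Its elements are the non-exceptional
vertices and the flags rooted at them. -/
noncomputable def stGraph (hG : G.IsQuasiStable g) : Graph where
  X := {x : G.X // ¬ G.IsExc (Graph.root x)}
  finite := inferInstance
  r x := ⟨G.r x.1, by rw [root_eq_iff.2 (G.r_r x.1)]; exact x.2⟩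
  i x := ⟨G.stI x.1, root_stI hG x.2⟩
  r_r x := Subtype.ext (G.r_r x.1)
  i_i x := Subtype.ext (stI_stI hG x.2)
  i_r x := Subtype.ext (stI_root x.2)

/-- The stabilization of a quasi-stable graph of type `(g, n)`, with the induced weights and
marking. -/
noncomputable def st (hG : G.IsQuasiStable g) : WGraph n where
  toGraph := stGraph hG
  h v := G.h ⟨v.1.1, congrArg Subtype.val v.2⟩
  m := G.m.trans
    { toFun := fun x => ⟨⟨x.1, root_leg hG x.2⟩, fun h => x.2.1 (congrArg Subtype.val h),
        Subtype.ext ((stI_eq_self_iff hG (root_leg hG x.2)).2 x.2.2)⟩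
      invFun := fun x => ⟨x.1.1, fun h => x.2.1 (Subtype.ext h),
        (stI_eq_self_iff hG x.1.2).1 (congrArg Subtype.val x.2.2)⟩
      left_inv := fun _ => rfl
      right_inv := fun _ => rfl }

end Stabilization

/-- The map on the elements of the stabilization that a morphism `π` of quasi-stable graphs
induces. It is `π`, except on a half-edge `x` whose conjugate `h_v^1` is rooted at an exceptional
vertex `v` and whose edge is contracted by `π`: there it is the image of the other flag
`h_v^2` rooted at `v` (a half-edge if `π` does not contract the edge of `h_v^2`, and the vertex
to which everything is contracted otherwise). -/
noncomputable def stMap {G' : WGraph n} (π : Hom G G') (x : G.X) : G'.X :=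
  open Classical in
  if G.IsHalfEdge x ∧ G.IsExc (Graph.root (G.i x)) ∧ G'.IsVertex (π.toFun x) then
    π.toFun (G.other (G.i x))
  else π.toFun x

/-- The graph with one vertex of genus `g`, no edges and `n` legs. -/
def corolla (g n : ℕ) : WGraph n where
  X := Option (Fin n)
  finite := inferInstance
  r _ := none
  i x := x
  r_r _ := rfl
  i_i _ := rfl
  i_r _ := rfl
  h _ := g
  m :=
    { toFun := fun j => ⟨some j, fun h => Option.some_ne_none j (Eq.symm h), rfl⟩
      invFun := fun x => x.1.get (by
        obtain ⟨x, hx⟩ := x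
        cases x with
        | none => exact absurd rfl hx.1
        | some j => rfl)
      left_inv := fun _ => rfl
      right_inv := fun x => Subtype.ext (by simp) }

end WGraph

/-! ### Universal stability conditions -/

/-- A universal stability condition of type `(g, n)`: a function `φ_G` on the vertices of every
stable graph `G` of type `(g, n)`, with integral total, compatible with all morphisms.
(The values on graphs that are not stable of type `(g, n)` play no role.) -/
structure StabCond (g n : ℕ) where
  toFun : ∀ G : WGraph n, G.V → ℝ
  integral : ∀ G : WGraph n, G.IsStable g → ∃ k : ℤ, ∑ v : G.V, toFun G v = k
  map_eq : ∀ G₁ G₂ : WGraph n, G₁.IsStable g → G₂.IsStable g → ∀ (π : Hom G₁ G₂) (v : G₂.V),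
    open Classical in
    toFun G₂ v = ∑ w : G₁.V, if π.toFun w.1 = v.1 then toFun G₁ w else 0

namespace StabCond

variable {g n : ℕ} (φ : StabCond g n)

/-- The degree `|φ|`, i.e. the total of `φ_G` for any stable graph `G` of type `(g, n)`; here it
is read off from the stable graph with one vertex and no edges. -/
noncomputable def degree : ℤ := ⌊∑ v : (WGraph.corolla g n).V, φ.toFun (WGraph.corolla g n) v⌋

/-- The function induced by `φ` on the vertices of a quasi-stable graph. -/
noncomputable def onQuasi {G : WGraph n} (hG : G.IsQuasiStable g) (v : G.V) : ℝ :=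
  open Classical in
  if hv : G.IsExc v then 0
  else φ.toFun (WGraph.st hG)
    ⟨⟨v.1, by rwa [show Graph.root v.1 = v from Subtype.ext v.2]⟩, Subtype.ext v.2⟩

/-- A divisor `D` on a quasi-stable graph is `φ`-semistable. (Admissibility is
imposed separately.) -/
def IsSemistable {G : WGraph n} (hG : G.IsQuasiStable g) (D : G.V → ℤ) : Prop :=
  ∑ v : G.V, D v = φ.degree ∧
  ∀ S : Finset G.V,
    ∑ v ∈ S, φ.onQuasi hG v - (Graph.cut S : ℝ) / 2 ≤ ((∑ v ∈ S, D v : ℤ) : ℝ) ∧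
    ((∑ v ∈ S, D v : ℤ) : ℝ) ≤ ∑ v ∈ S, φ.onQuasi hG v + (Graph.cut S : ℝ) / 2

/-- General universal stability conditions. -/
def IsGeneral : Prop :=
  ∀ (G : WGraph n) (hG : G.IsQuasiStable g) (S : Finset G.V),
    (∃ k : ℤ, ∑ v ∈ S, φ.onQuasi hG v + (Graph.cut S : ℝ) / 2 = k) →
    (∀ v ∈ S, G.IsExc v) ∨ (∀ v, v ∉ S → G.IsExc v)

end StabCond

/-! ### Tropical curves, their divisors and their Picard group -/

/-- A stable tropical curve of type `(g, n)` with real edge lengths. -/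
structure TropCurve (g n : ℕ) where
  G : WGraph n
  stable : G.IsStable g
  d : G.E → ℝ
  d_pos : ∀ e, 0 < d e

namespace TropCurve

variable {g n : ℕ} (Γ : TropCurve g n)

/-- The points of the compact metric graph underlying the tropical curve: the vertices, and for
every edge `e` an open interval of length `d e`. -/
inductive Pt
  | vert (v : Γ.G.V)
  | inner (e : Γ.G.E) (s : Set.Ioo (0 : ℝ) (Γ.d e))

/-- The point at distance `s` from the tail along the edge `e`, for `s` in `[0, d e]`. -/
noncomputable def pt (e : Γ.G.E) (s : ℝ) : Γ.Pt :=
  open Classical in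
  if h0 : s ≤ 0 then .vert (Graph.tail e)
  else if h1 : Γ.d e ≤ s then .vert (Graph.head e)
  else .inner e ⟨s, not_le.1 h0, not_le.1 h1⟩

/-- Divisors on the metric graph: finite formal integral sums of points. -/
abbrev Div : Type := Γ.Pt →₀ ℤ

/-- `f` is a rational function whose slope at `pt e s` is `a e s` in the direction towards the head
of `e` and `b e s` in the direction towards the tail of `e` (both slopes are outgoing).
Being affine with integral slope on a small segment in either direction from every point of the
closed edge `[0, d e]` means, by compactness, being continuous and piecewise linear with finitely
many pieces and integral slopes. -/
structure IsRational (f : Γ.Pt → ℝ) (a b : Γ.G.E → ℝ → ℤ) : Prop where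
  right : ∀ e s, 0 ≤ s → s < Γ.d e →
    ∀ᶠ t in nhdsWithin (0 : ℝ) (Set.Ioi 0), f (Γ.pt e (s + t)) = f (Γ.pt e s) + a e s * t
  left : ∀ e s, 0 < s → s ≤ Γ.d e →
    ∀ᶠ t in nhdsWithin (0 : ℝ) (Set.Ioi 0), f (Γ.pt e (s - t)) = f (Γ.pt e s) + b e s * t

/-- The order at a point of a rational function with slopes `a`, `b`: the sum of the outgoing
slopes. -/
noncomputable def ord (a b : Γ.G.E → ℝ → ℤ) : Γ.Pt → ℤ
  | .vert v =>
    open Classical in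
    (∑ e : Γ.G.E, if Graph.tail e = v then a e 0 else 0) +
      ∑ e : Γ.G.E, if Graph.head e = v then b e (Γ.d e) else 0
  | .inner e s => a e s + b e s

/-- The group of principal divisors. -/
def principal : AddSubgroup Γ.Div where
  carrier := {D | ∃ f a b, Γ.IsRational f a b ∧ ∀ p, D p = Γ.ord a b p}
  zero_mem' := by
    refine ⟨fun _ => 0, fun _ _ => 0, fun _ _ => 0, ⟨?_, ?_⟩, ?_⟩
    · intro e s _ _
      simp
    · intro e s _ _
      simp
    · intro p
      cases p <;> simp [ord]
  add_mem' := by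
    rintro D D' ⟨f, a, b, h, hD⟩ ⟨f', a', b', h', hD'⟩
    refine ⟨fun p => f p + f' p, fun e s => a e s + a' e s, fun e s => b e s + b' e s,
      ⟨?_, ?_⟩, ?_⟩
    · intro e s h0 h1
      filter_upwards [h.right e s h0 h1, h'.right e s h0 h1] with t ht ht'
      rw [ht, ht']
      push_cast
      ring
    · intro e s h0 h1
      filter_upwards [h.left e s h0 h1, h'.left e s h0 h1] with t ht ht'
      rw [ht, ht']
      push_cast
      ring
    · intro p
      rw [Finsupp.add_apply, hD, hD']
      cases p with
      | vert v =>
        simp only [ord, ← Finset.sum_add_distrib]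
        refine Finset.sum_congr rfl fun e _ => ?_
        split_ifs <;> ring
      | inner e s =>
        simp only [ord]
        ring
  neg_mem' := by
    rintro D ⟨f, a, b, h, hD⟩
    refine ⟨fun p => - f p, fun e s => - a e s, fun e s => - b e s, ⟨?_, ?_⟩, ?_⟩
    · intro e s h0 h1
      filter_upwards [h.right e s h0 h1] with t ht
      rw [ht]
      push_cast
      ring
    · intro e s h0 h1
      filter_upwards [h.left e s h0 h1] with t ht
      rw [ht]
      push_cast
      ring
    · intro p
      rw [Finsupp.neg_apply, hD]
      cases p with
      | vert v =>
        simp only [ord, neg_add, ← Finset.sum_neg_distrib]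
        congr 1 <;> refine Finset.sum_congr rfl fun e _ => ?_ <;> split_ifs <;> simp
      | inner e s =>
        simp only [ord]
        ring

/-- The tropical Picard group: divisors modulo linear equivalence. -/
def Pic : Type := Γ.Div ⧸ Γ.principal

noncomputable instance : AddCommGroup Γ.Pic := inferInstanceAs (AddCommGroup (Γ.Div ⧸ Γ.principal))

variable {Γ} in
/-- The linear equivalence class of a divisor. -/
noncomputable def cls (D : Γ.Div) : Γ.Pic := QuotientAddGroup.mk D

/-- The degree of a divisor. -/
noncomputable def degDiv (D : Γ.Div) : ℤ := D.sum fun _ k => k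

/-- The set `Pic^k` of the classes of the divisors of degree `k`. -/
def PicDeg (k : ℤ) : Set Γ.Pic := {c | ∃ D : Γ.Div, Γ.degDiv D = k ∧ cls D = c}

/-- The real homology group `H₁`, as the space of real 1-cycles. -/
def H₁ : Submodule ℝ (Γ.G.E → ℝ) where
  carrier := {z | ∀ v : Γ.G.V,
    open Classical in
    (∑ e : Γ.G.E, if Graph.head e = v then z e else 0) =
      ∑ e : Γ.G.E, if Graph.tail e = v then z e else 0}
  zero_mem' := by
    intro v
    simp
  add_mem' := by
    intro y z hy hz v
    have h1 := hy v
    have h2 := hz v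
    simp only [← Finset.sum_filter] at h1 h2 ⊢
    simp only [Pi.add_apply, Finset.sum_add_distrib, h1, h2]
  smul_mem' := by
    intro c z hz v
    have h1 := hz v
    simp only [← Finset.sum_filter] at h1 ⊢
    simp only [Pi.smul_apply, ← Finset.smul_sum, h1]

/-- The divisor of degree 0 obtained by starting at the tail of `e` and running `t` times
(`t` a real number, possibly not in `[0, 1]`) through `e`. -/
noncomputable def slide (e : Γ.G.E) (t : ℝ) : Γ.Div :=
  ⌊t⌋ • (Finsupp.single (Pt.vert (Graph.head e)) 1 - Finsupp.single (Pt.vert (Graph.tail e)) 1) +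
    (Finsupp.single (Γ.pt e (Int.fract t * Γ.d e)) 1 - Finsupp.single (Pt.vert (Graph.tail e)) 1)

/-- The inverse `H₁(ℝ) → H₁(ℝ) / H₁(ℤ) → Pic⁰` of the tropical Abel-Jacobi isomorphism, where
`H₁(ℝ)` is identified with its dual by the length pairing: the Abel-Jacobi map sends
`slide e t` to the functional `w ↦ t * d e * w e`, hence `∑ e, slide e (z e)` to the
functional `w ↦ ∑ e, d e * z e * w e` of pairing with `z`. -/
noncomputable def ajInv (z : Γ.H₁) : Γ.Pic := cls (∑ e : Γ.G.E, Γ.slide e (z.1 e))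

/-- The topology of the Picard group: a set is open if and only if its preimage under
`z ↦ c + ajInv z` is open in `H₁(ℝ)` for every class `c`. So every `Pic^k` is open, and it carries
the topology of the real torus `H₁(ℝ) / H₁(ℤ)`, transported by the tropical Abel-Jacobi
isomorphism and a translation. -/
noncomputable instance : TopologicalSpace Γ.Pic :=
  ⨆ c : Γ.Pic, TopologicalSpace.coinduced (fun z : Γ.H₁ => c + Γ.ajInv z) inferInstance

end TropCurve

/-! ### The Jacobian topological space -/

/-- The objects of the category of quasi-stable graphs with an admissible divisor and an
isomorphism of the stabilization with a given graph `Gbar`. -/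
structure QD (g : ℕ) {n : ℕ} (Gbar : WGraph n) where
  G : WGraph n
  qs : G.IsQuasiStable g
  D : G.V → ℤ
  admissible : ∀ v, G.IsExc v → D v = 1
  ρ : Hom Gbar (WGraph.st qs)
  ρ_bij : Function.Bijective ρ.toFun

namespace QD

variable {g n : ℕ} {Gbar : WGraph n}

/-- The element of `G` corresponding to an element of `Gbar`. -/
def emb (o : QD g Gbar) (y : Gbar.X) : o.G.X := (o.ρ.toFun y).1

/-- The non-exceptional vertex of `G` corresponding to a vertex of `Gbar`. -/
def embV (o : QD g Gbar) (v : Gbar.V) : o.G.V :=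
  ⟨o.emb v.1, by
    have h := o.ρ.map_r v.1
    rw [show Gbar.r v.1 = v.1 from v.2] at h
    exact (congrArg Subtype.val h).symm⟩

/-- The degree of the divisor. -/
noncomputable def deg (o : QD g Gbar) : ℤ := ∑ v : o.G.V, o.D v

/-- The morphisms `π` of graphs with `π_* D = D'` and `π^st ∘ ρ = ρ'`. -/
structure Mor (o o' : QD g Gbar) where
  π : Hom o.G o'.G
  map_D : ∀ v : o'.G.V,
    open Classical in
    ∑ w : o.G.V, (if π.toFun w.1 = v.1 then o.D w else 0) = o'.D v
  map_ρ : ∀ y, WGraph.stMap π (o.emb y) = o'.emb y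

/-- An edge of `Gbar` is exceptional for `o` if an exceptional vertex of `G` lies on it. -/
def IsExcEdge (o : QD g Gbar) (e : Gbar.E) : Prop :=
  o.G.IsExc (Graph.root (o.G.i (o.emb (Graph.rep e))))

end QD

namespace TropCurve

variable {g n : ℕ} (Γ : TropCurve g n)

/-- The polytope `P(G, D, ρ)`, a product of intervals indexed by the exceptional edges. For an
exceptional vertex `v` on the edge `e`, the flag `h_v^1` is the one that points to the tail of `e`,
and the coordinate is the distance from the tail of `e`. -/
abbrev Poly (o : QD g Γ.G) : Type :=
  ∀ e : {e : Γ.G.E // o.IsExcEdge e}, Set.Icc (0 : ℝ) (Γ.d e.1)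

/-- The map `P(π) : P(G', D', ρ') → P(G, D, ρ)`. If `e` is exceptional for `G` but not for `G'`,
then exactly one of the edges `e^1`, `e^2` of `G` is contracted by `π`; the edge `e^1` contains
the half-edge `emb (rep e)`. -/
noncomputable def polyMap {o o' : QD g Γ.G} (p : QD.Mor o o') (x : Γ.Poly o') : Γ.Poly o :=
  open Classical in
  fun e =>
    if h : o'.IsExcEdge e.1 then x ⟨e.1, h⟩
    else if o'.G.IsVertex (p.π.toFun (o.emb (Graph.rep e.1))) then
      ⟨0, le_refl _, (Γ.d_pos e.1).le⟩
    else ⟨Γ.d e.1, (Γ.d_pos e.1).le, le_refl _⟩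

/-- The disjoint union of the polytopes of the objects satisfying `C`. -/
abbrev PolySum (C : QD g Γ.G → Prop) : Type 1 := Σ o : {o : QD g Γ.G // C o}, Γ.Poly o.1

/-- The identification of `x'` with `P(π)(x')` for every morphism `π` of the full subcategory. -/
inductive Glue (C : QD g Γ.G → Prop) : Γ.PolySum C → Γ.PolySum C → Prop
  | mk (o o' : {o : QD g Γ.G // C o}) (p : QD.Mor o.1 o'.1) (x : Γ.Poly o'.1) :
      Glue C ⟨o', x⟩ ⟨o, Γ.polyMap p x⟩

/-- The colimit of the polytopes over the full subcategory of the objects satisfying `C`: the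
topological quotient of their disjoint union by the identifications above. -/
abbrev JacOf (C : QD g Γ.G → Prop) : Type 1 := Quot (Γ.Glue C)

/-- The Jacobian topological space. -/
abbrev Jac : Type 1 := Γ.JacOf fun _ => True

/-- The degree `k` Jacobian topological space. -/
abbrev JacDeg (k : ℤ) : Type 1 := Γ.JacOf fun o => o.deg = k

/-- The Jacobian topological space of `φ`-semistable divisors. -/
abbrev JacStab (φ : StabCond g n) : Type 1 := Γ.JacOf fun o => φ.IsSemistable o.qs o.D

/-- The point of the Jacobian given by a point of a polytope. -/
def Jac.mk (o : QD g Γ.G) (x : Γ.Poly o) : Γ.Jac := Quot.mk _ ⟨⟨o, trivial⟩, x⟩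

/-- The canonical map from the colimit over a full subcategory to the Jacobian. -/
def JacOf.toJac (C : QD g Γ.G → Prop) : Γ.JacOf C → Γ.Jac :=
  Quot.map (fun a => ⟨⟨a.1.1, trivial⟩, a.2⟩) (by
    rintro _ _ ⟨o, o', p, x⟩
    exact Glue.mk (C := fun _ => True) ⟨o.1, trivial⟩ ⟨o'.1, trivial⟩ p x)

/-- The divisor attached to a point of a polytope: the sum of the points on the exceptional edges
given by the coordinates, plus `D` on the non-exceptional vertices. -/
noncomputable def cellDiv (o : QD g Γ.G) (x : Γ.Poly o) : Γ.Div :=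
  open Classical in
  (∑ e : {e : Γ.G.E // o.IsExcEdge e}, Finsupp.single (Γ.pt e.1 (x e)) 1) +
    ∑ v : Γ.G.V, Finsupp.single (Pt.vert v) (o.D (o.embV v))

end TropCurve

end TropJac

/-! An integral function `D` on the vertices and a real chain `t` on the edges describe the divisor
`base D t`, in which `t e` slides a chip along `e`. Every class has this form, and `cls_base_eq_iff`
computes linear equivalence: an integral chain may be traded from `t` into `D` through its boundary,
and the gradient of a function on the vertices may be added to `t`. A point of a polytope is such a
pair with `t` in the unit cube: `D` is `baseDeg`, with the exceptional chips moved to the tails.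
Hence the map to the Picard group exists as soon as glued points have the same divisor
(`cellDiv_polyMap`), and splitting `t` into integral and fractional parts shows that it is onto.

In these terms semistability becomes the condition `IsBalanced` on `(D, t)`. This is the first-order
condition for a minimum, on the chains that differ from `t` by a gradient, of the convex energy `∑
e, d e * (interpSq (y e) + u e * y e)`, where `interpSq` interpolates `k ^ 2 / 2` and the boundary
of `u` is `D - φ`. The energy is coercive, so balanced representatives exist (`exists_isBalanced`),
which gives surjectivity in (ii). If two balanced chains differ by the gradient of `F`, the
conditions for the set where `F` is maximal and for its complement add up to an equality, which
generality of `φ` forbids unless `F` is constant (`IsBalanced.unique`). So semistable points with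
the same class have chains that differ by an integral chain. The gluing forgets exactly this: every
point equals a normal form that depends only on `D + bdry ⌊t⌋` and on the fractional parts of `t`
(`mk_canon_eq`, `mk_norm_eq`). This is injectivity.

For the topology, every triple is isomorphic to a standard subdivision (`QD.toCanon`), and only
finitely many of these are semistable, so finitely many compact boxes cover the semistable Jacobian.
The classes of a compact set of chains form a closed set, because its preimage in `H₁` is empty or a
compact set plus a lattice (`isClosed_image_cls_base`). Thus the continuous bijection is closed. -/

namespace TropJac

open TropJac.Graph Filter Topology

/-! ### Half-edges, parametrized edge sets and the genus. -/

namespace Graph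

variable {G : Graph}

theorem IsVertex.r_eq {x : G.X} (h : G.IsVertex x) : G.r x = x := h

theorem IsVertex.i_eq {x : G.X} (h : G.IsVertex x) : G.i x = x := by
  have := G.i_r x
  rwa [show G.r x = x from h] at this

theorem isVertex_r (x : G.X) : G.IsVertex (G.r x) := G.r_r x

theorem IsHalfEdge.not_isVertex {x : G.X} (h : G.IsHalfEdge x) : ¬ G.IsVertex x :=
  fun hv => h hv.i_eq

theorem IsHalfEdge.conj {x : G.X} (h : G.IsHalfEdge x) : G.IsHalfEdge (G.i x) := by
  intro h1
  rw [G.i_i] at h1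
  exact h h1.symm

/-- The two half-edges of an edge; `true` stands for the chosen one. -/
noncomputable def half (e : G.E) (b : Bool) : G.X := cond b (rep e) (G.i (rep e))

theorem root_half_true (e : G.E) : root (half e true) = tail e := rfl

theorem root_half_false (e : G.E) : root (half e false) = head e := rfl

theorem i_half (e : G.E) (b : Bool) : G.i (half e b) = half e (!b) := by
  cases b
  · exact G.i_i _
  · rfl

theorem isHalfEdge_half (e : G.E) (b : Bool) : G.IsHalfEdge (half e b) := by
  have h : G.IsHalfEdge (rep e) := (Quot.out e).2
  cases b
  · exact h.conj
  · exact h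

theorem mk_half (e : G.E) (b : Bool) : (Quot.mk _ ⟨half e b, isHalfEdge_half e b⟩ : G.E) = e := by
  have h : (Quot.mk _ ⟨half e true, isHalfEdge_half e true⟩ : G.E) = e := Quot.out_eq e
  cases b
  · refine Eq.trans (Quot.sound ?_) h
    exact (i_half e false).symm
  · exact h

theorem half_inj {e e' : G.E} {b b' : Bool} (h : half e b = half e' b') : e = e' ∧ b = b' := by
  have he : e = e' := by
    rw [← mk_half e b, ← mk_half e' b']
    congr 1
    exact Subtype.ext h
  subst he
  refine ⟨rfl, ?_⟩
  by_contra hb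
  have hb' : b' = !b := by cases b <;> cases b' <;> simp_all
  rw [hb', ← i_half] at h
  exact isHalfEdge_half e b h.symm

theorem exists_half {x : G.X} (hx : G.IsHalfEdge x) : ∃ e b, x = half e b := by
  -- The unordered pair of conjugate half-edges is well defined on an edge, so `x` lies in the pair
  -- of the chosen half-edge of its edge.
  let F : G.E → Set G.X := Quot.lift (fun a : G.H => ({a.1, G.i a.1} : Set G.X)) (by
    intro a b h
    rw [h, G.i_i, Set.pair_comm])
  let e : G.E := Quot.mk _ ⟨x, hx⟩
  have h1 : F (Quot.mk _ ⟨half e true, isHalfEdge_half e true⟩) = F e := by rw [mk_half]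
  have h2 : x ∈ F e := Or.inl rfl
  rw [← h1] at h2
  rcases h2 with h | h
  · exact ⟨e, true, h⟩
  · exact ⟨e, false, h.trans (i_half e true)⟩

theorem eq_half_or (x : G.X) : G.i x = x ∨ ∃ e b, x = half e b := by
  by_cases h : G.i x = x
  · exact Or.inl h
  · exact Or.inr (exists_half h)

/-- A parametrization of the edges of a graph with a labelling of their two half-edges. -/
structure EdgePres (G : Graph) (ι : Type) where
  h : ι → Bool → G.X
  conj : ∀ j b, G.i (h j b) = h j (!b)
  ne : ∀ j, h j true ≠ h j false
  inj : ∀ j j' b b', h j b = h j' b' → j = j'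
  surj : ∀ x, G.IsHalfEdge x → ∃ j b, x = h j b

namespace EdgePres

variable {ι : Type} (P : EdgePres G ι)

theorem isHalfEdge (j : ι) (b : Bool) : G.IsHalfEdge (P.h j b) := by
  intro h
  rw [P.conj] at h
  cases b
  · exact P.ne j h
  · exact P.ne j h.symm

theorem edge_eq {j : ι} {b b' : Bool} :
    (Quot.mk _ ⟨P.h j b, P.isHalfEdge j b⟩ : G.E) = Quot.mk _ ⟨P.h j b', P.isHalfEdge j b'⟩ := by
  by_cases hb : b' = b
  · subst hb
    rfl
  · apply Quot.sound
    change P.h j b' = G.i (P.h j b)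
    rw [P.conj]
    congr 1
    cases b <;> cases b' <;> simp_all

/-- The bijection with the set of edges. -/
noncomputable def equiv : ι ≃ G.E :=
  Equiv.ofBijective (fun j => Quot.mk _ ⟨P.h j true, P.isHalfEdge j true⟩) (by
    constructor
    · intro j j' h
      obtain ⟨e, b, he⟩ := exists_half (P.isHalfEdge j true)
      obtain ⟨e', b', he'⟩ := exists_half (P.isHalfEdge j' true)
      have h1 : e = e' := by
        rw [← mk_half e b, ← mk_half e' b']
        simp only [← he, ← he']
        exact h
      subst h1
      by_cases hb : b = b'
      · subst hb
        exact P.inj j j' true true (he.trans he'.symm)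
      · have : b' = !b := by cases b <;> cases b' <;> simp_all
        refine P.inj j j' (!true) true ?_
        rw [← P.conj, he, he', this, i_half]
    · intro e
      obtain ⟨j, b, hj⟩ := P.surj _ (isHalfEdge_half e true)
      refine ⟨j, ?_⟩
      change (Quot.mk _ ⟨P.h j true, P.isHalfEdge j true⟩ : G.E) = e
      rw [P.edge_eq (b' := b)]
      rw [← mk_half e true]
      congr 1
      exact Subtype.ext hj.symm)

/-- The labelling by `P` and the chosen orientation of the edge can differ only by a flip `c`.
Counts that are symmetric in the two ends, such as `cut`, do not see it. -/
theorem half_equiv (j : ι) : ∃ c : Bool, ∀ b, half (P.equiv j) b = P.h j (c ^^ b) := by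
  obtain ⟨e, b, he⟩ := exists_half (P.isHalfEdge j true)
  have h1 : P.equiv j = e := by
    rw [← mk_half e b]
    simp only [← he]
    rfl
  rw [h1]
  refine ⟨!b, fun b' => ?_⟩
  by_cases hb : b' = b
  · subst hb
    rw [← he]
    cases b' <;> rfl
  · have : b' = !b := by cases b <;> cases b' <;> simp_all
    rw [this, ← i_half, ← he, P.conj]
    cases b <;> rfl

include P in
theorem card_E : Nat.card G.E = Nat.card ι := (Nat.card_congr P.equiv).symm

theorem cut_eq (S : Finset G.V) :
    cut S = Nat.card {j : ι // ¬ (root (P.h j true) ∈ S ↔ root (P.h j false) ∈ S)} := by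
  refine (Nat.card_congr (P.equiv.subtypeEquiv fun j => ?_)).symm
  obtain ⟨c, hc⟩ := P.half_equiv j
  rw [← root_half_true, ← root_half_false, hc, hc]
  cases c
  · rfl
  · exact not_congr ⟨Iff.symm, Iff.symm⟩

end EdgePres

/-- The tautological parametrization of the edges. -/
noncomputable def EdgePres.self (G : Graph) : EdgePres G G.E where
  h := half
  conj := i_half
  ne e h := by simpa using (half_inj h).2
  inj _ _ _ _ h := (half_inj h).1
  surj _ h := exists_half h

theorem Connected.card_components (h : G.Connected) : Nat.card (Quot G.Step) = 1 := by
  rw [Nat.card_eq_one_iff_unique]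
  obtain ⟨⟨x⟩, h⟩ := h
  refine ⟨⟨fun a b => ?_⟩, ⟨Quot.mk _ x⟩⟩
  induction a using Quot.ind
  induction b using Quot.ind
  exact Quot.eqvGen_sound (h _ _)

theorem connected_of_center (x : G.X) (h : ∀ y, Relation.EqvGen G.Step y x) : G.Connected :=
  ⟨⟨x⟩, fun y z => (h y).trans _ _ _ ((h z).symm _ _)⟩

theorem eqvGen_r (x : G.X) : Relation.EqvGen G.Step x (G.r x) := .rel _ _ (Or.inl rfl)

theorem eqvGen_i (x : G.X) : Relation.EqvGen G.Step x (G.i x) := .rel _ _ (Or.inr rfl)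

/-- A connected graph has one component, so the genus can be counted in any index types for edges
and vertices. Subdivisions, fibers of contractions and the graph with one vertex are all handled
this way. -/
theorem genus_eq_of_pres {ι κ : Type} [Fintype κ] (hc : G.Connected) (P : EdgePres G ι)
    (f : κ ≃ G.V) (h : G.V → ℕ) :
    G.genus h = Nat.card ι - Nat.card κ + 1 + ∑ v : κ, (h (f v) : ℤ) := by
  rw [genus, b₁, P.card_E, hc.card_components, Nat.card_congr f]
  rw [← Equiv.sum_comp f]
  simp

/-- Transport of an edge parametrization along an isomorphism. -/
def EdgePres.map {G' : Graph} {ι : Type} (P : EdgePres G ι) (f : G.X ≃ G'.X)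
    (hi : ∀ x, f (G.i x) = G'.i (f x)) : EdgePres G' ι where
  h j b := f (P.h j b)
  conj j b := by rw [← hi, P.conj]
  ne j h := P.ne j (f.injective h)
  inj j j' b b' h := P.inj j j' b b' (f.injective h)
  surj x hx := by
    have h1 : G.IsHalfEdge (f.symm x) := by
      intro h
      apply hx
      have := congrArg f h
      rwa [hi, f.apply_symm_apply] at this
    obtain ⟨j, b, h⟩ := P.surj _ h1
    exact ⟨j, b, by rw [← h, f.apply_symm_apply]⟩

section Iso

variable {G' : Graph} (f : G.X ≃ G'.X) (hr : ∀ x, f (G.r x) = G'.r (f x))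
  (hi : ∀ x, f (G.i x) = G'.i (f x))

include hr in
theorem isVertex_map_iff (x : G.X) : G'.IsVertex (f x) ↔ G.IsVertex x := by
  unfold IsVertex
  rw [← hr, f.injective.eq_iff]

/-- The bijection of vertices induced by an isomorphism. -/
def mapV : G.V ≃ G'.V := f.subtypeEquiv fun x => (isVertex_map_iff f hr x).symm

theorem mapV_val (v : G.V) : (mapV f hr v).1 = f v.1 := rfl

include hr in
theorem val_map (v : G.V) : val (mapV f hr v) = val v := by
  refine (Nat.card_congr (f.subtypeEquiv fun x => ?_)).symm
  rw [IsFlag, IsFlag, ← hr, f.injective.ne_iff, mapV_val, f.injective.eq_iff]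

include hr hi in
theorem Connected.map (h : G.Connected) : G'.Connected := by
  obtain ⟨⟨x⟩, h⟩ := h
  refine connected_of_center (f x) fun y => ?_
  have h1 : ∀ a b, Relation.EqvGen G.Step a b → Relation.EqvGen G'.Step (f a) (f b) := by
    intro a b hab
    induction hab with
    | rel a b hab =>
      rcases hab with rfl | rfl
      · rw [hr]
        exact eqvGen_r _
      · rw [hi]
        exact eqvGen_i _
    | refl a => exact .refl _
    | symm a b _ ih => exact ih.symm
    | trans a b c _ _ ih1 ih2 => exact ih1.trans _ _ _ ih2
  have := h1 _ _ (h (f.symm y) x)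
  rwa [f.apply_symm_apply] at this

include hi in
theorem genus_map (hc : G.Connected) (h : G.V → ℕ) (h' : G'.V → ℕ)
    (hh : ∀ v, h' (mapV f hr v) = h v) : G'.genus h' = G.genus h := by
  rw [genus_eq_of_pres hc (EdgePres.self G) (Equiv.refl _),
    genus_eq_of_pres (hc.map f hr hi) ((EdgePres.self G).map f hi) (mapV f hr)]
  simp [hh]

end Iso

theorem connected_of_subsingleton [Subsingleton G.X] (x : G.X) : G.Connected :=
  connected_of_center x fun y => by rw [Subsingleton.elim y x]; exact .refl _

theorem genus_of_subsingleton [Subsingleton G.X] (h : G.V → ℕ) (v : G.V) : G.genus h = h v := by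
  let P : EdgePres G Empty :=
    { h := fun j => j.elim
      conj := fun j => j.elim
      ne := fun j => j.elim
      inj := fun j => j.elim
      surj := fun x hx => absurd (Subsingleton.elim _ _) hx }
  let f : Unit ≃ G.V :=
    { toFun := fun _ => v
      invFun := fun _ => ()
      left_inv := fun _ => rfl
      right_inv := fun w => Subtype.ext (Subsingleton.elim _ _) }
  rw [genus_eq_of_pres (connected_of_subsingleton v.1) P f]
  have h1 : ∑ w : Unit, (h (f w) : ℤ) = h v := Fintype.sum_unique _
  rw [h1]
  simp

end Graph

/-! ### Isomorphisms of marked weighted graphs. -/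

variable {n g : ℕ}

/-- An isomorphism of marked weighted graphs is a morphism. -/
def Hom.ofIso {G₁ G₂ : WGraph n} (f : G₁.X ≃ G₂.X) (hr : ∀ x, f (G₁.r x) = G₂.r (f x))
    (hi : ∀ x, f (G₁.i x) = G₂.i (f x)) (hm : ∀ j, f (G₁.m j).1 = (G₂.m j).1)
    (hh : ∀ (v : G₁.V) (w : G₂.V), f v.1 = w.1 → G₂.h w = G₁.h v) : Hom G₁ G₂ :=
  have hsub : ∀ v : G₂.V, Subsingleton (fiber f hr hi v).X := fun v =>
    ⟨fun a b => Subtype.ext (f.injective (a.2.trans b.2.symm))⟩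
  have hv : ∀ v : G₂.V, (fiber f hr hi v).r ⟨f.symm v.1, f.apply_symm_apply _⟩ =
      ⟨f.symm v.1, f.apply_symm_apply _⟩ := fun v => (hsub v).elim _ _
  { toFun := f
    map_r := hr
    map_i := hi
    flag_fiber := fun y hy => by
      refine ⟨f.symm y, fun h => hy ?_, fun z => f.eq_symm_apply.symm⟩
      have := congrArg f h
      rwa [hr, f.apply_symm_apply] at this
    map_m := hm
    fiber_connected := fun v =>
      have := hsub v
      connected_of_subsingleton (G := fiber f hr hi v) ⟨f.symm v.1, f.apply_symm_apply _⟩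
    fiber_genus := fun v => by
      have := hsub v
      rw [genus_of_subsingleton (G := fiber f hr hi v) _
        ⟨⟨f.symm v.1, f.apply_symm_apply _⟩, hv v⟩]
      exact congrArg Nat.cast (hh _ v (f.apply_symm_apply _)).symm }

theorem Hom.h_eq_of_injective {G₁ G₂ : WGraph n} (π : Hom G₁ G₂)
    (hπ : Function.Injective π.toFun) (v : G₁.V) (w : G₂.V) (hvw : π.toFun v.1 = w.1) :
    G₂.h w = G₁.h v := by
  have hsub : Subsingleton (fiber π.toFun π.map_r π.map_i w).X :=
    ⟨fun a b => Subtype.ext (hπ (a.2.trans b.2.symm))⟩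
  have h := π.fiber_genus w
  rw [genus_of_subsingleton (G := fiber π.toFun π.map_r π.map_i w) _
    ⟨⟨v.1, hvw⟩, hsub.elim _ _⟩] at h
  exact (Nat.cast_injective (R := ℤ) h).symm

theorem WGraph.IsStable.of_bijective {G₁ G₂ : WGraph n} (h : G₁.IsStable g) (π : Hom G₁ G₂)
    (hπ : Function.Bijective π.toFun) : G₂.IsStable g := by
  let f := Equiv.ofBijective _ hπ
  have hr : ∀ x, f (G₁.r x) = G₂.r (f x) := π.map_r
  have hi : ∀ x, f (G₁.i x) = G₂.i (f x) := π.map_i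
  have hh : ∀ v, G₂.h (mapV f hr v) = G₁.h v := fun v =>
    π.h_eq_of_injective hπ.1 v (mapV f hr v) rfl
  refine ⟨h.connected.map f hr hi, ?_, fun v => ?_⟩
  · rw [genus_map f hr hi h.connected G₁.h G₂.h hh, h.genus_eq]
  · obtain ⟨w, rfl⟩ := (mapV f hr).surjective v
    rw [hh, val_map]
    exact h.pos w

/-! ### Subdivisions of a stable graph and the standard triples. -/

section Subdivision

variable (G : Graph) (Ex : Set G.E)

open Classical in
/-- The involution of the subdivision of the edges in `Ex`. -/
noncomputable def subI : G.X ⊕ (Ex × Option Bool) → G.X ⊕ (Ex × Option Bool)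
  | .inl x => if h : ∃ p : Ex × Bool, x = half p.1.1 p.2 then .inr (h.choose.1, some h.choose.2)
      else .inl (G.i x)
  | .inr (e, none) => .inr (e, none)
  | .inr (e, some b) => .inl (half e.1 b)

variable {G Ex}

theorem subI_half_mem (e : Ex) (b : Bool) : subI G Ex (.inl (half e.1 b)) = .inr (e, some b) := by
  have h : ∃ p : Ex × Bool, half e.1 b = half p.1.1 p.2 := ⟨(e, b), rfl⟩
  rw [subI, dif_pos h]
  obtain ⟨h1, h2⟩ := half_inj h.choose_spec
  rw [← Subtype.ext h1, ← h2]

theorem subI_half_not_mem {e : G.E} (he : e ∉ Ex) (b : Bool) :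
    subI G Ex (.inl (half e b)) = .inl (half e (!b)) := by
  rw [subI, dif_neg, i_half]
  rintro ⟨p, hp⟩
  exact he ((half_inj hp).1 ▸ p.1.2)

theorem subI_of_fixed {x : G.X} (hx : G.i x = x) : subI G Ex (.inl x) = .inl x := by
  rw [subI, dif_neg, hx]
  rintro ⟨p, rfl⟩
  exact isHalfEdge_half _ _ hx

variable (G Ex)

/-- The graph obtained by inserting a vertex in every edge of `Ex`. -/
noncomputable def subGraph : Graph where
  X := G.X ⊕ (Ex × Option Bool)
  finite := inferInstance
  r := Sum.map G.r fun p => (p.1, none)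
  i := subI G Ex
  r_r x := by rcases x with x | x <;> simp [G.r_r]
  i_i x := by
    rcases x with x | ⟨e, _ | b⟩
    · rcases eq_half_or x with h | ⟨e, b, rfl⟩
      · rw [subI_of_fixed h, subI_of_fixed h]
      · by_cases he : e ∈ Ex
        · rw [subI_half_mem ⟨e, he⟩]
          rfl
        · rw [subI_half_not_mem he, subI_half_not_mem he, Bool.not_not]
    · rfl
    · exact subI_half_mem e b
  i_r x := by
    rcases x with x | x
    · exact subI_of_fixed (G.i_r x)
    · rfl

variable {G Ex}

theorem subGraph_i_half_mem (e : Ex) (b : Bool) :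
    (subGraph G Ex).i (.inl (half e.1 b)) = .inr (e, some b) := subI_half_mem e b

theorem subGraph_i_half_not_mem {e : G.E} (he : e ∉ Ex) (b : Bool) :
    (subGraph G Ex).i (.inl (half e b)) = .inl (half e (!b)) := subI_half_not_mem he b

theorem subGraph_i_fixed {x : G.X} (hx : G.i x = x) :
    (subGraph G Ex).i (.inl x) = .inl x := subI_of_fixed hx

theorem subGraph_isVertex_inl {x : G.X} :
    (subGraph G Ex).IsVertex (.inl x) ↔ G.IsVertex x :=
  Sum.inl_injective.eq_iff

theorem subGraph_isVertex_inr {e : Ex} {b : Option Bool} :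
    (subGraph G Ex).IsVertex (.inr (e, b)) ↔ b = none := by
  constructor
  · intro h
    have h1 : (Sum.inr (e, none) : G.X ⊕ (Ex × Option Bool)) = .inr (e, b) := h
    exact (congrArg Prod.snd (Sum.inr_injective h1)).symm
  · rintro rfl
    rfl

variable (G Ex)

/-- The vertices of the subdivision. -/
noncomputable def subV : G.V ⊕ Ex ≃ (subGraph G Ex).V :=
  Equiv.ofBijective
    (Sum.elim (fun v => ⟨.inl v.1, subGraph_isVertex_inl.2 v.2⟩)
      fun e => ⟨.inr (e, none), subGraph_isVertex_inr.2 rfl⟩) (by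
    constructor
    · rintro (v | e) (w | e') h
      · exact congrArg _ (Subtype.ext (Sum.inl_injective (congrArg Subtype.val h)))
      · exact absurd (congrArg Subtype.val h) Sum.inl_ne_inr
      · exact absurd (congrArg Subtype.val h) Sum.inr_ne_inl
      · exact congrArg _ (congrArg Prod.fst (Sum.inr_injective (congrArg Subtype.val h)))
    · rintro ⟨x | ⟨e, b⟩, hx⟩
      · exact ⟨.inl ⟨x, subGraph_isVertex_inl.1 hx⟩, rfl⟩
      · obtain rfl := subGraph_isVertex_inr.1 hx
        exact ⟨.inr e, rfl⟩)

/-- The edges of the subdivision. -/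
noncomputable def subPres : EdgePres (subGraph G Ex) ({e // e ∉ Ex} ⊕ (Ex × Bool)) where
  h j b := match j with
    | .inl e => .inl (half e.1 b)
    | .inr (e, c) => cond b (.inl (half e.1 c)) (.inr (e, some c))
  conj j b := by
    rcases j with e | ⟨e, c⟩
    · exact subI_half_not_mem e.2 b
    · cases b
      · rfl
      · exact subI_half_mem e c
  ne j h := by
    rcases j with e | ⟨e, c⟩
    · simpa using (half_inj (Sum.inl_injective h)).2
    · exact Sum.inl_ne_inr h
  inj j j' b b' h := by
    rcases j with e | ⟨e, c⟩ <;> rcases j' with e' | ⟨e', c'⟩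
    · exact congrArg _ (Subtype.ext (half_inj (Sum.inl_injective h)).1)
    · cases b'
      · exact absurd h Sum.inl_ne_inr
      · exact absurd ((half_inj (Sum.inl_injective h)).1 ▸ e'.2) e.2
    · cases b
      · exact absurd h Sum.inr_ne_inl
      · exact absurd ((half_inj (Sum.inl_injective h)).1 ▸ e.2) e'.2
    · cases b <;> cases b'
      · have := Sum.inr_injective h
        simp only [Prod.mk.injEq, Option.some.injEq] at this
        rw [this.1, this.2]
      · exact absurd h Sum.inr_ne_inl
      · exact absurd h Sum.inl_ne_inr
      · have := half_inj (Sum.inl_injective h)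
        rw [Subtype.ext this.1, this.2]
  surj x hx := by
    rcases x with x | ⟨e, _ | b⟩
    · rcases eq_half_or x with h | ⟨e, b, rfl⟩
      · exact absurd (subI_of_fixed h) hx
      · by_cases he : e ∈ Ex
        · exact ⟨.inr (⟨e, he⟩, b), true, rfl⟩
        · exact ⟨.inl ⟨e, he⟩, b, rfl⟩
    · exact absurd rfl hx
    · exact ⟨.inr (e, b), false, rfl⟩

theorem subGraph_connected (h : G.Connected) : (subGraph G Ex).Connected := by
  obtain ⟨⟨x⟩, h⟩ := h
  have hinr : ∀ (e : Ex) (o : Option Bool), Relation.EqvGen (subGraph G Ex).Step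
      (.inr (e, o)) (.inr (e, none)) := fun e o => eqvGen_r (G := subGraph G Ex) (.inr (e, o))
  have hhalf : ∀ (e : Ex) (b : Bool), Relation.EqvGen (subGraph G Ex).Step
      (.inl (half e.1 b)) (.inr (e, none)) := by
    intro e b
    have h1 := eqvGen_i (G := subGraph G Ex) (.inl (half e.1 b))
    rw [subGraph_i_half_mem] at h1
    exact h1.trans _ _ _ (hinr e _)
  have hmap : ∀ a b, Relation.EqvGen G.Step a b →
      Relation.EqvGen (subGraph G Ex).Step (.inl a) (.inl b) := by
    intro a b hab
    induction hab with
    | rel a b hab =>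
      rcases hab with rfl | rfl
      · exact eqvGen_r (G := subGraph G Ex) (.inl a)
      · rcases eq_half_or a with ha | ⟨e, b, rfl⟩
        · rw [ha]
          exact .refl _
        · by_cases he : e ∈ Ex
          · rw [i_half]
            exact (hhalf ⟨e, he⟩ b).trans _ _ _ ((hhalf ⟨e, he⟩ (!b)).symm)
          · have h1 := eqvGen_i (G := subGraph G Ex) (.inl (half e b))
            rwa [subGraph_i_half_not_mem he, ← i_half] at h1
    | refl a => exact .refl _
    | symm a b _ ih => exact ih.symm
    | trans a b c _ _ ih1 ih2 => exact ih1.trans _ _ _ ih2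
  refine connected_of_center (G := subGraph G Ex) (.inl x) fun y => ?_
  rcases y with y | ⟨e, o⟩
  · exact hmap _ _ (h y x)
  · exact (hinr e o).trans _ _ _ (((hhalf e true).symm).trans _ _ _ (hmap _ _ (h _ x)))

theorem val_subV_inl (v : G.V) : val (subV G Ex (.inl v)) = val v := by
  refine (Nat.card_congr (Equiv.ofBijective
    (fun f => ⟨.inl f.1, fun h => f.2.1 (Sum.inl_injective h), congrArg Sum.inl f.2.2⟩)
    ⟨fun f f' h => Subtype.ext (Sum.inl_injective (congrArg Subtype.val h)), ?_⟩)).symm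
  rintro ⟨x | p, hx, hr⟩
  · exact ⟨⟨x, fun h => hx (congrArg Sum.inl h), Sum.inl_injective hr⟩, rfl⟩
  · exact absurd hr Sum.inr_ne_inl

theorem val_subV_inr (e : Ex) : val (subV G Ex (.inr e)) = 2 := by
  have h2 : Nat.card Bool = 2 := by simp
  rw [← h2]
  refine (Nat.card_congr (Equiv.ofBijective
    (fun b => ⟨.inr (e, some b),
      fun h => absurd (subGraph_isVertex_inr.1 h) (Option.some_ne_none b), rfl⟩)
    ⟨fun b b' h => ?_, ?_⟩)).symm
  · have := Sum.inr_injective (congrArg Subtype.val h)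
    simpa using this
  · rintro ⟨x | ⟨e', _ | b⟩, hx, hr⟩
    · exact absurd hr Sum.inl_ne_inr
    · exact absurd rfl hx
    · have : e' = e := congrArg Prod.fst (Sum.inr_injective hr)
      subst this
      exact ⟨b, rfl⟩

end Subdivision

variable {n g : ℕ} (G : WGraph n) (Ex : Set G.E)

/-- The subdivision of a marked weighted graph. -/
noncomputable def subW : WGraph n where
  toGraph := subGraph G.toGraph Ex
  h v := Sum.elim G.h (fun _ => 0) ((subV G.toGraph Ex).symm v)
  m := Equiv.ofBijective (fun j => ⟨.inl (G.m j).1,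
      fun h => (G.m j).2.1 (subGraph_isVertex_inl.1 h), subI_of_fixed (G.m j).2.2⟩) (by
    constructor
    · intro j j' h
      exact G.m.injective (Subtype.ext (Sum.inl_injective (congrArg Subtype.val h)))
    · rintro ⟨x | ⟨e, _ | b⟩, hx, hi⟩
      · have h1 : G.i x = x := by
          rcases eq_half_or x with h | ⟨e, b, rfl⟩
          · exact h
          · by_cases he : e ∈ Ex
            · exact absurd ((subGraph_i_half_mem ⟨e, he⟩ b).symm.trans hi) Sum.inr_ne_inl
            · simpa using
                (half_inj (Sum.inl_injective ((subGraph_i_half_not_mem he b).symm.trans hi))).2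
        obtain ⟨j, hj⟩ := G.m.surjective ⟨x, fun h => hx (subGraph_isVertex_inl.2 h), h1⟩
        exact ⟨j, Subtype.ext (congrArg Sum.inl (congrArg Subtype.val hj))⟩
      · exact absurd rfl hx
      · exact absurd hi Sum.inl_ne_inr)

theorem subW_h (x : G.V ⊕ Ex) : (subW G Ex).h (subV G.toGraph Ex x) = Sum.elim G.h (fun _ => 0) x :=
  congrArg _ ((subV G.toGraph Ex).symm_apply_apply x)

variable {G}

/-- A vertex of weight zero and valence two violates the stability inequality, so only the inserted
vertices can be exceptional. -/
theorem subW_isExc (hG : G.IsStable g) (x : G.V ⊕ Ex) :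
    (subW G Ex).IsExc (subV G.toGraph Ex x) ↔ ∃ e, x = .inr e := by
  rcases x with v | e
  · refine iff_of_false ?_ (by simp)
    rintro ⟨h1, h2⟩
    rw [subW_h] at h1
    have h1 : G.h v = 0 := h1
    have h2 : val (subV G.toGraph Ex (.inl v)) = 2 := h2
    rw [val_subV_inl] at h2
    have := hG.pos v
    rw [h1, h2] at this
    norm_num at this
  · exact iff_of_true ⟨subW_h G Ex (.inr e), val_subV_inr G.toGraph Ex e⟩ ⟨e, rfl⟩

theorem subW_isExc_root_inl (hG : G.IsStable g) (x : G.X) :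
    ¬ (subW G Ex).IsExc (root (G := (subW G Ex).toGraph) (.inl x)) := by
  intro h
  obtain ⟨e, he⟩ := (subW_isExc Ex hG (.inl (root x))).1 h
  exact absurd he Sum.inl_ne_inr

theorem subW_isExc_root_inr (hG : G.IsStable g) (p : Ex × Option Bool) :
    (subW G Ex).IsExc (root (G := (subW G Ex).toGraph) (.inr p)) :=
  (subW_isExc Ex hG (.inr p.1)).2 ⟨_, rfl⟩

theorem subW_isQuasiStable (hG : G.IsStable g) : (subW G Ex).IsQuasiStable g where
  connected := subGraph_connected _ _ hG.connected
  genus_eq := by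
    classical
    have : Fintype Ex := Fintype.ofFinite _
    have h1 := genus_eq_of_pres hG.connected (EdgePres.self _) (Equiv.refl _) G.h
    rw [hG.genus_eq] at h1
    have h2 := genus_eq_of_pres (subGraph_connected _ Ex hG.connected) (subPres G.toGraph Ex)
      (subV G.toGraph Ex) (subW G Ex).h
    -- Each subdivided edge becomes two and brings one new vertex of weight zero, so the Euler
    -- characteristic and the total weight stay the same.
    have h3 : Nat.card G.E = Nat.card {e // e ∉ Ex} + Nat.card Ex := by
      rw [← Nat.card_sum]
      exact Nat.card_congr ((Equiv.sumComm _ _).trans (Equiv.sumCompl (· ∈ Ex))).symm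
    refine h2.trans ?_
    rw [h1, Fintype.sum_sum_type, Nat.card_sum, Nat.card_sum, Nat.card_prod, h3]
    simp only [subW_h, Equiv.refl_apply]
    simp
    ring
  two_le_val v := by
    obtain ⟨x, rfl⟩ := (subV G.toGraph Ex).surjective v
    intro h
    rw [subW_h] at h
    rcases x with v | e
    · have h : G.h v = 0 := h
      change 2 ≤ val (subV G.toGraph Ex (.inl v))
      rw [val_subV_inl]
      have := hG.pos v
      rw [h] at this
      simp only [Nat.cast_zero] at this
      omega
    · exact (val_subV_inr G.toGraph Ex e).ge
  exc_edges v hv f hf hr := by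
    subst hr
    rcases f with x | ⟨e, _ | b⟩
    · exact absurd hv (subW_isExc_root_inl Ex hG x)
    · exact absurd rfl hf
    · refine ⟨fun h => ?_, fun h => ?_⟩
      · exact absurd h Sum.inl_ne_inr
      · exact absurd (congrArg Subtype.val h) Sum.inl_ne_inr
  exc_not_adj v w hv hw hvw := by
    rintro ⟨f, hf, rfl, rfl⟩
    rcases f with x | ⟨e, _ | b⟩
    · exact absurd hv (subW_isExc_root_inl Ex hG x)
    · exact hvw rfl
    · exact absurd hw (subW_isExc_root_inl Ex hG (half e.1 b))

theorem subW_other (hG : G.IsStable g) (e : Ex) (b : Bool) :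
    (subW G Ex).other (.inr (e, some b)) = .inr (e, some (!b)) := by
  have hf : ∀ b, (subW G Ex).IsFlag (.inr (e, some b)) := fun b h =>
    absurd (subGraph_isVertex_inr.1 h) (Option.some_ne_none b)
  obtain ⟨-, -, -, h⟩ := WGraph.other_spec (hf b) (subW_isExc_root_inr Ex hG (e, some b))
  refine (h _ (hf (!b)) rfl fun h1 => ?_).symm
  have := Sum.inr_injective h1
  simp at this

theorem WGraph.stI_of_isExc {G : WGraph n} {x y : G.X} (h : G.i x = y) (hy : G.IsExc (root y)) :
    G.stI x = G.i (G.other y) := by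
  subst h
  rw [WGraph.stI, if_pos hy]

theorem WGraph.stI_of_not_isExc {G : WGraph n} {x y : G.X} (h : G.i x = y)
    (hy : ¬ G.IsExc (root y)) : G.stI x = y := by
  subst h
  rw [WGraph.stI, if_neg hy]

theorem subW_stI (hG : G.IsStable g) (x : G.X) : (subW G Ex).stI (.inl x) = .inl (G.i x) := by
  rcases eq_half_or x with h | ⟨e, b, rfl⟩
  · rw [h]
    exact WGraph.stI_of_not_isExc (G := subW G Ex) (subGraph_i_fixed h)
      (subW_isExc_root_inl Ex hG x)
  · rw [i_half]
    by_cases he : e ∈ Ex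
    · refine (WGraph.stI_of_isExc (G := subW G Ex) (subGraph_i_half_mem ⟨e, he⟩ b)
        (subW_isExc_root_inr Ex hG _)).trans ?_
      rw [subW_other Ex hG]
      rfl
    · exact WGraph.stI_of_not_isExc (G := subW G Ex) (subGraph_i_half_not_mem he b)
        (subW_isExc_root_inl Ex hG _)

/-- The elements of a stable graph are those of the stabilization of a subdivision. -/
noncomputable def subStEquiv (hG : G.IsStable g) :
    G.X ≃ (WGraph.st (subW_isQuasiStable Ex hG)).X :=
  Equiv.ofBijective (fun x => ⟨.inl x, subW_isExc_root_inl Ex hG x⟩) (by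
    constructor
    · intro x y h
      exact Sum.inl_injective (congrArg Subtype.val h)
    · rintro ⟨x | p, hx⟩
      · exact ⟨x, rfl⟩
      · exact absurd (subW_isExc_root_inr Ex hG p) hx)

/-- The object given by a set of exceptional edges and a divisor on the non-exceptional
vertices. -/
noncomputable def QD.canon (hG : G.IsStable g) (D : G.V → ℤ) : QD g G where
  G := subW G Ex
  qs := subW_isQuasiStable Ex hG
  D v := Sum.elim D (fun _ => 1) ((subV G.toGraph Ex).symm v)
  admissible v hv := by
    obtain ⟨x, rfl⟩ := (subV G.toGraph Ex).surjective v
    obtain ⟨e, rfl⟩ := (subW_isExc Ex hG x).1 hv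
    simp
  ρ := Hom.ofIso (subStEquiv Ex hG) (fun _ => rfl) (fun x => Subtype.ext (subW_stI Ex hG x).symm)
    (fun _ => rfl) fun v w hw => by
      have h1 : (subV G.toGraph Ex (.inl v)).1 = w.1.1 := congrArg Subtype.val hw
      have h2 := subW_h G Ex (.inl v)
      refine Eq.trans ?_ h2
      exact congrArg (subW G Ex).h (Subtype.ext h1.symm)
  ρ_bij := (subStEquiv Ex hG).bijective

section

variable (hG : G.IsStable g) (D : G.V → ℤ)

theorem QD.canon_D (x : G.V ⊕ Ex) :
    (QD.canon Ex hG D).D (subV G.toGraph Ex x) = Sum.elim D (fun _ => 1) x :=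
  congrArg _ ((subV G.toGraph Ex).symm_apply_apply x)

theorem QD.canon_isExcEdge (e : G.E) : (QD.canon Ex hG D).IsExcEdge e ↔ e ∈ Ex := by
  unfold QD.IsExcEdge
  change (subW G Ex).IsExc (root (G := (subW G Ex).toGraph)
    (subI G.toGraph Ex (.inl (half e true)))) ↔ _
  by_cases he : e ∈ Ex
  · rw [subI_half_mem ⟨e, he⟩]
    exact iff_of_true (subW_isExc_root_inr Ex hG _) he
  · rw [subI_half_not_mem he]
    exact iff_of_false (subW_isExc_root_inl Ex hG _) he

end

/-! ### Every triple is a subdivision; the local behaviour of morphisms. -/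

namespace QD

variable {n g : ℕ} {Gb : WGraph n} (o : QD g Gb)

theorem emb_injective : Function.Injective o.emb := fun _ _ h =>
  o.ρ_bij.1 (Subtype.ext h)

theorem emb_r (y : Gb.X) : o.emb (Gb.r y) = o.G.r (o.emb y) := congrArg Subtype.val (o.ρ.map_r y)

theorem root_emb (y : Gb.X) : root (o.emb y) = o.embV (root y) := Subtype.ext (o.emb_r y).symm

theorem not_isExc_emb (y : Gb.X) : ¬ o.G.IsExc (root (o.emb y)) := (o.ρ.toFun y).2

theorem not_isExc_embV (v : Gb.V) : ¬ o.G.IsExc (o.embV v) := by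
  have h : root v.1 = v := Subtype.ext v.2
  rw [← h, ← root_emb]
  exact o.not_isExc_emb _

theorem exists_emb {x : o.G.X} (hx : ¬ o.G.IsExc (root x)) : ∃ y, o.emb y = x := by
  obtain ⟨y, hy⟩ := o.ρ_bij.2 ⟨x, hx⟩
  exact ⟨y, congrArg Subtype.val hy⟩

theorem stI_emb (y : Gb.X) : o.G.stI (o.emb y) = o.emb (Gb.i y) :=
  (congrArg Subtype.val (o.ρ.map_i y)).symm

theorem isVertex_emb_iff {y : Gb.X} : o.G.IsVertex (o.emb y) ↔ Gb.IsVertex y := by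
  unfold IsVertex
  rw [← emb_r, o.emb_injective.eq_iff]

theorem i_emb_eq_iff {y : Gb.X} : o.G.i (o.emb y) = o.emb y ↔ Gb.i y = y := by
  rw [← WGraph.stI_eq_self_iff o.qs (o.not_isExc_emb y), stI_emb, o.emb_injective.eq_iff]

theorem isHalfEdge_emb_half (e : Gb.E) (b : Bool) : o.G.IsHalfEdge (o.emb (half e b)) := fun h =>
  isHalfEdge_half e b (o.i_emb_eq_iff.1 h)

theorem embV_injective : Function.Injective o.embV := fun _ _ h =>
  Subtype.ext (o.emb_injective (congrArg (fun z : o.G.V => z.1) h))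

/-- Conjugation in `Gb` corresponds to `stI`, which passes from one flag of the exceptional vertex
to the other. Hence the conjugates in `o.G` of the two halves of `e` are the two flags of one
exceptional vertex. -/
theorem i_emb_half_of_isExc {e : Gb.E} {b : Bool}
    (h : o.G.IsExc (root (o.G.i (o.emb (half e b))))) :
    o.G.i (o.emb (half e (!b))) = o.G.other (o.G.i (o.emb (half e b))) ∧
      o.G.r (o.G.i (o.emb (half e (!b)))) = o.G.r (o.G.i (o.emb (half e b))) := by
  have h1 := o.stI_emb (half e b)
  rw [WGraph.stI_of_isExc rfl h, i_half] at h1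
  have h2 : o.G.i (o.emb (half e (!b))) = o.G.other (o.G.i (o.emb (half e b))) := by
    rw [← h1, o.G.i_i]
  refine ⟨h2, ?_⟩
  rw [h2]
  exact congrArg Subtype.val (WGraph.exc_pair o.qs (o.not_isExc_emb _) h).2.2.1

theorem isExc_root_i_emb_half (e : Gb.E) (b : Bool) :
    o.G.IsExc (root (o.G.i (o.emb (half e b)))) ↔ o.IsExcEdge e := by
  have h1 : ∀ b, o.G.IsExc (root (o.G.i (o.emb (half e b)))) →
      o.G.IsExc (root (o.G.i (o.emb (half e (!b))))) := by
    intro b h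
    rwa [WGraph.root_eq_iff.2 (o.i_emb_half_of_isExc h).2]
  cases b
  · exact ⟨h1 false, h1 true⟩
  · exact Iff.rfl

theorem i_emb_half_of_not_isExcEdge {e : Gb.E} (he : ¬ o.IsExcEdge e) (b : Bool) :
    o.G.i (o.emb (half e b)) = o.emb (half e (!b)) := by
  rw [← i_half, ← stI_emb]
  exact (WGraph.stI_of_not_isExc rfl (by rwa [isExc_root_i_emb_half])).symm

/-- The exceptional vertex on an exceptional edge. -/
noncomputable def excV (e : Gb.E) : o.G.V := root (o.G.i (o.emb (half e true)))

theorem isExc_excV {e : Gb.E} (he : o.IsExcEdge e) : o.G.IsExc (o.excV e) := he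

theorem r_i_emb_half {e : Gb.E} (he : o.IsExcEdge e) (b : Bool) :
    o.G.r (o.G.i (o.emb (half e b))) = (o.excV e).1 := by
  cases b
  · exact (o.i_emb_half_of_isExc (b := true) he).2
  · rfl

/-- The edges of `Gb` on which there is an exceptional vertex. -/
def excSet : Set Gb.E := {e | o.IsExcEdge e}

/-- The map from the subdivision of `Gb` to the graph of `o`. -/
noncomputable def subMap : Gb.X ⊕ (o.excSet × Option Bool) → o.G.X
  | .inl y => o.emb y
  | .inr (e, none) => (o.excV e.1).1
  | .inr (e, some b) => o.G.i (o.emb (half e.1 b))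

theorem isExc_root_subMap_inr (p : o.excSet × Option Bool) :
    root (o.subMap (.inr p)) = o.excV p.1.1 := by
  obtain ⟨e, _ | b⟩ := p
  · exact Subtype.ext (o.excV e.1).2
  · exact Subtype.ext (o.r_i_emb_half e.2 b)

/-- A flag at an exceptional vertex is a half-edge whose conjugate is rooted at a non-exceptional
vertex, so it comes from a half of an edge of `Gb`; this gives surjectivity. An exceptional vertex
has only two flags, and they are the conjugates of the two halves of one edge, so it determines that
edge; this gives injectivity. -/
theorem subMap_bijective : Function.Bijective o.subMap := by
  have hexc : ∀ p : o.excSet × Option Bool, o.G.IsExc (root (o.subMap (.inr p))) := by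
    intro p
    rw [isExc_root_subMap_inr]
    exact o.isExc_excV p.1.2
  have hhalf : ∀ (e e' : o.excSet) (b b' : Bool),
      o.subMap (.inr (e, some b)) = o.subMap (.inr (e', some b')) → e = e' ∧ b = b' := by
    intro e e' b b' h
    have h1 : o.G.i (o.emb (half e.1 b)) = o.G.i (o.emb (half e'.1 b')) := h
    have h2 := congrArg o.G.i h1
    rw [o.G.i_i, o.G.i_i] at h2
    have h3 := half_inj (o.emb_injective h2)
    exact ⟨Subtype.ext h3.1, h3.2⟩
  have hflag : ∀ (e : o.excSet) (b : Bool), o.G.IsFlag (o.G.i (o.emb (half e.1 b))) := fun e b =>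
    (o.isHalfEdge_emb_half _ _).conj.not_isVertex
  constructor
  · rintro (y | ⟨e, b⟩) (y' | ⟨e', b'⟩) h
    · exact congrArg _ (o.emb_injective h)
    · exact absurd (hexc (e', b')) (by rw [← h]; exact o.not_isExc_emb y)
    · exact absurd (hexc (e, b)) (by rw [h]; exact o.not_isExc_emb y')
    · have he : e = e' := by
        have h1 : o.excV e.1 = o.excV e'.1 := by
          rw [← isExc_root_subMap_inr o (e, b), ← isExc_root_subMap_inr o (e', b'), h]
        obtain ⟨-, -, -, hu⟩ := WGraph.other_spec (hflag e true) (o.isExc_excV e.2)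
        by_cases h2 : o.subMap (.inr (e', some true)) = o.subMap (.inr (e, some true))
        · exact (hhalf _ _ _ _ h2).1.symm
        · have h3 := hu _ (hflag e' true) (congrArg Subtype.val h1).symm h2
          rw [← (o.i_emb_half_of_isExc (b := true) e.2).1] at h3
          exact (hhalf e' e true false h3).1.symm
      subst he
      rcases b with _ | b <;> rcases b' with _ | b'
      · rfl
      · have h1 : (o.excV e.1).1 = o.G.i (o.emb (half e.1 b')) := h
        exact absurd (h1 ▸ (o.excV e.1).2) (hflag e b')
      · have h1 : o.G.i (o.emb (half e.1 b)) = (o.excV e.1).1 := h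
        exact absurd (h1 ▸ (o.excV e.1).2) (hflag e b)
      · rw [(hhalf _ _ _ _ h).2]
  · intro x
    by_cases hx : o.G.IsExc (root x)
    · have key : ∀ f, o.G.IsFlag f → o.G.IsExc (root f) →
          ∃ (e : o.excSet) (b : Bool), f = o.G.i (o.emb (half e.1 b)) := by
        intro f hf he
        obtain ⟨h1, h2⟩ := o.qs.exc_edges _ he f hf rfl
        have h3 : ¬ o.G.IsExc (root (o.G.i f)) := fun h3 =>
          o.qs.exc_not_adj _ _ he h3 h2.symm ⟨f, h1, rfl, rfl⟩
        obtain ⟨y, hy⟩ := o.exists_emb h3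
        have hy1 : Gb.IsHalfEdge y := fun h => by
          rw [← o.i_emb_eq_iff, hy, o.G.i_i] at h
          exact h1 h.symm
        obtain ⟨e, b, rfl⟩ := exists_half hy1
        have h4 : f = o.G.i (o.emb (half e b)) := by rw [hy, o.G.i_i]
        refine ⟨⟨e, ?_⟩, b, h4⟩
        rw [h4, isExc_root_i_emb_half] at he
        exact he
      by_cases hv : o.G.IsVertex x
      · have h2 := hx.2
        unfold val at h2
        have h3 : 0 < Nat.card {f : o.G.X // o.G.IsFlag f ∧ o.G.r f = (root x).1} := by omega
        obtain ⟨⟨f, hf, hfr⟩⟩ := (Nat.card_pos_iff.1 h3).1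
        have h4 : root f = root x := Subtype.ext hfr
        obtain ⟨e, b, rfl⟩ := key f hf (h4 ▸ hx)
        refine ⟨.inr (e, none), ?_⟩
        have h5 := o.r_i_emb_half e.2 b
        rw [hfr] at h5
        exact h5.symm.trans hv
      · obtain ⟨e, b, h⟩ := key x hv hx
        exact ⟨.inr (e, some b), h.symm⟩
    · obtain ⟨y, hy⟩ := o.exists_emb hx
      exact ⟨.inl y, hy⟩

/-- The graph of `o` is a subdivision of `Gb`. -/
noncomputable def subEquiv : (subW Gb o.excSet).X ≃ o.G.X :=
  Equiv.ofBijective o.subMap o.subMap_bijective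

theorem subEquiv_r (x : (subW Gb o.excSet).X) :
    o.subEquiv ((subW Gb o.excSet).r x) = o.G.r (o.subEquiv x) := by
  rcases x with y | p
  · exact o.emb_r y
  · exact (congrArg Subtype.val (o.isExc_root_subMap_inr p)).symm

theorem subEquiv_i (x : (subW Gb o.excSet).X) :
    o.subEquiv ((subW Gb o.excSet).i x) = o.G.i (o.subEquiv x) := by
  rcases x with y | ⟨e, _ | b⟩
  · rcases eq_half_or y with h | ⟨e, b, rfl⟩
    · rw [show (subW Gb o.excSet).i (.inl y) = .inl y from subGraph_i_fixed h]
      exact (o.i_emb_eq_iff.2 h).symm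
    · by_cases he : e ∈ o.excSet
      · rw [show (subW Gb o.excSet).i (.inl (half e b)) = .inr (⟨e, he⟩, some b) from
          subGraph_i_half_mem ⟨e, he⟩ b]
        rfl
      · rw [show (subW Gb o.excSet).i (.inl (half e b)) = .inl (half e (!b)) from
          subGraph_i_half_not_mem he b]
        exact (o.i_emb_half_of_not_isExcEdge he b).symm
  · exact (IsVertex.i_eq (o.excV e.1).2).symm
  · exact (o.G.i_i _).symm

/-- The vertices of the graph of `o`. -/
noncomputable def vEquiv : Gb.V ⊕ o.excSet ≃ o.G.V :=
  (subV Gb.toGraph o.excSet).trans (mapV o.subEquiv o.subEquiv_r)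

theorem D_excV {e : Gb.E} (he : o.IsExcEdge e) : o.D (o.excV e) = 1 :=
  o.admissible _ (o.isExc_excV he)

theorem subEquiv_symm_emb (y : Gb.X) : o.subEquiv.symm (o.emb y) = Sum.inl y :=
  o.subEquiv.symm_apply_eq.2 rfl

theorem subEquiv_h (v : (subW Gb o.excSet).V) (w : o.G.V) (h : o.subEquiv v.1 = w.1) :
    o.G.h w = (subW Gb o.excSet).h v := by
  obtain ⟨x, rfl⟩ := (subV Gb.toGraph o.excSet).surjective v
  have hw : w = o.vEquiv x := Subtype.ext h.symm
  rw [subW_h, hw]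
  rcases x with v | e
  · have h2 : ((WGraph.st o.qs).r (o.ρ.toFun v.1)) = o.ρ.toFun v.1 := by
      rw [← o.ρ.map_r, show Gb.r v.1 = v.1 from v.2]
    exact o.ρ.h_eq_of_injective o.ρ_bij.1 v ⟨o.ρ.toFun v.1, h2⟩ rfl
  · exact (o.isExc_excV e.2).1

/-- The isomorphism of `o` with the standard object with the same exceptional edges and the same
divisor. -/
noncomputable def toCanonHom : Hom o.G (subW Gb o.excSet) :=
  Hom.ofIso o.subEquiv.symm
    (fun x => by rw [Equiv.symm_apply_eq, subEquiv_r, Equiv.apply_symm_apply])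
    (fun x => by rw [Equiv.symm_apply_eq, subEquiv_i, Equiv.apply_symm_apply])
    (fun j => by
      have h : (o.G.m j).1 = o.emb (Gb.m j).1 := (congrArg Subtype.val (o.ρ.map_m j)).symm
      rw [h, subEquiv_symm_emb]
      rfl)
    (fun v w h => by
      rw [o.subEquiv_h w v]
      rw [← h, Equiv.apply_symm_apply])

theorem stMap_of_not_isVertex {G G' : WGraph n} (π : Hom G G') {x : G.X}
    (h : ¬ G'.IsVertex (π.toFun x)) : WGraph.stMap π x = π.toFun x := by
  rw [WGraph.stMap, if_neg fun h1 => h h1.2.2]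

theorem stMap_of_not_isHalfEdge {G G' : WGraph n} (π : Hom G G') {x : G.X}
    (h : ¬ G.IsHalfEdge x) : WGraph.stMap π x = π.toFun x := by
  rw [WGraph.stMap, if_neg fun h1 => h h1.1]

theorem stMap_of_isVertex {G G' : WGraph n} (π : Hom G G') {x : G.X}
    (h1 : G.IsHalfEdge x) (h2 : G.IsExc (root (G.i x))) (h : G'.IsVertex (π.toFun x)) :
    WGraph.stMap π x = π.toFun (G.other (G.i x)) := by
  rw [WGraph.stMap, if_pos ⟨h1, h2, h⟩]

variable {o}

namespace Mor

variable {o' : QD g Gb} (p : Mor o o')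

theorem map_emb_vertex {y : Gb.X} (hy : Gb.IsVertex y) : p.π.toFun (o.emb y) = o'.emb y := by
  rw [← p.map_ρ, stMap_of_not_isHalfEdge]
  exact fun h => h.not_isVertex (o.isVertex_emb_iff.2 hy)

theorem map_emb_of_not_isVertex {y : Gb.X} (h : ¬ o'.G.IsVertex (p.π.toFun (o.emb y))) :
    p.π.toFun (o.emb y) = o'.emb y := by
  rw [← p.map_ρ, stMap_of_not_isVertex _ h]

theorem map_i_emb_of_isVertex {e : Gb.E} {b : Bool} (he : o.IsExcEdge e)
    (h : o'.G.IsVertex (p.π.toFun (o.emb (half e b)))) :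
    p.π.toFun (o.G.i (o.emb (half e (!b)))) = o'.emb (half e b) := by
  have h1 := (o.isExc_root_i_emb_half e b).2 he
  rw [(o.i_emb_half_of_isExc h1).1, ← p.map_ρ,
    stMap_of_isVertex _ (o.isHalfEdge_emb_half e b) h1 h]

include p in
-- With no exceptional vertex on `e` in the source, `stMap` is `π` itself on both halves. They stay
-- conjugate in the target, which leaves no room for an exceptional vertex there.
theorem isExcEdge_of {e : Gb.E} (he : o'.IsExcEdge e) : o.IsExcEdge e := by
  by_contra h
  have h1 : ∀ b, p.π.toFun (o.emb (half e b)) = o'.emb (half e b) := by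
    intro b
    have h2 := p.map_ρ (half e b)
    rwa [WGraph.stMap, if_neg] at h2
    rintro ⟨-, h3, -⟩
    exact h ((o.isExc_root_i_emb_half e b).1 h3)
  have h2 := congrArg p.π.toFun (o.i_emb_half_of_not_isExcEdge h true)
  rw [p.π.map_i, h1, h1] at h2
  have h3 := (o'.isExc_root_i_emb_half e true).2 he
  rw [h2] at h3
  exact o'.not_isExc_emb _ h3

/-- If one piece were contracted, the far flag of the exceptional vertex would take the place of the
lost half-edge. Then the opposite half of `e` would map to a flag rooted at an exceptional vertex,
although `map_ρ` makes it an element of the stabilization. -/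
theorem not_isVertex_of_isExcEdge {e : Gb.E} (he : o'.IsExcEdge e) (b : Bool) :
    ¬ o'.G.IsVertex (p.π.toFun (o.emb (half e b))) := by
  intro h
  have h1 := congrArg o'.G.i (p.map_i_emb_of_isVertex (p.isExcEdge_of he) h)
  rw [← p.π.map_i, o.G.i_i] at h1
  have h2 : ¬ o'.G.IsVertex (p.π.toFun (o.emb (half e (!b)))) := by
    rw [h1]
    exact (o'.isHalfEdge_emb_half e b).conj.not_isVertex
  rw [p.map_emb_of_not_isVertex h2] at h1
  have h3 := (o'.isExc_root_i_emb_half e b).2 he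
  rw [← h1] at h3
  exact o'.not_isExc_emb _ h3

/-- If both pieces survived, the conjugate of one half and the other half would be two preimages of
the same flag. They are distinct, since only the first is rooted at the exceptional vertex. -/
theorem isVertex_not_of_not_isVertex {e : Gb.E} (ho : o.IsExcEdge e) (he : ¬ o'.IsExcEdge e)
    {b : Bool} (h : ¬ o'.G.IsVertex (p.π.toFun (o.emb (half e b)))) :
    o'.G.IsVertex (p.π.toFun (o.emb (half e (!b)))) := by
  by_contra h'
  have h1 := p.map_emb_of_not_isVertex h
  have h2 := p.map_emb_of_not_isVertex h'
  have h3 := o'.i_emb_half_of_not_isExcEdge he b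
  rw [← h1, ← p.π.map_i, ← h2] at h3
  obtain ⟨x, -, hx⟩ := p.π.flag_fiber _ h'
  have h4 := ((hx _).1 h3).trans ((hx _).1 rfl).symm
  have h5 := (o.isExc_root_i_emb_half e b).2 ho
  rw [h4] at h5
  exact o.not_isExc_emb _ h5

theorem map_embV (v : Gb.V) : p.π.toFun (o.embV v).1 = (o'.embV v).1 := p.map_emb_vertex v.2

theorem map_excV_of_isExcEdge {e : Gb.E} (he : o'.IsExcEdge e) :
    p.π.toFun (o.excV e).1 = (o'.excV e).1 := by
  change p.π.toFun (o.G.r (o.G.i (o.emb (half e true)))) = o'.G.r (o'.G.i (o'.emb (half e true)))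
  rw [p.π.map_r, p.π.map_i, p.map_emb_of_not_isVertex (p.not_isVertex_of_isExcEdge he true)]

theorem map_excV_of_isVertex {e : Gb.E} {b : Bool} (ho : o.IsExcEdge e)
    (h : o'.G.IsVertex (p.π.toFun (o.emb (half e b)))) :
    p.π.toFun (o.excV e).1 = (o'.embV (root (half e b))).1 := by
  rw [← o.r_i_emb_half ho b, p.π.map_r, p.π.map_i, h.i_eq, h.r_eq]
  have h1 := h.r_eq
  rw [← p.π.map_r, ← o.emb_r] at h1
  rw [← h1]
  exact p.map_emb_vertex (isVertex_r _)

end Mor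

end QD

/-! ### Contractions between standard subdivisions. -/

section Contraction

variable {n g : ℕ} (G : WGraph n) {Ex Ex' : Set G.E} (hEx : Ex' ⊆ Ex) (σ : G.E → Bool)

open Classical in
/-- The contraction of one half of every edge in `Ex` outside `Ex'`, at the end given by `σ`. -/
noncomputable def contr (Ex Ex' : Set G.E) (σ : G.E → Bool) :
    G.X ⊕ (Ex × Option Bool) → G.X ⊕ (Ex' × Option Bool)
  | .inl y => if ∃ e, e ∈ Ex ∧ e ∉ Ex' ∧ y = half e (σ e) then .inl (G.r y) else .inl y
  | .inr (e, o) => if h : e.1 ∈ Ex' then .inr (⟨e.1, h⟩, o)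
      else if o = some (!σ e.1) then .inl (half e.1 (σ e.1)) else .inl (G.r (half e.1 (σ e.1)))

variable {G} {σ}

theorem contr_half_self {e : G.E} (h : e ∈ Ex) (h' : e ∉ Ex') :
    contr G Ex Ex' σ (.inl (half e (σ e))) = .inl (G.r (half e (σ e))) := by
  rw [contr, if_pos ⟨e, h, h', rfl⟩]

theorem contr_half_not (e : G.E) :
    contr G Ex Ex' σ (.inl (half e (!σ e))) = .inl (half e (!σ e)) := by
  rw [contr, if_neg]
  rintro ⟨e', -, -, h⟩
  obtain ⟨rfl, h⟩ := half_inj h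
  simp at h

theorem contr_half_of_mem {e : G.E} (h' : e ∈ Ex') (b : Bool) :
    contr G Ex Ex' σ (.inl (half e b)) = .inl (half e b) := by
  rw [contr, if_neg]
  rintro ⟨e', -, h, he⟩
  exact h ((half_inj he).1 ▸ h')

theorem contr_half_of_not_mem {e : G.E} (h' : e ∉ Ex) (b : Bool) :
    contr G Ex Ex' σ (.inl (half e b)) = .inl (half e b) := by
  rw [contr, if_neg]
  rintro ⟨e', h, -, he⟩
  exact h' ((half_inj he).1 ▸ h)

theorem contr_fixed {y : G.X} (h : G.i y = y) : contr G Ex Ex' σ (.inl y) = .inl y := by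
  rw [contr, if_neg]
  rintro ⟨e', -, -, rfl⟩
  exact isHalfEdge_half _ _ h

theorem contr_inr_of_mem {e : Ex} (h : e.1 ∈ Ex') (o : Option Bool) :
    contr G Ex Ex' σ (.inr (e, o)) = .inr (⟨e.1, h⟩, o) := by
  rw [contr, dif_pos h]

theorem contr_inr_not {e : Ex} (h : e.1 ∉ Ex') :
    contr G Ex Ex' σ (.inr (e, some (!σ e.1))) = .inl (half e.1 (σ e.1)) := by
  rw [contr, dif_neg h, if_pos rfl]

theorem contr_inr_self {e : Ex} (h : e.1 ∉ Ex') :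
    contr G Ex Ex' σ (.inr (e, some (σ e.1))) = .inl (G.r (half e.1 (σ e.1))) := by
  rw [contr, dif_neg h, if_neg (by simp)]

theorem contr_inr_none {e : Ex} (h : e.1 ∉ Ex') :
    contr G Ex Ex' σ (.inr (e, none)) = .inl (G.r (half e.1 (σ e.1))) := by
  rw [contr, dif_neg h, if_neg (by simp)]

theorem bool_eq_or (b c : Bool) : b = c ∨ b = !c := by
  cases b <;> cases c <;> simp

theorem contr_r (x : (subW G Ex).X) :
    contr G Ex Ex' σ ((subW G Ex).r x) = (subW G Ex').r (contr G Ex Ex' σ x) := by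
  rcases x with y | ⟨e, o⟩
  · refine (contr_fixed (G.i_r y)).trans ?_
    by_cases h : ∃ e, e ∈ Ex ∧ e ∉ Ex' ∧ y = half e (σ e)
    · rw [contr, if_pos h]
      exact congrArg Sum.inl (G.r_r y).symm
    · rw [contr, if_neg h]
      rfl
  · by_cases h : e.1 ∈ Ex'
    · rw [contr_inr_of_mem h]
      exact contr_inr_of_mem h none
    · refine (contr_inr_none h).trans ?_
      by_cases ho : o = some (!σ e.1)
      · rw [ho, contr_inr_not h]
        rfl
      · rw [contr, dif_neg h, if_neg ho]
        exact congrArg Sum.inl (G.r_r _).symm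

include hEx in
theorem contr_i (x : (subW G Ex).X) :
    contr G Ex Ex' σ ((subW G Ex).i x) = (subW G Ex').i (contr G Ex Ex' σ x) := by
  have h1 : ∀ e b, contr G Ex Ex' σ ((subW G Ex).i (.inl (half e b))) =
      (subW G Ex').i (contr G Ex Ex' σ (.inl (half e b))) := by
    intro e b
    by_cases he : e ∈ Ex
    · rw [show (subW G Ex).i (.inl (half e b)) = _ from subGraph_i_half_mem ⟨e, he⟩ b]
      by_cases he' : e ∈ Ex'
      · rw [contr_half_of_mem he', contr_inr_of_mem he']
        exact (subGraph_i_half_mem ⟨e, he'⟩ b).symm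
      · rcases bool_eq_or b (σ e) with rfl | rfl
        · rw [contr_half_self he he']
          refine (contr_inr_self (e := ⟨e, he⟩) he').trans ?_
          exact (subGraph_i_fixed (G.i_r _)).symm
        · rw [contr_half_not]
          refine (contr_inr_not (e := ⟨e, he⟩) he').trans ?_
          refine Eq.trans ?_ (subGraph_i_half_not_mem he' _).symm
          rw [Bool.not_not]
    · have he' : e ∉ Ex' := fun h => he (hEx h)
      rw [show (subW G Ex).i (.inl (half e b)) = _ from subGraph_i_half_not_mem he b]
      rw [contr_half_of_not_mem he, contr_half_of_not_mem he]
      exact (subGraph_i_half_not_mem he' b).symm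
  rcases x with y | ⟨e, _ | b⟩
  · rcases eq_half_or y with h | ⟨e, b, rfl⟩
    · rw [show (subW G Ex).i (.inl y) = _ from subGraph_i_fixed h, contr_fixed h]
      exact (subGraph_i_fixed h).symm
    · exact h1 e b
  · have h2 : (subGraph G.toGraph Ex).IsVertex (.inr (e, none)) := subGraph_isVertex_inr.2 rfl
    have h3 : (subGraph G.toGraph Ex').IsVertex (contr G Ex Ex' σ (.inr (e, none))) := by
      have := contr_r (Ex' := Ex') (σ := σ) (.inr (e, none))
      exact this.symm
    exact h3.i_eq.symm
  -- This flag is conjugate to `half e.1 b`, so the identity proved for halves can be conjugated.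
  · have h2 := congrArg (subW G Ex').i (h1 e.1 b)
    replace h2 := h2.trans ((subW G Ex').i_i _)
    rw [show (subW G Ex).i (.inl (half e.1 b)) = _ from subGraph_i_half_mem e b] at h2
    exact h2.symm

/-- The elements contracted to a vertex. -/
theorem contr_eq_inl_vertex {v : G.X} (hv : G.IsVertex v) {x : G.X ⊕ (Ex × Option Bool)}
    (h : contr G Ex Ex' σ x = .inl v) :
    x = .inl v ∨ ∃ e : Ex, e.1 ∉ Ex' ∧ G.r (half e.1 (σ e.1)) = v ∧
      (x = .inl (half e.1 (σ e.1)) ∨ x = .inr (e, none) ∨ x = .inr (e, some (σ e.1))) := by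
  rcases x with y | ⟨e, o⟩
  · by_cases h1 : ∃ e, e ∈ Ex ∧ e ∉ Ex' ∧ y = half e (σ e)
    · obtain ⟨e, he, he', rfl⟩ := h1
      rw [contr_half_self he he'] at h
      exact Or.inr ⟨⟨e, he⟩, he', Sum.inl_injective h, Or.inl rfl⟩
    · rw [contr, if_neg h1] at h
      exact Or.inl (congrArg Sum.inl (Sum.inl_injective h))
  · by_cases h1 : e.1 ∈ Ex'
    · rw [contr_inr_of_mem h1] at h
      exact absurd h Sum.inr_ne_inl
    · right
      by_cases ho : o = some (!σ e.1)
      · rw [ho, contr_inr_not h1] at h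
        exact absurd (Sum.inl_injective h ▸ hv) (isHalfEdge_half _ _).not_isVertex
      · rw [contr, dif_neg h1, if_neg ho] at h
        refine ⟨e, h1, Sum.inl_injective h, Or.inr ?_⟩
        rcases o with _ | b
        · exact Or.inl rfl
        · rcases bool_eq_or b (σ e.1) with rfl | rfl
          · exact Or.inr rfl
          · exact absurd rfl ho

theorem contr_eq_inr {e : Ex'} {o : Option Bool} {x : G.X ⊕ (Ex × Option Bool)} :
    contr G Ex Ex' σ x = .inr (e, o) ↔ x = .inr (⟨e.1, hEx e.2⟩, o) := by
  constructor
  · rcases x with y | ⟨e', o'⟩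
    · rw [contr]
      split_ifs <;> exact False.elim
    · rw [contr]
      split_ifs
      · intro h
        have := Sum.inr_injective h
        rw [Prod.mk.injEq] at this
        obtain ⟨rfl, rfl⟩ := this
        rfl
      · exact False.elim
      · exact False.elim
  · rintro rfl
    exact contr_inr_of_mem e.2 o

include hEx in
-- For an edge that loses its inserted vertex, `half e (σ e)` itself is contracted, and the flag of
-- the inserted vertex on the opposite side is the one that maps onto it. All other surviving flags
-- are their own preimage.
theorem contr_flag_fiber (f : (subW G Ex').X) (hf : (subW G Ex').IsFlag f) :
    ∃ x, (subW G Ex).IsFlag x ∧ ∀ y, contr G Ex Ex' σ y = f ↔ y = x := by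
  rcases f with z | ⟨e, _ | b⟩
  · have hz : ¬ G.IsVertex z := fun h => hf (subGraph_isVertex_inl.2 h)
    by_cases h : ∃ e, e ∈ Ex ∧ e ∉ Ex' ∧ z = half e (σ e)
    · obtain ⟨e, he, he', rfl⟩ := h
      refine ⟨.inr (⟨e, he⟩, some (!σ e)),
        fun h => absurd (subGraph_isVertex_inr.1 h) (Option.some_ne_none _), fun x => ⟨?_, ?_⟩⟩
      · rcases x with y | ⟨e', o⟩
        · rw [contr]
          split_ifs with h1
          · intro h
            exact absurd (Sum.inl_injective h ▸ isVertex_r y) hz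
          · intro h
            exact absurd ⟨e, he, he', Sum.inl_injective h⟩ h1
        · rw [contr]
          split_ifs with h1 h2
          · exact False.elim
          · intro h
            have h3 := (half_inj (Sum.inl_injective h)).1
            obtain rfl : e' = ⟨e, he⟩ := Subtype.ext h3
            rw [h2]
          · intro h
            exact absurd (Sum.inl_injective h ▸ isVertex_r _) hz
      · rintro rfl
        exact contr_inr_not (e := ⟨e, he⟩) he'
    · refine ⟨.inl z, fun h => hz (subGraph_isVertex_inl.1 h), fun x => ⟨?_, ?_⟩⟩
      · rcases x with y | ⟨e', o⟩
        · rw [contr]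
          split_ifs with h1
          · intro h
            exact absurd (Sum.inl_injective h ▸ isVertex_r y) hz
          · exact fun h => congrArg Sum.inl (Sum.inl_injective h)
        · rw [contr]
          split_ifs with h1 h2
          · exact False.elim
          · intro h3
            exact absurd ⟨e'.1, e'.2, h1, (Sum.inl_injective h3).symm⟩ h
          · intro h
            exact absurd (Sum.inl_injective h ▸ isVertex_r _) hz
      · rintro rfl
        rw [contr, if_neg h]
  · exact absurd rfl hf
  · exact ⟨.inr (⟨e.1, hEx e.2⟩, some b),
      fun h => absurd (subGraph_isVertex_inr.1 h) (Option.some_ne_none _),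
      fun x => contr_eq_inr hEx⟩

section Fiber

/-- The edges of `Ex` one half of which is contracted to the vertex `v`. -/
def ContrTo (Ex Ex' : Set G.E) (σ : G.E → Bool) (v : G.V) : Type :=
  {e : Ex // e.1 ∉ Ex' ∧ G.r (half e.1 (σ e.1)) = v.1}

instance (v : G.V) : Finite (ContrTo Ex Ex' σ v) := inferInstanceAs (Finite {_e : Ex // _})

/-- The fiber of the contraction over a non-exceptional vertex. -/
noncomputable abbrev contrFiber (hEx : Ex' ⊆ Ex) (σ : G.E → Bool) (v : G.V) : Graph :=
  fiber (G₁ := (subW G Ex).toGraph) (G₂ := (subW G Ex').toGraph) (contr G Ex Ex' σ) contr_r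
    (contr_i hEx) (subV G.toGraph Ex' (.inl v))

theorem contrFiber_cases (v : G.V) (x : (contrFiber hEx σ v).X) :
    x.1 = .inl v.1 ∨ ∃ e : ContrTo Ex Ex' σ v, (x.1 = .inl (half e.1.1 (σ e.1.1)) ∨
      x.1 = .inr (e.1, none) ∨ x.1 = .inr (e.1, some (σ e.1.1))) := by
  rcases contr_eq_inl_vertex v.2 x.2 with h | ⟨e, h1, h2, h3⟩
  · exact Or.inl h
  · exact Or.inr ⟨⟨e, h1, h2⟩, h3⟩

/-- The vertex `v` in the fiber over it. -/
noncomputable def contrCenter (v : G.V) : (contrFiber hEx σ v).X :=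
  ⟨.inl v.1, contr_fixed (IsVertex.i_eq v.2)⟩

theorem contrFiber_connected (v : G.V) : (contrFiber hEx σ v).Connected := by
  have h1 : ∀ (e : ContrTo Ex Ex' σ v) (x : (contrFiber hEx σ v).X),
      x.1 = .inl (half e.1.1 (σ e.1.1)) →
      Relation.EqvGen (contrFiber hEx σ v).Step x (contrCenter hEx v) := by
    intro e x hx
    refine .rel _ _ (Or.inl (Subtype.ext ?_))
    change Sum.inl v.1 = (subW G Ex).r x.1
    rw [hx]
    exact congrArg Sum.inl e.2.2.symm
  have h2 : ∀ (e : ContrTo Ex Ex' σ v) (x : (contrFiber hEx σ v).X),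
      x.1 = .inr (e.1, some (σ e.1.1)) →
      Relation.EqvGen (contrFiber hEx σ v).Step x (contrCenter hEx v) := by
    intro e x hx
    refine (eqvGen_i x).trans _ _ _ (h1 e _ ?_)
    change (subW G Ex).i x.1 = _
    rw [hx]
    rfl
  refine connected_of_center (contrCenter hEx v) fun x => ?_
  rcases contrFiber_cases hEx v x with h | ⟨e, h | h | h⟩
  · rw [show x = contrCenter hEx v from Subtype.ext h]
    exact .refl _
  · exact h1 e x h
  · let y : (contrFiber hEx σ v).X := ⟨.inr (e.1, some (σ e.1.1)),
      (contr_inr_self e.2.1).trans (congrArg Sum.inl e.2.2)⟩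
    have h3 : (contrFiber hEx σ v).r y = x := Subtype.ext (Eq.trans rfl h.symm)
    have h4 := eqvGen_r y
    rw [h3] at h4
    exact h4.symm.trans _ _ _ (h2 e y rfl)
  · exact h2 e x h

/-- The edges of the fiber over a non-exceptional vertex. -/
noncomputable def contrFiberPres (v : G.V) :
    EdgePres (contrFiber hEx σ v) (ContrTo Ex Ex' σ v) where
  h e b := cond b ⟨.inl (half e.1.1 (σ e.1.1)),
      (contr_half_self e.1.2 e.2.1).trans (congrArg Sum.inl e.2.2)⟩
    ⟨.inr (e.1, some (σ e.1.1)), (contr_inr_self e.2.1).trans (congrArg Sum.inl e.2.2)⟩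
  conj e b := by
    refine Subtype.ext ?_
    cases b
    · rfl
    · exact subGraph_i_half_mem e.1 _
  ne e h := absurd (congrArg Subtype.val h) Sum.inl_ne_inr
  inj e e' b b' h := by
    have h' := congrArg Subtype.val h
    cases b <;> cases b'
    · exact Subtype.ext (congrArg Prod.fst (Sum.inr_injective h'))
    · exact absurd h' Sum.inr_ne_inl
    · exact absurd h' Sum.inl_ne_inr
    · exact Subtype.ext (Subtype.ext (half_inj (Sum.inl_injective h')).1)
  surj x hx := by
    have hx' : (subW G Ex).i x.1 ≠ x.1 := fun h => hx (Subtype.ext h)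
    rcases contrFiber_cases hEx v x with h | ⟨e, h | h | h⟩
    · rw [h] at hx'
      exact absurd (subGraph_i_fixed (IsVertex.i_eq v.2)) hx'
    · exact ⟨e, true, Subtype.ext h⟩
    · rw [h] at hx'
      exact absurd rfl hx'
    · exact ⟨e, false, Subtype.ext h⟩

/-- The vertices of the fiber over a non-exceptional vertex. -/
noncomputable def contrFiberV (v : G.V) : Option (ContrTo Ex Ex' σ v) ≃ (contrFiber hEx σ v).V :=
  Equiv.ofBijective
    (fun e => e.elim ⟨contrCenter hEx v, Subtype.ext (subGraph_isVertex_inl.2 v.2)⟩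
      fun e => ⟨⟨.inr (e.1, none), (contr_inr_none e.2.1).trans (congrArg Sum.inl e.2.2)⟩,
        Subtype.ext rfl⟩) (by
    constructor
    · intro e e' h
      have h' := congrArg (fun z => z.1.1) h
      rcases e with _ | e <;> rcases e' with _ | e'
      · rfl
      · exact absurd h' Sum.inl_ne_inr
      · exact absurd h' Sum.inr_ne_inl
      · exact congrArg some (Subtype.ext (congrArg Prod.fst (Sum.inr_injective h')))
    · rintro ⟨x, hx⟩
      have hx' : (subGraph G.toGraph Ex).IsVertex x.1 := congrArg Subtype.val hx
      rcases contrFiber_cases hEx v x with h | ⟨e, h | h | h⟩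
      · exact ⟨none, Subtype.ext (Subtype.ext h.symm)⟩
      · rw [h, subGraph_isVertex_inl] at hx'
        exact absurd hx' (isHalfEdge_half _ _).not_isVertex
      · exact ⟨some e, Subtype.ext (Subtype.ext h.symm)⟩
      · rw [h, subGraph_isVertex_inr] at hx'
        exact absurd hx' (Option.some_ne_none _))

/-- The fiber is a star around `v`: each contracted piece contributes one edge and one outer vertex
of weight zero. It is therefore a tree, and only the weight of `v` remains. -/
theorem contrFiber_genus (v : G.V) (h : (contrFiber hEx σ v).V → ℕ)
    (hh : ∀ w, h w = (subW G Ex).h ⟨w.1.1, congrArg Subtype.val w.2⟩) :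
    (contrFiber hEx σ v).genus h = G.h v := by
  classical
  have : Fintype (ContrTo Ex Ex' σ v) := Fintype.ofFinite _
  rw [genus_eq_of_pres (contrFiber_connected hEx v) (contrFiberPres hEx v) (contrFiberV hEx v),
    Fintype.sum_option]
  have h1 : h (contrFiberV hEx v none) = G.h v := (hh _).trans (subW_h G Ex (.inl v))
  have h2 : ∀ e, h (contrFiberV hEx v (some e)) = 0 := fun e =>
    (hh _).trans (subW_h G Ex (.inr e.1))
  simp only [h1, h2]
  simp

end Fiber

/-- The contraction as a morphism of marked weighted graphs. -/
noncomputable def contrHom (σ : G.E → Bool) : Hom (subW G Ex) (subW G Ex') where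
  toFun := contr G Ex Ex' σ
  map_r := contr_r
  map_i := contr_i hEx
  flag_fiber := contr_flag_fiber hEx
  map_m j := contr_fixed (G.m j).2.2
  fiber_connected v := by
    obtain ⟨x, rfl⟩ := (subV G.toGraph Ex').surjective v
    rcases x with v | e
    · exact contrFiber_connected hEx v
    · have : Subsingleton (fiber (G₁ := (subW G Ex).toGraph) (G₂ := (subW G Ex').toGraph)
        (contr G Ex Ex' σ) contr_r (contr_i hEx) (subV G.toGraph Ex' (.inr e))).X :=
        ⟨fun a b => Subtype.ext
          (((contr_eq_inr hEx).1 a.2).trans ((contr_eq_inr hEx).1 b.2).symm)⟩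
      exact connected_of_subsingleton ⟨.inr (⟨e.1, hEx e.2⟩, none), contr_inr_of_mem e.2 none⟩
  fiber_genus v := by
    obtain ⟨x, rfl⟩ := (subV G.toGraph Ex').surjective v
    rcases x with v | e
    · rw [subW_h]
      exact contrFiber_genus hEx v _ fun _ => rfl
    · have : Subsingleton (fiber (G₁ := (subW G Ex).toGraph) (G₂ := (subW G Ex').toGraph)
        (contr G Ex Ex' σ) contr_r (contr_i hEx) (subV G.toGraph Ex' (.inr e))).X :=
        ⟨fun a b => Subtype.ext
          (((contr_eq_inr hEx).1 a.2).trans ((contr_eq_inr hEx).1 b.2).symm)⟩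
      let w : (fiber (G₁ := (subW G Ex).toGraph) (G₂ := (subW G Ex').toGraph)
        (contr G Ex Ex' σ) contr_r (contr_i hEx) (subV G.toGraph Ex' (.inr e))).V :=
        ⟨⟨.inr (⟨e.1, hEx e.2⟩, none), contr_inr_of_mem e.2 none⟩, Subsingleton.elim _ _⟩
      refine (genus_of_subsingleton _ w).trans ?_
      rw [subW_h]
      exact congrArg Nat.cast (subW_h G Ex (.inr ⟨e.1, hEx e.2⟩))

end Contraction

namespace QD

variable {n g : ℕ} {Gb : WGraph n}

/-- A morphism of standard objects. -/
noncomputable def contrMor (hG : Gb.IsStable g) {Ex Ex' : Set Gb.E} (hEx : Ex' ⊆ Ex)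
    (σ : Gb.E → Bool) (D D' : Gb.V → ℤ)
    (hD : ∀ v, open Classical in D' v = D v +
      ∑ e : Gb.E, if e ∈ Ex ∧ e ∉ Ex' ∧ root (half e (σ e)) = v then 1 else 0) :
    Mor (canon Ex hG D) (canon Ex' hG D') where
  π := contrHom hEx σ
  map_D v := by
    classical
    obtain ⟨x, rfl⟩ := (subV Gb.toGraph Ex').surjective v
    have : Fintype Ex := Fintype.ofFinite _
    refine ((Equiv.sum_comp (subV Gb.toGraph Ex) _).symm).trans ?_
    simp only [canon_D, Fintype.sum_sum_type, Sum.elim_inl, Sum.elim_inr]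
    have hinl : ∀ w : Gb.V, (contrHom hEx σ).toFun (subV Gb.toGraph Ex (.inl w)).1 = .inl w.1 :=
      fun w => contr_fixed (IsVertex.i_eq w.2)
    rcases x with v | e
    · rw [Sum.elim_inl, hD]
      congr 1
      · rw [Finset.sum_eq_single v]
        · exact if_pos (hinl v)
        · intro w _ hw
          refine if_neg fun h => hw (Subtype.ext (Sum.inl_injective ((hinl w).symm.trans h)))
        · simp
      · rw [← Finset.sum_filter, ← Finset.sum_filter, Finset.sum_const, Finset.sum_const,
          ← Fintype.card_subtype, ← Fintype.card_subtype]
        congr 1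
        refine Fintype.card_congr (Equiv.ofBijective (fun e => ⟨e.1.1, e.1.2, ?_⟩) ⟨?_, ?_⟩)
        · have he := e.2
          by_cases h : e.1.1 ∈ Ex'
          · exact absurd ((contr_inr_of_mem h none).symm.trans he) Sum.inr_ne_inl
          · exact ⟨h, Subtype.ext (Sum.inl_injective ((contr_inr_none h).symm.trans he))⟩
        · intro e e' h
          exact Subtype.ext (Subtype.ext (congrArg (fun z => z.1) h))
        · rintro ⟨e, h1, h2, h3⟩
          exact ⟨⟨⟨e, h1⟩, (contr_inr_none (e := ⟨e, h1⟩) h2).trans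
            (congrArg Sum.inl (congrArg Subtype.val h3))⟩, rfl⟩
    · rw [Finset.sum_eq_zero, zero_add, Finset.sum_eq_single ⟨e.1, hEx e.2⟩]
      · exact if_pos ((contr_eq_inr (σ := σ) (e := e) (o := none) hEx).2 rfl)
      · intro e' _ he'
        refine if_neg fun h => ?_
        have := (contr_eq_inr (σ := σ) (e := e) (o := none) (x := .inr (e', none)) hEx).1 h
        exact he' (congrArg Prod.fst (Sum.inr_injective this))
      · simp
      · intro w _
        exact if_neg fun h => absurd ((hinl w).symm.trans h) Sum.inl_ne_inr
  map_ρ y := by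
    change WGraph.stMap (contrHom hEx σ) (.inl y) = .inl y
    -- On a contracted half, `stMap` takes the image of the other flag of the inserted vertex, and
    -- `contr` sends that flag back to the half. Elsewhere `stMap` is the contraction itself and
    -- fixes `y`.
    by_cases h : ∃ e, e ∈ Ex ∧ e ∉ Ex' ∧ y = half e (σ e)
    · obtain ⟨e, he, he', rfl⟩ := h
      have h1 : (subW Gb Ex).i (.inl (half e (σ e))) = .inr (⟨e, he⟩, some (σ e)) :=
        subGraph_i_half_mem ⟨e, he⟩ (σ e)
      have h2 : (subW Gb Ex').IsVertex (contr Gb Ex Ex' σ (.inl (half e (σ e)))) := by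
        rw [contr_half_self he he']
        exact subGraph_isVertex_inl.2 (isVertex_r _)
      have h3 : (subW Gb Ex).IsExc (root ((subW Gb Ex).i (.inl (half e (σ e))))) := by
        rw [h1]
        exact subW_isExc_root_inr Ex hG _
      have h4 : (subW Gb Ex).IsHalfEdge (.inl (half e (σ e))) := fun h =>
        absurd (h1.symm.trans h) Sum.inr_ne_inl
      refine (stMap_of_isVertex (contrHom hEx σ) h4 h3 h2).trans ?_
      rw [h1, subW_other Ex hG]
      exact contr_inr_not (e := ⟨e, he⟩) he'
    · have h1 : (contrHom hEx σ).toFun (.inl y) = .inl y := by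
        change contr Gb Ex Ex' σ (.inl y) = _
        rw [contr, if_neg h]
      by_cases hv : Gb.IsVertex y
      · exact (stMap_of_not_isHalfEdge (contrHom hEx σ)
          fun h => h (subGraph_i_fixed hv.i_eq)).trans h1
      · refine (stMap_of_not_isVertex (contrHom hEx σ) fun h => hv ?_).trans h1
        rw [h1] at h
        exact subGraph_isVertex_inl.1 h

/-- The morphism of an object to the standard one isomorphic to it. -/
noncomputable def toCanon (hG : Gb.IsStable g) (o : QD g Gb) :
    Mor o (canon o.excSet hG fun v => o.D (o.embV v)) where
  π := o.toCanonHom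
  map_D v := by
    classical
    obtain ⟨x, rfl⟩ := (subV Gb.toGraph o.excSet).surjective v
    rw [Finset.sum_eq_single (o.vEquiv x)]
    · refine (if_pos (o.subEquiv.symm_apply_apply _)).trans ?_
      rw [canon_D]
      rcases x with v | e
      · rfl
      · exact o.D_excV e.2
    · intro w _ hw
      exact if_neg fun h => hw (Subtype.ext (o.subEquiv.symm_apply_eq.1 h))
    · simp
  map_ρ y := by
    have h1 : o.toCanonHom.toFun (o.emb y) = .inl y := o.subEquiv_symm_emb y
    by_cases hv : Gb.IsVertex y
    · exact (stMap_of_not_isHalfEdge o.toCanonHom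
        fun h => h.not_isVertex (o.isVertex_emb_iff.2 hv)).trans h1
    · refine (stMap_of_not_isVertex o.toCanonHom fun h => hv ?_).trans h1
      rw [h1] at h
      exact subGraph_isVertex_inl.1 h

end QD

/-! ### Transport of divisors along morphisms and the map to the Picard group. -/

namespace QD

variable {n g : ℕ} {Gb : WGraph n}

open Classical in
theorem sum_vertices {M : Type*} [AddCommMonoid M] (o : QD g Gb) (f : o.G.V → M) :
    ∑ w, f w = ∑ v, f (o.embV v) + ∑ e : Gb.E, if o.IsExcEdge e then f (o.excV e) else 0 := by
  have : Fintype o.excSet := Fintype.ofFinite _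
  rw [← Equiv.sum_comp o.vEquiv, Fintype.sum_sum_type, ← Finset.sum_filter]
  congr 1
  exact (Finset.sum_subtype _ (fun e => by simp [excSet]) fun e => f (o.excV e)).symm

open Classical in
/-- The effect of a morphism on the divisors. -/
theorem Mor.D_embV {o o' : QD g Gb} (p : Mor o o') (v : Gb.V) :
    o'.D (o'.embV v) = o.D (o.embV v) + ∑ e : Gb.E,
      if o.IsExcEdge e ∧ ¬ o'.IsExcEdge e ∧
        root (half e (decide (o'.G.IsVertex (p.π.toFun (o.emb (rep e)))))) = v then 1 else 0 := by
  rw [← p.map_D, sum_vertices]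
  congr 1
  · rw [Finset.sum_eq_single v]
    · exact if_pos (p.map_embV v)
    · intro w _ hw
      refine if_neg fun h => hw (o'.embV_injective (Subtype.ext ?_))
      exact (p.map_embV w).symm.trans h
    · simp
  · refine Finset.sum_congr rfl fun e _ => ?_
    by_cases ho : o.IsExcEdge e
    · rw [if_pos ho, o.D_excV ho]
      congr 1
      by_cases he : o'.IsExcEdge e
      · rw [p.map_excV_of_isExcEdge he]
        refine propext (iff_of_false (fun h => ?_) (by simp [he]))
        exact o'.not_isExc_embV v ((Subtype.ext h : o'.excV e = o'.embV v) ▸ o'.isExc_excV he)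
      · have h1 : p.π.toFun (o.excV e).1 = (o'.embV (root (half e
            (decide (o'.G.IsVertex (p.π.toFun (o.emb (rep e)))))))).1 := by
          -- One of the two pieces of `e` is contracted. The label `true` belongs to the tail piece,
          -- so the exceptional chip falls on the tail if that piece is contracted and on the head
          -- otherwise.
          by_cases h2 : o'.G.IsVertex (p.π.toFun (o.emb (rep e)))
          · rw [decide_eq_true h2]
            exact p.map_excV_of_isVertex (b := true) ho h2
          · rw [decide_eq_false h2]
            exact p.map_excV_of_isVertex (b := false) ho
              (p.isVertex_not_of_not_isVertex (b := true) ho he h2)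
        rw [h1]
        simp only [ho, he, not_false_eq_true, true_and]
        refine propext ⟨fun h => o'.embV_injective (Subtype.ext h), fun h => by rw [h]⟩
    · rw [if_neg ho, if_neg fun h => ho h.1]

end QD

namespace TropCurve

variable {n g : ℕ} (Γ : TropCurve g n)

theorem pt_zero (e : Γ.G.E) : Γ.pt e 0 = .vert (tail e) := by
  rw [pt, dif_pos le_rfl]

theorem pt_d (e : Γ.G.E) : Γ.pt e (Γ.d e) = .vert (head e) := by
  rw [pt, dif_neg (not_le.2 (Γ.d_pos e)), dif_pos le_rfl]

theorem pt_inner (e : Γ.G.E) (s : Set.Ioo 0 (Γ.d e)) : Γ.pt e s = .inner e s := by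
  rw [pt, dif_neg (not_le.2 s.2.1), dif_neg (not_le.2 s.2.2)]

open Classical in
theorem cellDiv_eq (o : QD g Γ.G) (x : Γ.Poly o) :
    Γ.cellDiv o x = (∑ e : Γ.G.E,
      if h : o.IsExcEdge e then Finsupp.single (Γ.pt e (x ⟨e, h⟩)) (1 : ℤ) else 0) +
      ∑ v : Γ.G.V, Finsupp.single (Pt.vert v) (o.D (o.embV v)) := by
  rw [cellDiv]
  congr 1
  rw [Finset.sum_dite, Finset.sum_const_zero, add_zero]
  refine Finset.sum_bij' (fun e _ => ⟨e.1, Finset.mem_filter.2 ⟨Finset.mem_univ _, e.2⟩⟩)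
    (fun e _ => ⟨e.1, (Finset.mem_filter.1 e.2).2⟩) ?_ ?_ ?_ ?_ ?_ <;> intros <;>
    first | rfl | exact Finset.mem_univ _

theorem sum_single_vert (c : Γ.G.E → Prop) (f : Γ.G.E → Γ.G.V) [DecidablePred c]
    [∀ e v, Decidable (c e ∧ f e = v)] :
    ∑ v : Γ.G.V, (Finsupp.single (Pt.vert v) (∑ e, if c e ∧ f e = v then 1 else 0) : Γ.Div) =
      ∑ e, if c e then Finsupp.single (Pt.vert (f e)) 1 else 0 := by
  have h1 : ∀ v, (Finsupp.single (Pt.vert v) (∑ e, if c e ∧ f e = v then 1 else 0) : Γ.Div) =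
      ∑ e, Finsupp.single (Pt.vert v) (if c e ∧ f e = v then 1 else 0) := fun v =>
    map_sum (Finsupp.singleAddHom (Pt.vert v)) _ _
  simp only [h1]
  rw [Finset.sum_comm]
  refine Finset.sum_congr rfl fun e _ => ?_
  rw [Finset.sum_eq_single (f e)]
  · by_cases h : c e
    · rw [if_pos h, if_pos ⟨h, rfl⟩]
    · rw [if_neg h, if_neg fun h1 => h h1.1, Finsupp.single_zero]
  · intro v _ hv
    rw [if_neg fun h => hv h.2.symm, Finsupp.single_zero]
  · simp

/-- At an edge that ceases to be exceptional, `polyMap` puts the moving point at the end to which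
`π` contracts the exceptional vertex. That is the vertex at which the divisor of `o'` gains a chip
(`QD.Mor.D_embV`), so the two divisors agree edge by edge. -/
theorem cellDiv_polyMap {o o' : QD g Γ.G} (p : QD.Mor o o') (x : Γ.Poly o') :
    Γ.cellDiv o (Γ.polyMap p x) = Γ.cellDiv o' x := by
  classical
  rw [cellDiv_eq, cellDiv_eq]
  simp only [p.D_embV, Finsupp.single_add, Finset.sum_add_distrib]
  rw [add_comm (∑ v : Γ.G.V, Finsupp.single (Pt.vert v) (o.D (o.embV v))), ← add_assoc]
  congr 1
  simp only [← and_assoc]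
  rw [sum_single_vert, ← Finset.sum_add_distrib]
  refine Finset.sum_congr rfl fun e _ => ?_
  by_cases he : o'.IsExcEdge e
  · have ho := p.isExcEdge_of he
    rw [dif_pos ho, dif_pos he, if_neg fun h => h.2 he, add_zero, polyMap, dif_pos he]
  · rw [dif_neg he, zero_add]
    by_cases ho : o.IsExcEdge e
    · rw [dif_pos ho, if_pos ⟨ho, he⟩, polyMap, dif_neg he]
      by_cases hv : o'.G.IsVertex (p.π.toFun (o.emb (rep e)))
      · rw [if_pos hv, pt_zero, decide_eq_true hv]
        rfl
      · rw [if_neg hv, pt_d, decide_eq_false hv]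
        rfl
    · rw [dif_neg ho, if_neg fun h => ho h.1]

/-- The map to the Picard group. -/
noncomputable def abelMap : Γ.Jac → Γ.Pic :=
  Quot.lift (fun a => cls (Γ.cellDiv a.1.1 a.2)) (by
    rintro _ _ ⟨o, o', p, x⟩
    exact congrArg cls (Γ.cellDiv_polyMap p x).symm)

end TropCurve

/-! ### Linear equivalence on the metric graph. -/

/-- A function on an interval with opposite one-sided slopes at every interior point is affine. -/
theorem affine_of_slopes {U p q : ℝ → ℝ} {d : ℝ} (hd : 0 < d)
    (hr : ∀ s, 0 ≤ s → s < d → ∀ᶠ t in 𝓝[>] (0 : ℝ), U (s + t) = U s + p s * t)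
    (hl : ∀ s, 0 < s → s ≤ d → ∀ᶠ t in 𝓝[>] (0 : ℝ), U (s - t) = U s + q s * t)
    (hpq : ∀ s, 0 < s → s < d → p s + q s = 0) :
    U d = U 0 + p 0 * d ∧ q d = - p 0 := by
  classical
  -- `σ` is the slope in the increasing direction, read from the left at `d`, where there is no
  -- right slope. The relation `P` says that two points have the same slope and lie on one line. It
  -- is symmetric, transitive and true near every point, so it holds between any two points of the
  -- connected interval.
  let σ : ℝ → ℝ := fun s => if s < d then p s else - q d
  let P : ℝ → ℝ → Prop := fun x y => σ x = σ y ∧ U y - U x = σ x * (y - x)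
  have hext : ∀ {Q : ℝ → Prop}, (∀ᶠ t in 𝓝[>] (0 : ℝ), Q t) → ∃ ε > 0, ∀ t, 0 < t → t < ε → Q t := by
    intro Q h
    obtain ⟨ε, hε, h⟩ := mem_nhdsGT_iff_exists_Ioo_subset.1 h
    exact ⟨ε, hε, fun t h0 h1 => h ⟨h0, h1⟩⟩
  have hslope : ∀ y c δ, 0 ≤ y → y < d → 0 < δ → (∀ t, 0 < t → t < δ → U (y + t) = U y + c * t) →
      p y = c := by
    intro y c δ h0 h1 hδ h
    obtain ⟨ε, hε, h2⟩ := hext (hr y h0 h1)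
    have h3 : 0 < min δ ε / 2 := by positivity
    have h4 : min δ ε / 2 < δ := by linarith [min_le_left δ ε, lt_min hδ hε]
    have h5 : min δ ε / 2 < ε := by linarith [min_le_right δ ε, lt_min hδ hε]
    have h6 := h _ h3 h4
    rw [h2 _ h3 h5] at h6
    exact mul_right_cancel₀ h3.ne' (by linarith)
  have key : P 0 d := by
    refine (isPreconnected_Icc (a := (0 : ℝ)) (b := d)).induction₂ P ?_ ?_ ?_
      ⟨le_rfl, hd.le⟩ ⟨hd.le, le_rfl⟩
    · rintro x ⟨hx0, hxd⟩
      have hR : ∃ ε > 0, ∀ y, x < y → y < x + ε → y ≤ d → P x y := by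
        rcases hxd.eq_or_lt with rfl | hxd
        · exact ⟨1, one_pos, fun y h1 _ h2 => absurd h1 (not_lt.2 h2)⟩
        obtain ⟨ε, hε, h⟩ := hext (hr x hx0 hxd)
        refine ⟨min ε (d - x), lt_min hε (by linarith), fun y h1 h2 _ => ?_⟩
        have h3 : y < x + ε := h2.trans_le (by linarith [min_le_left ε (d - x)])
        have h4 : y < d := h2.trans_le (by linarith [min_le_right ε (d - x)])
        have h5 : U y = U x + p x * (y - x) := by
          have := h (y - x) (by linarith) (by linarith)
          rwa [add_sub_cancel] at this
        have h6 : p y = p x := by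
          refine hslope y _ (x + ε - y) (by linarith) h4 (by linarith) fun t h7 h8 => ?_
          have := h (y - x + t) (by linarith) (by linarith)
          rw [← add_assoc, add_sub_cancel] at this
          rw [this, h5]
          ring
        refine ⟨?_, ?_⟩
        · simp only [σ]
          rw [if_pos hxd, if_pos h4, h6]
        · simp only [σ]
          rw [if_pos hxd, h5]
          ring
      have hL : ∃ ε > 0, ∀ y, 0 ≤ y → y < x → x - ε < y → P x y := by
        rcases hx0.eq_or_lt with rfl | hx0
        · exact ⟨1, one_pos, fun y h1 h2 _ => absurd h1 (not_le.2 h2)⟩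
        have hσ : σ x = - q x := by
          simp only [σ]
          split_ifs with h
          · linarith [hpq x hx0 h]
          · rw [le_antisymm hxd (not_lt.1 h)]
        obtain ⟨ε, hε, h⟩ := hext (hl x hx0 hxd)
        refine ⟨ε, hε, fun y h1 h2 h3 => ?_⟩
        have h5 : U y = U x + q x * (x - y) := by
          have := h (x - y) (by linarith) (by linarith)
          rwa [sub_sub_cancel] at this
        have h4 : y < d := by linarith
        have h6 : p y = - q x := by
          refine hslope y _ (x - y) h1 h4 (by linarith) fun t h7 h8 => ?_
          have := h (x - y - t) (by linarith) (by linarith)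
          rw [show x - (x - y - t) = y + t by ring] at this
          rw [this, h5]
          ring
        refine ⟨?_, ?_⟩
        · rw [hσ]
          simp only [σ]
          rw [if_pos h4, h6]
        · rw [hσ, h5]
          ring
      obtain ⟨ε, hε, hR⟩ := hR
      obtain ⟨ε', hε', hL⟩ := hL
      filter_upwards [self_mem_nhdsWithin, mem_nhdsWithin_of_mem_nhds
        (Ioo_mem_nhds (show x - ε' < x by linarith) (show x < x + ε by linarith))] with y hy hy'
      rcases lt_trichotomy x y with h | rfl | h
      · exact hR y h hy'.2 hy.2
      · exact ⟨rfl, by ring⟩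
      · exact hL y hy.1 h hy'.1
    · rintro x y z - - - ⟨h1, h2⟩ ⟨h3, h4⟩
      refine ⟨h1.trans h3, ?_⟩
      rw [← h1] at h4
      linarith
    · rintro x y - - ⟨h1, h2⟩
      refine ⟨h1.symm, ?_⟩
      rw [← h1]
      linarith
  obtain ⟨h1, h2⟩ := key
  simp only [σ] at h1 h2
  rw [if_pos hd] at h1 h2
  rw [if_neg (lt_irrefl d)] at h1
  exact ⟨by linarith, by linarith⟩

namespace TropCurve

variable {n g : ℕ} (Γ : TropCurve g n)

open Classical in
/-- The boundary of a chain. -/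
noncomputable def bdry {M : Type*} [AddCommGroup M] : (Γ.G.E → M) →+ (Γ.G.V → M) where
  toFun z v := (∑ e : Γ.G.E, if head e = v then z e else 0) - ∑ e : Γ.G.E, if tail e = v then z e else 0
  map_zero' := by
    ext v
    simp
  map_add' y z := by
    ext v
    simp only [← Finset.sum_filter, Pi.add_apply, Finset.sum_add_distrib]
    abel

open Classical in
theorem bdry_apply {M : Type*} [AddCommGroup M] (z : Γ.G.E → M) (v : Γ.G.V) :
    Γ.bdry z v = (∑ e : Γ.G.E, if head e = v then z e else 0) -
      ∑ e : Γ.G.E, if tail e = v then z e else 0 := rfl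

open Classical in
/-- The vertex to which a point is moved along its edge. -/
noncomputable def vertCoeff (v : Γ.G.V) : Γ.Pt → ℤ
  | .vert w => if w = v then 1 else 0
  | .inner e _ => if tail e = v then 1 else 0

open Classical in
/-- The distance from the tail for the points on `e`. -/
noncomputable def distCoeff (e : Γ.G.E) : Γ.Pt → ℝ
  | .vert _ => 0
  | .inner e' s => if e' = e then s else 0

open Classical in
/-- The convex piecewise linear function along `e` that bends at the given point. -/
noncomputable def bend (e : Γ.G.E) (s : ℝ) : Γ.Pt → ℝ
  | .vert _ => 0
  | .inner e' s' => if e' = e then max (s - s') 0 else 0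

open Classical in
/-- The slope of `bend` to the right. -/
noncomputable def bendR (e : Γ.G.E) (s : ℝ) : Γ.Pt → ℤ
  | .vert _ => 0
  | .inner e' s' => if e' = e ∧ s'.1 ≤ s then 1 else 0

open Classical in
/-- The slope of `bend` from the left. -/
noncomputable def bendL (e : Γ.G.E) (s : ℝ) : Γ.Pt → ℤ
  | .vert _ => 0
  | .inner e' s' => if e' = e ∧ s'.1 < s then 1 else 0

/-- The degree at a vertex after moving all inner points to the tails of their edges. -/
noncomputable def vertDeg (v : Γ.G.V) : Γ.Div →ₗ[ℤ] ℤ := Finsupp.linearCombination ℤ (Γ.vertCoeff v)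

/-- The total distance from the tail of the points on `e`. -/
noncomputable def totalDist (e : Γ.G.E) : Γ.Div →ₗ[ℤ] ℝ :=
  Finsupp.linearCombination ℤ (Γ.distCoeff e)

theorem eventually_bend_right (e : Γ.G.E) (s : ℝ) (p : Γ.Pt) :
    ∀ᶠ t in 𝓝[>] (0 : ℝ), Γ.bend e (s + t) p = Γ.bend e s p + Γ.bendR e s p * t := by
  rcases p with v | ⟨e', s'⟩
  · simp [bend, bendR]
  · by_cases he : e' = e
    · by_cases hs : s'.1 ≤ s
      · filter_upwards [self_mem_nhdsWithin] with t ht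
        have ht : 0 < t := ht
        simp only [bend, bendR, he, hs, if_true, and_self]
        rw [max_eq_left (by linarith), max_eq_left (by linarith)]
        push_cast
        ring
      · filter_upwards [mem_nhdsWithin_of_mem_nhds (Iio_mem_nhds (sub_pos.2 (not_le.1 hs)))] with t ht
        have ht : t < s'.1 - s := ht
        simp only [bend, bendR, he, hs, if_true, and_false, if_false]
        rw [max_eq_right (by linarith), max_eq_right (by linarith)]
        simp
    · simp [bend, bendR, he]

theorem eventually_bend_left (e : Γ.G.E) (s : ℝ) (p : Γ.Pt) :
    ∀ᶠ t in 𝓝[>] (0 : ℝ), Γ.bend e (s - t) p = Γ.bend e s p - Γ.bendL e s p * t := by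
  rcases p with v | ⟨e', s'⟩
  · simp [bend, bendL]
  · by_cases he : e' = e
    · by_cases hs : s'.1 < s
      · filter_upwards [mem_nhdsWithin_of_mem_nhds (Iio_mem_nhds (sub_pos.2 hs))] with t ht
        have ht : t < s - s'.1 := ht
        simp only [bend, bendL, he, hs, if_true, and_self]
        rw [max_eq_left (by linarith), max_eq_left (by linarith)]
        push_cast
        ring
      · filter_upwards [self_mem_nhdsWithin] with t ht
        have ht : 0 < t := ht
        simp only [bend, bendL, he, hs, if_true, and_false, if_false]
        rw [max_eq_right (by linarith), max_eq_right (by linarith)]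
        simp
    · simp [bend, bendL, he]

theorem eventually_sum_bend_right (e : Γ.G.E) (s : ℝ) (D : Γ.Div) :
    ∀ᶠ t in 𝓝[>] (0 : ℝ), Finsupp.linearCombination ℤ (Γ.bend e (s + t)) D =
      Finsupp.linearCombination ℤ (Γ.bend e s) D +
        (Finsupp.linearCombination ℤ (Γ.bendR e s) D : ℤ) * t := by
  have h := (Filter.eventually_all_finset D.support).2 fun p _ => Γ.eventually_bend_right e s p
  filter_upwards [h] with t ht
  simp only [Finsupp.linearCombination_apply, Finsupp.sum, Int.cast_sum, Finset.sum_mul,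
    ← Finset.sum_add_distrib]
  refine Finset.sum_congr rfl fun p hp => ?_
  rw [ht p hp]
  simp only [zsmul_eq_mul, smul_eq_mul]
  push_cast
  ring

theorem eventually_sum_bend_left (e : Γ.G.E) (s : ℝ) (D : Γ.Div) :
    ∀ᶠ t in 𝓝[>] (0 : ℝ), Finsupp.linearCombination ℤ (Γ.bend e (s - t)) D =
      Finsupp.linearCombination ℤ (Γ.bend e s) D -
        (Finsupp.linearCombination ℤ (Γ.bendL e s) D : ℤ) * t := by
  have h := (Filter.eventually_all_finset D.support).2 fun p _ => Γ.eventually_bend_left e s p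
  filter_upwards [h] with t ht
  simp only [Finsupp.linearCombination_apply, Finsupp.sum, Int.cast_sum, Finset.sum_mul,
    ← Finset.sum_sub_distrib]
  refine Finset.sum_congr rfl fun p hp => ?_
  rw [ht p hp]
  simp only [zsmul_eq_mul, smul_eq_mul]
  push_cast
  ring

/-- The two slopes of `bend` at `s` differ only for a point placed at `s` itself. Thus the
combination of the `bend`s with coefficients `D` has the prescribed order inside `e`, and
subtracting it from a rational function with divisor `D` leaves an affine function. -/
theorem sum_bendR_sub_bendL (e : Γ.G.E) (s : Set.Ioo 0 (Γ.d e)) (D : Γ.Div) :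
    Finsupp.linearCombination ℤ (Γ.bendR e s) D - Finsupp.linearCombination ℤ (Γ.bendL e s) D =
      D (.inner e s) := by
  classical
  rw [Finsupp.linearCombination_apply, Finsupp.linearCombination_apply, Finsupp.sum, Finsupp.sum,
    ← Finset.sum_sub_distrib]
  rw [Finset.sum_eq_single (Pt.inner e s)]
  · simp [bendR, bendL]
  · intro p _ hp
    rw [← smul_sub]
    rcases p with v | ⟨e', s'⟩
    · simp [bendR, bendL]
    · by_cases he : e' = e
      · subst he
        have hs : s'.1 ≠ s.1 := fun h => hp (by rw [Subtype.ext h])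
        have : s'.1 ≤ s.1 ↔ s'.1 < s.1 := ⟨fun h => lt_of_le_of_ne h hs, le_of_lt⟩
        simp [bendR, bendL, this]
      · simp [bendR, bendL, he]
  · intro h
    rw [Finsupp.notMem_support_iff.1 h]
    simp

theorem sum_bendR_zero (e : Γ.G.E) (D : Γ.Div) :
    Finsupp.linearCombination ℤ (Γ.bendR e 0) D = 0 := by
  have h : Γ.bendR e 0 = 0 := by
    ext p
    rcases p with v | ⟨e', s'⟩
    · rfl
    · simp [bendR, s'.2.1]
  rw [h]
  simp

theorem sum_bend_zero (e : Γ.G.E) (D : Γ.Div) :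
    Finsupp.linearCombination ℤ (Γ.bend e 0) D = 0 := by
  have h : Γ.bend e 0 = 0 := by
    ext p
    rcases p with v | ⟨e', s'⟩
    · rfl
    · simp [bend, s'.2.1.le]
  rw [h]
  simp

theorem sum_bend_d (e : Γ.G.E) (D : Γ.Div) :
    Finsupp.linearCombination ℤ (Γ.bend e (Γ.d e)) D =
      (Finsupp.linearCombination ℤ (Γ.bendL e (Γ.d e)) D : ℤ) * Γ.d e - Γ.totalDist e D := by
  rw [totalDist]
  simp only [Finsupp.linearCombination_apply, Finsupp.sum, Int.cast_sum, Finset.sum_mul,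
    ← Finset.sum_sub_distrib]
  refine Finset.sum_congr rfl fun p hp => ?_
  rcases p with v | ⟨e', s'⟩
  · simp [bend, bendL, distCoeff]
  · by_cases he : e' = e
    · subst he
      simp only [bend, bendL, distCoeff, s'.2.2, if_true, and_self]
      rw [max_eq_left (by linarith [s'.2.2])]
      simp only [zsmul_eq_mul, smul_eq_mul]
      push_cast
      ring
    · simp [bend, bendL, distCoeff, he]

open Classical in
-- At the end of the edge every inner point has left slope one, so the combination of the `bendL`
-- counts the chips inside `e`, which all move to the tail.
theorem vertDeg_eq (v : Γ.G.V) (D : Γ.Div) :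
    Γ.vertDeg v D = D (.vert v) + ∑ e : Γ.G.E, if tail e = v then
      Finsupp.linearCombination ℤ (Γ.bendL e (Γ.d e)) D else 0 := by
  induction D using Finsupp.induction_linear with
  | zero => simp
  | add D D' h h' =>
    simp only [map_add, Finsupp.add_apply, h, h', ← Finset.sum_filter, Finset.sum_add_distrib]
    ring
  | single p k =>
    simp only [vertDeg, Finsupp.linearCombination_single]
    rcases p with w | ⟨e, s⟩
    · simp [vertCoeff, bendL, Finsupp.single_apply]
    · rw [Finset.sum_eq_single e]
      · simp [vertCoeff, bendL, s.2.2]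
      · intro e' _ he
        simp [bendL, he.symm]
      · simp

/-- Principal divisors in terms of an integral chain and a function on the vertices. -/
theorem mem_principal_iff (D : Γ.Div) : D ∈ Γ.principal ↔ ∃ (k : Γ.G.E → ℤ) (F : Γ.G.V → ℝ),
    (∀ v, Γ.vertDeg v D + Γ.bdry k v = 0) ∧
      ∀ e, Γ.totalDist e D = k e * Γ.d e + F (tail e) - F (head e) := by
  classical
  constructor
  · rintro ⟨f, a, b, hf, hD⟩
    -- Removing the bends at the points of `D` makes `f` affine along `e`; the two ends are then
    -- compared.
    have key : ∀ e, f (.vert (head e)) - Finsupp.linearCombination ℤ (Γ.bend e (Γ.d e)) D =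
        f (.vert (tail e)) + a e 0 * Γ.d e ∧
        b e (Γ.d e) + Finsupp.linearCombination ℤ (Γ.bendL e (Γ.d e)) D = - a e 0 := by
      intro e
      have h := affine_of_slopes (d := Γ.d e)
        (U := fun s => f (Γ.pt e s) - Finsupp.linearCombination ℤ (Γ.bend e s) D)
        (p := fun s => a e s - (Finsupp.linearCombination ℤ (Γ.bendR e s) D : ℤ))
        (q := fun s => b e s + (Finsupp.linearCombination ℤ (Γ.bendL e s) D : ℤ)) (Γ.d_pos e) ?_ ?_ ?_
      · simp only [pt_d, pt_zero, sum_bend_zero, sum_bendR_zero] at h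
        refine ⟨by simpa using h.1, ?_⟩
        have h2 := h.2
        rw [Int.cast_zero, sub_zero] at h2
        exact_mod_cast h2
      · intro s h0 h1
        filter_upwards [hf.right e s h0 h1, Γ.eventually_sum_bend_right e s D] with t h2 h3
        rw [h2, h3]
        ring
      · intro s h0 h1
        filter_upwards [hf.left e s h0 h1, Γ.eventually_sum_bend_left e s D] with t h2 h3
        rw [h2, h3]
        ring
      · intro s h0 h1
        have h2 := hD (.inner e ⟨s, h0, h1⟩)
        rw [← sum_bendR_sub_bendL] at h2
        simp only [ord] at h2
        have h3 : ((a e s : ℤ) : ℝ) + b e s = (Finsupp.linearCombination ℤ (Γ.bendR e s) D : ℤ) -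
            (Finsupp.linearCombination ℤ (Γ.bendL e s) D : ℤ) := by exact_mod_cast h2.symm
        linarith
    -- The initial slope increased by the number of inner chips is the slope with which `f` arrives
    -- at the head. This slope is the integral chain.
    refine ⟨fun e => a e 0 + Finsupp.linearCombination ℤ (Γ.bendL e (Γ.d e)) D,
      fun v => f (.vert v), fun v => ?_, fun e => ?_⟩
    · rw [vertDeg_eq, hD, bdry_apply]
      simp only [ord]
      have h1 : ∀ e, a e 0 + Finsupp.linearCombination ℤ (Γ.bendL e (Γ.d e)) D = - b e (Γ.d e) :=
        fun e => by linarith [(key e).2]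
      have h2 : ∑ e, (if head e = v then
          a e 0 + Finsupp.linearCombination ℤ (Γ.bendL e (Γ.d e)) D else 0) =
          - ∑ e, if head e = v then b e (Γ.d e) else 0 := by
        simp only [h1, ← Finset.sum_filter, Finset.sum_neg_distrib]
      rw [h2]
      simp only [← Finset.sum_filter, Finset.sum_add_distrib]
      ring
    · have h1 := (key e).1
      rw [sum_bend_d] at h1
      push_cast
      linarith
  · rintro ⟨k, F, hv, he⟩
    -- Conversely `c e` is the slope at the tail, chosen so that the bends raise it to `k e` at the
    -- head. The condition on `totalDist` then makes the function take the value `F (head e)` there.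
    let c : Γ.G.E → ℤ := fun e => k e - Finsupp.linearCombination ℤ (Γ.bendL e (Γ.d e)) D
    let f : Γ.Pt → ℝ := fun p => match p with
      | .vert v => F v
      | .inner e s => F (tail e) + c e * s + Finsupp.linearCombination ℤ (Γ.bend e s) D
    have hf : ∀ e s, 0 ≤ s → s ≤ Γ.d e →
        f (Γ.pt e s) = F (tail e) + c e * s + Finsupp.linearCombination ℤ (Γ.bend e s) D := by
      intro e s h0 h1
      rcases h0.eq_or_lt with rfl | h0
      · rw [pt_zero, sum_bend_zero]
        simp [f]
      rcases h1.eq_or_lt with rfl | h1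
      · rw [pt_d, sum_bend_d]
        simp only [f, c]
        push_cast
        linarith [he e]
      · rw [show Γ.pt e s = .inner e ⟨s, h0, h1⟩ from Γ.pt_inner e ⟨s, h0, h1⟩]
    refine ⟨f, fun e s => c e + Finsupp.linearCombination ℤ (Γ.bendR e s) D,
      fun e s => - (c e + Finsupp.linearCombination ℤ (Γ.bendL e s) D), ⟨?_, ?_⟩, ?_⟩
    · intro e s h0 h1
      filter_upwards [self_mem_nhdsWithin, Γ.eventually_sum_bend_right e s D,
        mem_nhdsWithin_of_mem_nhds (Iio_mem_nhds (sub_pos.2 h1))] with t h2 h3 h4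
      have h2 : 0 < t := h2
      have h4 : t < Γ.d e - s := h4
      rw [hf e s h0 h1.le, hf e (s + t) (by linarith) (by linarith), h3]
      push_cast
      ring
    · intro e s h0 h1
      filter_upwards [self_mem_nhdsWithin, Γ.eventually_sum_bend_left e s D,
        mem_nhdsWithin_of_mem_nhds (Iio_mem_nhds h0)] with t h2 h3 h4
      have h2 : 0 < t := h2
      have h4 : t < s := h4
      rw [hf e s h0.le h1, hf e (s - t) (by linarith) (by linarith), h3]
      push_cast
      ring
    · rintro (v | ⟨e, s⟩)
      · have h1 := hv v
        rw [vertDeg_eq, bdry_apply] at h1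
        simp only [ord, sum_bendR_zero, add_zero]
        have h2 : ∀ e, c e + Finsupp.linearCombination ℤ (Γ.bendL e (Γ.d e)) D = k e := fun e =>
          sub_add_cancel _ _
        simp only [h2]
        simp only [c, ← Finset.sum_filter, Finset.sum_sub_distrib, Finset.sum_neg_distrib] at h1 ⊢
        linarith
      · simp only [ord]
        rw [← sum_bendR_sub_bendL]
        ring

theorem cls_eq_iff (D D' : Γ.Div) : cls D = cls D' ↔ ∃ (k : Γ.G.E → ℤ) (F : Γ.G.V → ℝ),
    (∀ v, Γ.vertDeg v D - Γ.vertDeg v D' + Γ.bdry k v = 0) ∧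
      ∀ e, Γ.totalDist e D - Γ.totalDist e D' = k e * Γ.d e + F (tail e) - F (head e) := by
  rw [eq_comm]
  refine QuotientAddGroup.eq.trans ?_
  rw [mem_principal_iff]
  simp only [neg_add_eq_sub, map_sub]

end TropCurve

/-! ### Chains as representatives of classes; cycles, gradients and the topology. -/

namespace TropCurve

variable {n g : ℕ} (Γ : TropCurve g n)

/-- The divisor given by an integral function on the vertices and a real chain. -/
noncomputable def base (D : Γ.G.V → ℤ) (t : Γ.G.E → ℝ) : Γ.Div :=
  ∑ v : Γ.G.V, Finsupp.single (Pt.vert v) (D v) + ∑ e : Γ.G.E, Γ.slide e (t e)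

open Classical in
theorem vertCoeff_pt (v : Γ.G.V) (e : Γ.G.E) {s : ℝ} (hs : s < Γ.d e) :
    Γ.vertCoeff v (Γ.pt e s) = if tail e = v then 1 else 0 := by
  rw [pt]
  by_cases h0 : s ≤ 0
  · rw [dif_pos h0]
    rfl
  · rw [dif_neg h0, dif_neg (not_le.2 hs)]
    rfl

open Classical in
theorem distCoeff_pt (e e' : Γ.G.E) {s : ℝ} (h0 : 0 ≤ s) (hs : s < Γ.d e') :
    Γ.distCoeff e (Γ.pt e' s) = if e' = e then s else 0 := by
  rcases h0.eq_or_lt with rfl | h0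
  · rw [pt_zero]
    simp [distCoeff]
  · rw [show Γ.pt e' s = .inner e' ⟨s, h0, hs⟩ from Γ.pt_inner e' ⟨s, h0, hs⟩]
    rfl

theorem fract_mul_d_lt (e : Γ.G.E) (t : ℝ) : Int.fract t * Γ.d e < Γ.d e := by
  nlinarith [Int.fract_lt_one t, Γ.d_pos e]

theorem fract_mul_d_nonneg (e : Γ.G.E) (t : ℝ) : 0 ≤ Int.fract t * Γ.d e :=
  mul_nonneg (Int.fract_nonneg t) (Γ.d_pos e).le

theorem vertDeg_base (D : Γ.G.V → ℤ) (t : Γ.G.E → ℝ) (v : Γ.G.V) :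
    Γ.vertDeg v (Γ.base D t) = D v + Γ.bdry (fun e => ⌊t e⌋) v := by
  classical
  rw [base, map_add, map_sum, map_sum, bdry_apply, ← Finset.sum_sub_distrib]
  congr 1
  · rw [Finset.sum_eq_single v]
    · simp [vertDeg, vertCoeff]
    · intro w _ hw
      simp [vertDeg, vertCoeff, hw]
    · simp
  · refine Finset.sum_congr rfl fun e _ => ?_
    simp only [slide, vertDeg, map_add, map_sub, map_smul, Finsupp.linearCombination_single]
    rw [vertCoeff_pt _ _ _ (Γ.fract_mul_d_lt e _)]
    simp only [vertCoeff]
    split_ifs <;> simp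

theorem totalDist_base (D : Γ.G.V → ℤ) (t : Γ.G.E → ℝ) (e : Γ.G.E) :
    Γ.totalDist e (Γ.base D t) = Int.fract (t e) * Γ.d e := by
  classical
  rw [base, map_add, map_sum, map_sum]
  have h1 : ∀ v, Γ.totalDist e (Finsupp.single (Pt.vert v) (D v)) = 0 := by
    intro v
    simp [totalDist, distCoeff]
  have h2 : ∀ e', Γ.totalDist e (Γ.slide e' (t e')) =
      if e' = e then Int.fract (t e') * Γ.d e' else 0 := by
    intro e'
    simp only [slide, totalDist, map_add, map_sub, map_smul, Finsupp.linearCombination_single]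
    rw [distCoeff_pt _ _ _ (Γ.fract_mul_d_nonneg e' _) (Γ.fract_mul_d_lt e' _)]
    simp [distCoeff]
  simp [h1, h2]

/-- The floors in `vertDeg_base` and `totalDist_base` form integral chains and are absorbed into
`k`. What is left is linear in the real chains, with no reference to integral and fractional parts.
-/
theorem cls_base_eq_iff (D D' : Γ.G.V → ℤ) (t t' : Γ.G.E → ℝ) :
    cls (Γ.base D t) = cls (Γ.base D' t') ↔ ∃ (k : Γ.G.E → ℤ) (F : Γ.G.V → ℝ),
      (∀ v, D v - D' v + Γ.bdry k v = 0) ∧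
        ∀ e, (t e - t' e - k e) * Γ.d e = F (tail e) - F (head e) := by
  rw [cls_eq_iff]
  simp only [vertDeg_base, totalDist_base]
  constructor
  · rintro ⟨k, F, h1, h2⟩
    refine ⟨k + (fun e => ⌊t e⌋) - fun e => ⌊t' e⌋, F, fun v => ?_, fun e => ?_⟩
    · rw [map_sub, map_add, Pi.sub_apply, Pi.add_apply]
      linarith [h1 v]
    · have := h2 e
      simp only [Int.fract, Pi.sub_apply, Pi.add_apply] at this ⊢
      push_cast
      linarith
  · rintro ⟨k, F, h1, h2⟩
    refine ⟨k - (fun e => ⌊t e⌋) + fun e => ⌊t' e⌋, F, fun v => ?_, fun e => ?_⟩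
    · rw [map_add, map_sub, Pi.add_apply, Pi.sub_apply]
      linarith [h1 v]
    · have := h2 e
      simp only [Int.fract, Pi.sub_apply, Pi.add_apply] at this ⊢
      push_cast
      linarith

/-- Linear equivalence sees the inner points of an edge only through their number and their total
distance from the tail. All of them can be replaced by chips at the tail and one real coefficient.
-/
theorem cls_eq_cls_base (D : Γ.Div) :
    cls D = cls (Γ.base (fun v => Γ.vertDeg v D) fun e => Γ.totalDist e D / Γ.d e) := by
  rw [cls_eq_iff]
  refine ⟨fun e => ⌊Γ.totalDist e D / Γ.d e⌋, 0, fun v => ?_, fun e => ?_⟩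
  · rw [vertDeg_base]
    ring
  · rw [totalDist_base, Int.fract, sub_mul, div_mul_cancel₀ _ (Γ.d_pos e).ne']
    simp

theorem sum_vertDeg (D : Γ.Div) : ∑ v, Γ.vertDeg v D = Γ.degDiv D := by
  classical
  have h : ∀ p : Γ.Pt, ∑ v, Γ.vertCoeff v p = 1 := by
    rintro (w | ⟨e, s⟩) <;> simp [vertCoeff]
  simp only [vertDeg, Finsupp.linearCombination_apply, Finsupp.sum, degDiv]
  rw [Finset.sum_comm]
  simp only [← Finset.smul_sum, h]
  simp

theorem sum_mul_bdry (F : Γ.G.V → ℝ) (y : Γ.G.E → ℝ) :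
    ∑ v, F v * Γ.bdry y v = ∑ e, (F (head e) - F (tail e)) * y e := by
  classical
  simp only [bdry_apply, mul_sub, Finset.sum_sub_distrib, Finset.mul_sum, sub_mul, mul_ite, mul_zero]
  congr 1 <;>
  · rw [Finset.sum_comm]
    refine Finset.sum_congr rfl fun e _ => ?_
    simp

theorem bdry_intCast (k : Γ.G.E → ℤ) (v : Γ.G.V) :
    Γ.bdry (fun e => (k e : ℝ)) v = (Γ.bdry k v : ℤ) := by
  rw [bdry_apply, bdry_apply]
  push_cast
  rfl

theorem mem_H₁_iff (z : Γ.G.E → ℝ) : z ∈ Γ.H₁ ↔ Γ.bdry z = 0 := by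
  rw [funext_iff]
  refine forall_congr' fun v => ?_
  rw [bdry_apply]
  exact sub_eq_zero.symm

theorem cls_add (D D' : Γ.Div) : cls (D + D') = cls D + cls D' := rfl

theorem cls_base_add (D D' : Γ.G.V → ℤ) (t t' : Γ.G.E → ℝ) :
    cls (Γ.base D t) + cls (Γ.base D' t') = cls (Γ.base (D + D') (t + t')) := by
  rw [← cls_add, cls_eq_iff]
  refine ⟨(fun e => ⌊t e + t' e⌋) - (fun e => ⌊t e⌋) - fun e => ⌊t' e⌋, 0, fun v => ?_, fun e => ?_⟩
  · simp only [map_add, map_sub, vertDeg_base, Pi.add_apply, Pi.sub_apply]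
    ring
  · simp only [map_add, totalDist_base, Int.fract, Pi.add_apply, Pi.sub_apply]
    push_cast
    simp only [Pi.zero_apply]
    ring

theorem ajInv_eq (z : Γ.H₁) : Γ.ajInv z = cls (Γ.base 0 z.1) := by
  rw [ajInv, base]
  simp

/-- The length pairing. -/
noncomputable def lengthForm : LinearMap.BilinForm ℝ (Γ.G.E → ℝ) :=
  LinearMap.mk₂ ℝ (fun x y => ∑ e, Γ.d e * x e * y e)
    (fun x x' y => by
      rw [← Finset.sum_add_distrib]
      exact Finset.sum_congr rfl fun e _ => by simp only [Pi.add_apply]; ring)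
    (fun c x y => by
      rw [smul_eq_mul, Finset.mul_sum]
      exact Finset.sum_congr rfl fun e _ => by simp only [Pi.smul_apply, smul_eq_mul]; ring)
    (fun x y y' => by
      rw [← Finset.sum_add_distrib]
      exact Finset.sum_congr rfl fun e _ => by simp only [Pi.add_apply]; ring)
    (fun c x y => by
      rw [smul_eq_mul, Finset.mul_sum]
      exact Finset.sum_congr rfl fun e _ => by simp only [Pi.smul_apply, smul_eq_mul]; ring)

theorem lengthForm_apply (x y : Γ.G.E → ℝ) : Γ.lengthForm x y = ∑ e, Γ.d e * x e * y e := rfl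

/-- The gradients of functions on the vertices. -/
def grads : Submodule ℝ (Γ.G.E → ℝ) where
  carrier := {t | ∃ F : Γ.G.V → ℝ, ∀ e, t e * Γ.d e = F (tail e) - F (head e)}
  zero_mem' := ⟨0, fun e => by simp⟩
  add_mem' := by
    rintro t t' ⟨F, hF⟩ ⟨F', hF'⟩
    refine ⟨F + F', fun e => ?_⟩
    simp only [Pi.add_apply]
    linarith [hF e, hF' e]
  smul_mem' := by
    rintro c t ⟨F, hF⟩
    refine ⟨c • F, fun e => ?_⟩
    simp only [Pi.smul_apply, smul_eq_mul]
    rw [mul_assoc, hF e]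
    ring

/-- Summation by parts: pairing with the gradient of `F` is, up to sign, summing `F` against the
boundary. Testing with indicator functions of single vertices recovers the boundary. -/
theorem H₁_eq_orthogonal : Γ.H₁ = Γ.lengthForm.orthogonal Γ.grads := by
  classical
  ext z
  rw [mem_H₁_iff, LinearMap.BilinForm.mem_orthogonal_iff]
  have key : ∀ t (F : Γ.G.V → ℝ), (∀ e, t e * Γ.d e = F (tail e) - F (head e)) →
      Γ.lengthForm t z = - ∑ v, F v * Γ.bdry z v := by
    intro t F hF
    rw [sum_mul_bdry, lengthForm_apply, ← Finset.sum_neg_distrib]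
    refine Finset.sum_congr rfl fun e _ => ?_
    rw [mul_comm (Γ.d e), hF]
    ring
  constructor
  · rintro h t ⟨F, hF⟩
    rw [key t F hF, h]
    simp
  · intro h
    ext v
    let F : Γ.G.V → ℝ := Pi.single v 1
    have h1 : ∀ e, ((F (tail e) - F (head e)) / Γ.d e) * Γ.d e = F (tail e) - F (head e) :=
      fun e => div_mul_cancel₀ _ (Γ.d_pos e).ne'
    have h2 := h (fun e => (F (tail e) - F (head e)) / Γ.d e) ⟨F, h1⟩
    rw [key _ F h1] at h2
    simpa [F, Pi.single_apply] using h2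

/-- The length form is positive definite, so the gradients meet their orthogonal complement only in
zero; this is the discrete Hodge decomposition. -/
theorem isCompl_grads_H₁ : IsCompl Γ.grads Γ.H₁ := by
  rw [H₁_eq_orthogonal]
  have hs : Γ.lengthForm.IsRefl := by
    intro x y h
    rw [lengthForm_apply] at h ⊢
    rw [← h]
    exact Finset.sum_congr rfl fun e _ => by ring
  rw [LinearMap.BilinForm.isCompl_orthogonal_iff_disjoint hs, Submodule.disjoint_def]
  intro x hx hx'
  have h := hx' x hx
  change ∑ e, Γ.d e * x e * x e = 0 at h
  rw [Finset.sum_eq_zero_iff_of_nonneg fun e _ => by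
    rw [mul_assoc]
    exact mul_nonneg (Γ.d_pos e).le (mul_self_nonneg _)] at h
  ext e
  have h1 := h e (Finset.mem_univ _)
  rw [mul_assoc] at h1
  have h2 := (mul_eq_zero.1 h1).resolve_left (Γ.d_pos e).ne'
  simpa using h2

/-- The projection to the cycles along the gradients. -/
noncomputable def projH₁ : (Γ.G.E → ℝ) →ₗ[ℝ] Γ.H₁ :=
  Γ.H₁.projectionOnto Γ.grads Γ.isCompl_grads_H₁.symm

theorem sub_projH₁_mem (t : Γ.G.E → ℝ) : t - (Γ.projH₁ t).1 ∈ Γ.grads := by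
  have h : Γ.projH₁ (t - (Γ.projH₁ t).1) = 0 := by
    rw [map_sub, sub_eq_zero]
    exact (Submodule.projectionOnto_apply_left Γ.isCompl_grads_H₁.symm (Γ.projH₁ t)).symm
  exact (Submodule.projectionOnto_apply_eq_zero_iff Γ.isCompl_grads_H₁.symm).1 h

theorem projH₁_coe (z : Γ.H₁) : Γ.projH₁ z.1 = z :=
  Submodule.projectionOnto_apply_left Γ.isCompl_grads_H₁.symm z

theorem projH₁_eq_zero {t : Γ.G.E → ℝ} (h : t ∈ Γ.grads) : Γ.projH₁ t = 0 :=
  (Submodule.projectionOnto_apply_eq_zero_iff Γ.isCompl_grads_H₁.symm).2 h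

theorem continuous_projH₁ : Continuous Γ.projH₁ := Γ.projH₁.continuous_of_finiteDimensional

/-- A gradient does not change the class, so only the harmonic part of `t` counts. This writes the
class through the map that defines the topology, whence continuity in `t`. -/
theorem cls_base_eq (D : Γ.G.V → ℤ) (t : Γ.G.E → ℝ) :
    cls (Γ.base D t) = cls (Γ.base D 0) + Γ.ajInv (Γ.projH₁ t) := by
  rw [ajInv_eq, cls_base_add, add_zero, zero_add, cls_base_eq_iff]
  obtain ⟨F, hF⟩ := Γ.sub_projH₁_mem t
  refine ⟨0, F, fun v => ?_, fun e => ?_⟩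
  · rw [map_zero]
    simp
  · rw [← hF]
    simp

theorem continuous_cls_base (D : Γ.G.V → ℤ) :
    Continuous fun t : Γ.G.E → ℝ => cls (Γ.base D t) := by
  have h : Continuous fun z : Γ.H₁ => cls (Γ.base D 0) + Γ.ajInv z := by
    rw [continuous_iff_coinduced_le]
    exact le_iSup (fun c : Γ.Pic =>
      TopologicalSpace.coinduced (fun z : Γ.H₁ => c + Γ.ajInv z) inferInstance) _
  have h1 := h.comp Γ.continuous_projH₁
  convert h1 using 2 with t
  exact Γ.cls_base_eq D t

theorem isClosed_pic_iff (S : Set Γ.Pic) :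
    IsClosed S ↔ ∀ c : Γ.Pic, IsClosed ((fun z : Γ.H₁ => c + Γ.ajInv z) ⁻¹' S) := by
  rw [← isOpen_compl_iff, isOpen_iSup_iff]
  refine forall_congr' fun c => ?_
  rw [isOpen_coinduced, ← isOpen_compl_iff]
  rfl

/-- The classes of a compact family of divisors form a closed set. -/
theorem isClosed_image_cls_base (D : Γ.G.V → ℤ) {K : Set (Γ.G.E → ℝ)} (hK : IsCompact K) :
    IsClosed ((fun t => cls (Γ.base D t)) '' K) := by
  rw [isClosed_pic_iff]
  intro c
  obtain ⟨C, rfl⟩ : ∃ C : Γ.Div, cls C = c := QuotientAddGroup.mk_surjective c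
  rw [cls_eq_cls_base]
  set Dc := fun v => Γ.vertDeg v C
  set tc := fun e => Γ.totalDist e C / Γ.d e
  have hmem : ∀ z : Γ.H₁, (cls (Γ.base Dc tc) + Γ.ajInv z ∈ (fun t => cls (Γ.base D t)) '' K) ↔
      ∃ t ∈ K, ∃ k : Γ.G.E → ℤ, (∀ v, D v - Dc v + Γ.bdry k v = 0) ∧
        t - tc - z.1 - (fun e => (k e : ℝ)) ∈ Γ.grads := by
    intro z
    rw [ajInv_eq, cls_base_add, add_zero]
    refine exists_congr fun t => and_congr_right fun _ => ?_
    simp only []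
    rw [cls_base_eq_iff]
    refine exists_congr fun k => ?_
    constructor
    · rintro ⟨F, h1, h2⟩
      refine ⟨h1, F, fun e => ?_⟩
      rw [← h2 e]
      simp only [Pi.sub_apply, Pi.add_apply]
      ring
    · rintro ⟨h1, F, h2⟩
      refine ⟨F, h1, fun e => ?_⟩
      rw [← h2 e]
      simp only [Pi.sub_apply, Pi.add_apply]
      ring
  -- One integral chain `k₀` with the required boundary is fixed; the others differ from it by
  -- integral cycles. The preimage is therefore the lattice of integral cycles plus a compact set,
  -- hence closed.
  by_cases hk : ∃ k : Γ.G.E → ℤ, ∀ v, D v - Dc v + Γ.bdry k v = 0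
  · obtain ⟨k₀, hk₀⟩ := hk
    let Lat : Set Γ.H₁ := {z | ∀ e, ∃ m : ℤ, (m : ℝ) = z.1 e}
    have hLat : IsClosed Lat := by
      have : Lat = ⋂ e, (fun z : Γ.H₁ => z.1 e) ⁻¹' Set.range ((↑) : ℤ → ℝ) := by
        ext z
        simp [Lat]
      rw [this]
      refine isClosed_iInter fun e => Int.isClosedEmbedding_coe_real.isClosed_range.preimage ?_
      exact (continuous_apply e).comp continuous_subtype_val
    let φ : (Γ.G.E → ℝ) → Γ.H₁ := fun t => Γ.projH₁ (t - tc - fun e => (k₀ e : ℝ))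
    have hφ : Continuous φ := Γ.continuous_projH₁.comp (by fun_prop)
    have hcl := hLat.add_right_of_isCompact (hK.image hφ)
    convert hcl using 1
    have hcast : ∀ k : Γ.G.E → ℤ, (fun e => (k e : ℝ)) ∈ Γ.H₁ ↔ Γ.bdry k = 0 := by
      intro k
      rw [mem_H₁_iff, funext_iff, funext_iff]
      refine forall_congr' fun v => ?_
      rw [bdry_intCast]
      exact Int.cast_eq_zero
    ext z
    rw [Set.mem_preimage, hmem, Set.mem_add]
    constructor
    · rintro ⟨t, ht, k, h1, h2⟩
      have h3 : Γ.bdry (k₀ - k) = 0 := by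
        ext v
        rw [map_sub, Pi.sub_apply, Pi.zero_apply]
        linarith [h1 v, hk₀ v]
      let w : Γ.H₁ := ⟨_, (hcast _).2 h3⟩
      have h4 := Γ.projH₁_eq_zero h2
      have h5 : t - tc - z.1 - (fun e => (k e : ℝ)) = t - tc - (fun e => (k₀ e : ℝ)) - z.1 + w.1 := by
        ext e
        simp only [w, Pi.sub_apply, Pi.add_apply]
        push_cast
        ring
      rw [h5, map_add, map_sub, projH₁_coe, projH₁_coe] at h4
      refine ⟨w, fun e => ⟨_, rfl⟩, φ t, ⟨t, ht, rfl⟩, ?_⟩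
      rw [← sub_eq_zero, ← h4]
      simp only [φ]
      rw [add_comm, add_sub_right_comm]
    · rintro ⟨w, hw, _, ⟨t, ht, rfl⟩, rfl⟩
      choose m hm using hw
      have h1 : (fun e => (m e : ℝ)) = w.1 := funext hm
      refine ⟨t, ht, k₀ - m, fun v => ?_, ?_⟩
      · rw [map_sub, Pi.sub_apply, (hcast m).1 (h1 ▸ w.2), Pi.zero_apply, sub_zero]
        exact hk₀ v
      · have h2 := Γ.sub_projH₁_mem (t - tc - fun e => (k₀ e : ℝ))
        convert h2 using 1
        ext e
        simp only [φ, Submodule.coe_add, Pi.sub_apply, Pi.add_apply, ← hm]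
        push_cast
        ring
  -- Without such an integral chain, no class `c + ajInv z` is in the image.
  · convert isClosed_empty
    ext z
    rw [Set.mem_preimage, hmem]
    simp only [Set.mem_empty_iff_false, iff_false]
    rintro ⟨t, -, k, h, -⟩
    exact hk ⟨k, h⟩

end TropCurve

/-! ### The convex energy and balanced chains. -/

/-- The convex piecewise linear function interpolating `k ^ 2 / 2` at the integers. -/
noncomputable def interpSq (t : ℝ) : ℝ := t ^ 2 / 2 + Int.fract t * (1 - Int.fract t) / 2

theorem continuous_interpSq : Continuous interpSq := by
  unfold interpSq
  refine Continuous.add (by fun_prop) ?_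
  exact ContinuousOn.comp_fract'' (f := fun x : ℝ => x * (1 - x) / 2) (by fun_prop) (by norm_num)

theorem le_interpSq (t : ℝ) : t ^ 2 / 2 ≤ interpSq t := by
  unfold interpSq
  have := mul_nonneg (Int.fract_nonneg t) (sub_nonneg.2 (Int.fract_lt_one t).le)
  linarith

theorem interpSq_neg (t : ℝ) : interpSq (-t) = interpSq t := by
  unfold interpSq
  by_cases h : Int.fract t = 0
  · rw [Int.fract_neg_eq_zero.2 h, h]
    ring
  · rw [Int.fract_neg h]
    ring

/-- Up to the next integer `interpSq` is linear, with slope `(k + 1) ^ 2 / 2 - k ^ 2 / 2 = k + 1 /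
2` where `k = ⌊t⌋`. -/
theorem interpSq_add {t ε : ℝ} (h0 : 0 ≤ ε) (h1 : ε < 1 - Int.fract t) :
    interpSq (t + ε) = interpSq t + ε * (⌊t⌋ + 1 / 2) := by
  have h2 : Int.fract (t + ε) = Int.fract t + ε := by
    rw [Int.fract_eq_iff]
    refine ⟨by linarith [Int.fract_nonneg t], by linarith, ⌊t⌋, ?_⟩
    linarith [Int.floor_add_fract t]
  unfold interpSq
  rw [h2]
  have h3 : (⌊t⌋ : ℝ) = t - Int.fract t := by linarith [Int.floor_add_fract t]
  rw [h3]
  ring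

theorem eventually_interpSq_add (t c : ℝ) (hc : 0 ≤ c) :
    ∀ᶠ ε in 𝓝[>] (0 : ℝ), interpSq (t + ε * c) = interpSq t + ε * c * (⌊t⌋ + 1 / 2) := by
  have h1 : 0 < 1 - Int.fract t := sub_pos.2 (Int.fract_lt_one t)
  have h2 : Tendsto (fun ε : ℝ => ε * c) (𝓝[>] 0) (𝓝 (0 * c)) :=
    tendsto_nhdsWithin_of_tendsto_nhds (by fun_prop : Continuous fun ε : ℝ => ε * c).continuousAt
  rw [zero_mul] at h2
  filter_upwards [self_mem_nhdsWithin, h2.eventually (Iio_mem_nhds h1)] with ε h3 h4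
  exact interpSq_add (mul_nonneg (le_of_lt h3) hc) h4

theorem eventually_interpSq_sub (t c : ℝ) (hc : 0 ≤ c) :
    ∀ᶠ ε in 𝓝[>] (0 : ℝ), interpSq (t - ε * c) = interpSq t + ε * c * (⌊-t⌋ + 1 / 2) := by
  filter_upwards [eventually_interpSq_add (-t) c hc] with ε h
  rw [← interpSq_neg, ← interpSq_neg t, ← h]
  congr 1
  ring

namespace TropCurve

variable {n g : ℕ} (Γ : TropCurve g n)

open Classical in
/-- The slope of the energy of the edge `e` when the potential is raised on `A`. -/
noncomputable def flux (t : Γ.G.E → ℝ) (A : Finset Γ.G.V) (e : Γ.G.E) : ℝ :=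
  if head e ∈ A ∧ tail e ∉ A then ⌊t e⌋ + 1 / 2
  else if tail e ∈ A ∧ head e ∉ A then ⌊-t e⌋ + 1 / 2 else 0

/-- The numerical form of semistability. -/
def IsBalanced (ψ : Γ.G.V → ℝ) (D : Γ.G.V → ℤ) (t : Γ.G.E → ℝ) : Prop :=
  ∀ A : Finset Γ.G.V, ∑ v ∈ A, ψ v ≤ ∑ v ∈ A, (D v : ℝ) + ∑ e, Γ.flux t A e

/-- The signed edges of a path from `w` to `v` have this boundary, and connectedness provides the
path. Combinations of such chains reach every function on the vertices with total zero. -/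
theorem exists_bdry_single (v w : Γ.G.V) :
    open Classical in
    ∃ z : Γ.G.E → ℝ, Γ.bdry z = Pi.single v 1 - Pi.single w 1 := by
  classical
  have key : ∀ x y : Γ.G.X, Relation.EqvGen Γ.G.Step x y →
      ∃ z : Γ.G.E → ℝ, Γ.bdry z = Pi.single (root x) 1 - Pi.single (root y) 1 := by
    intro x y h
    induction h with
    | rel x y h =>
      rcases h with rfl | rfl
      · refine ⟨0, ?_⟩
        rw [show root (Γ.G.r x) = root x from Subtype.ext (Γ.G.r_r x), map_zero, sub_self]
      · rcases eq_half_or x with h | ⟨e, b, rfl⟩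
        · refine ⟨0, ?_⟩
          rw [h, map_zero, sub_self]
        · have h1 : Γ.bdry (Pi.single e (1 : ℝ)) = Pi.single (head e) 1 - Pi.single (tail e) 1 := by
            ext v
            rw [bdry_apply]
            simp only [Pi.single_apply, Pi.sub_apply]
            rw [Finset.sum_eq_single e (fun e' _ he => by simp [he]) (by simp),
              Finset.sum_eq_single e (fun e' _ he => by simp [he]) (by simp)]
            simp [eq_comm]
          rw [i_half]
          cases b
          · exact ⟨Pi.single e 1, h1⟩
          · refine ⟨- Pi.single e 1, ?_⟩
            rw [map_neg, h1, neg_sub]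
            rfl
    | refl x => exact ⟨0, by rw [map_zero, sub_self]⟩
    | symm x y _ ih =>
      obtain ⟨z, hz⟩ := ih
      exact ⟨-z, by rw [map_neg, hz, neg_sub]⟩
    | trans x y z _ _ ih1 ih2 =>
      obtain ⟨z1, hz1⟩ := ih1
      obtain ⟨z2, hz2⟩ := ih2
      exact ⟨z1 + z2, by rw [map_add, hz1, hz2, sub_add_sub_cancel]⟩
  have h := key v.1 w.1 (Γ.stable.connected.2 _ _)
  rwa [show root v.1 = v from Subtype.ext v.2, show root w.1 = w from Subtype.ext w.2] at h

theorem exists_bdry_eq (w : Γ.G.V → ℝ) (hw : ∑ v, w v = 0) : ∃ u : Γ.G.E → ℝ, Γ.bdry u = w := by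
  classical
  obtain ⟨⟨x⟩, -⟩ := Γ.stable.connected
  choose z hz using fun v => Γ.exists_bdry_single v (root x)
  have hsmul : ∀ (c : ℝ) (y : Γ.G.E → ℝ), Γ.bdry (c • y) = c • Γ.bdry y := by
    intro c y
    ext v
    rw [Pi.smul_apply, bdry_apply, bdry_apply]
    simp only [← Finset.sum_filter, Pi.smul_apply, ← Finset.smul_sum, smul_sub]
  refine ⟨∑ v, w v • z v, ?_⟩
  rw [map_sum]
  simp only [hsmul, hz, smul_sub, Finset.sum_sub_distrib, ← Finset.sum_smul, hw, zero_smul, sub_zero]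
  ext v
  simp [Finset.sum_apply, Pi.single_apply]

/-- Every chain can be made balanced by adding a gradient. -/
theorem exists_isBalanced (ψ : Γ.G.V → ℝ) (D : Γ.G.V → ℤ) (hD : ∑ v, (D v : ℝ) = ∑ v, ψ v)
    (t : Γ.G.E → ℝ) : ∃ y, y - t ∈ Γ.grads ∧ Γ.IsBalanced ψ D y := by
  classical
  obtain ⟨u, hu⟩ := Γ.exists_bdry_eq (fun v => D v - ψ v) (by
    rw [Finset.sum_sub_distrib, hD, sub_self])
  -- With the boundary of `u` equal to `D - ψ`, the derivative of the linear term in the direction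
  -- of the potential of `A` is the total of `D - ψ` over `A`.
  let J : (Γ.G.E → ℝ) → ℝ := fun y => ∑ e, Γ.d e * (interpSq (y e) + u e * y e)
  have hJ : Continuous J := by
    refine continuous_finsetSum _ fun e _ => ?_
    have := continuous_interpSq.comp (continuous_apply e : Continuous fun y : Γ.G.E → ℝ => y e)
    exact continuous_const.mul (this.add (by fun_prop))
  -- Coercivity: `interpSq y ≥ y ^ 2 / 2`, and `y ^ 2 / 2 + u * y ≥ y ^ 2 / 4 - u ^ 2` by completing
  -- the square.
  have hlow : ∀ y e, Γ.d e * ((y e) ^ 2 / 4) - ∑ e, Γ.d e * (u e) ^ 2 ≤ J y := by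
    intro y e
    have h1 : ∀ e, Γ.d e * ((y e) ^ 2 / 4) - Γ.d e * (u e) ^ 2 ≤
        Γ.d e * (interpSq (y e) + u e * y e) := by
      intro e
      rw [← mul_sub]
      refine mul_le_mul_of_nonneg_left ?_ (Γ.d_pos e).le
      nlinarith [le_interpSq (y e), sq_nonneg (y e / 2 + u e)]
    have h2 : Γ.d e * ((y e) ^ 2 / 4) ≤ ∑ e, Γ.d e * ((y e) ^ 2 / 4) :=
      Finset.single_le_sum (f := fun e => Γ.d e * ((y e) ^ 2 / 4))
        (fun e _ => mul_nonneg (Γ.d_pos e).le (by positivity)) (Finset.mem_univ e)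
    have h3 := Finset.sum_le_sum fun e (_ : e ∈ Finset.univ) => h1 e
    rw [Finset.sum_sub_distrib] at h3
    linarith
  let s : Set (Γ.G.E → ℝ) := {y | y - t ∈ Γ.grads}
  have hs : IsClosed s := by
    have h : IsClosed (Γ.grads : Set (Γ.G.E → ℝ)) := Submodule.closed_of_finiteDimensional _
    exact h.preimage (by fun_prop : Continuous fun y : Γ.G.E → ℝ => y - t)
  have ht : t ∈ s := by
    change t - t ∈ Γ.grads
    rw [sub_self]
    exact Γ.grads.zero_mem
  let C : ℝ := |J t| + ∑ e, Γ.d e * (u e) ^ 2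
  have hC : 0 ≤ C := add_nonneg (abs_nonneg _)
    (Finset.sum_nonneg fun e _ => mul_nonneg (Γ.d_pos e).le (sq_nonneg _))
  -- Outside this box some `|y e|` exceeds `1 + 4 * C / d e`, so `d e * y e ^ 2 / 4 ≥ C` and `hlow`
  -- gives `J y ≥ |J t|`. The summand 1 allows passing from `|y e|` to its square.
  have hbox : IsCompact (Set.univ.pi fun e => Set.Icc (-(1 + 4 * C / Γ.d e)) (1 + 4 * C / Γ.d e)) :=
    isCompact_univ_pi fun e => isCompact_Icc
  obtain ⟨y, hy, hmin⟩ := hJ.continuousOn.exists_isMinOn' hs ht (by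
    refine Filter.mem_inf_of_left (Filter.mem_of_superset hbox.compl_mem_cocompact ?_)
    intro y hy
    have : ∃ e, 1 + 4 * C / Γ.d e < |y e| := by
      by_contra! h
      exact hy fun e _ => abs_le.1 (h e)
    obtain ⟨e, he⟩ := this
    have h1 := hlow y e
    have h2 : 0 ≤ 4 * C / Γ.d e := div_nonneg (by linarith) (Γ.d_pos e).le
    have h3 : 4 * C / Γ.d e ≤ (y e) ^ 2 := by
      rw [← sq_abs]
      nlinarith
    rw [div_le_iff₀ (Γ.d_pos e)] at h3
    have h4 := le_abs_self (J t)
    simp only [C] at h3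
    change J t ≤ J y
    linarith)
  refine ⟨y, hy, fun A => ?_⟩
  let F : Γ.G.V → ℝ := fun v => if v ∈ A then 1 else 0
  let w : Γ.G.E → ℝ := fun e => (F (head e) - F (tail e)) / Γ.d e
  -- Raising the potential on `A` by a small `ε` changes the energy exactly linearly, since
  -- `interpSq` is piecewise linear. The slope is `flux` plus the linear term, and minimality makes
  -- the total nonnegative, which is balance at `A`.
  have hev : ∀ e, ∀ᶠ ε in 𝓝[>] (0 : ℝ),
      Γ.d e * (interpSq (y e + ε * w e) + u e * (y e + ε * w e)) =
      Γ.d e * (interpSq (y e) + u e * y e) +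
        ε * (Γ.flux y A e + (F (head e) - F (tail e)) * u e) := by
    intro e
    have hd := (Γ.d_pos e).ne'
    by_cases h1 : head e ∈ A <;> by_cases h2 : tail e ∈ A
    · refine Eventually.of_forall fun ε => ?_
      simp [w, F, h1, h2, flux]
    · filter_upwards [eventually_interpSq_add (y e) (1 / Γ.d e) (by have := Γ.d_pos e; positivity)]
        with ε h
      simp only [w, F, flux, h1, h2, if_true, if_false, not_false_eq_true, and_self, sub_zero]
      rw [h]
      field_simp
      ring
    · filter_upwards [eventually_interpSq_sub (y e) (1 / Γ.d e) (by have := Γ.d_pos e; positivity)]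
        with ε h
      simp only [w, F, flux, h1, h2, if_true, if_false, not_false_eq_true, and_self, zero_sub,
        not_true_eq_false]
      rw [show y e + ε * (-1 / Γ.d e) = y e - ε * (1 / Γ.d e) by ring, h]
      field_simp
      ring
    · refine Eventually.of_forall fun ε => ?_
      simp [w, F, h1, h2, flux]
  obtain ⟨ε, hε, hpos⟩ := ((eventually_all.2 hev).and self_mem_nhdsWithin).exists
  have hpos : 0 < ε := hpos
  have h1 : J (y + ε • w) = J y +
      ε * (∑ e, Γ.flux y A e + ∑ e, (F (head e) - F (tail e)) * u e) := by
    simp only [J, ← Finset.sum_add_distrib, Finset.mul_sum]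
    exact Finset.sum_congr rfl fun e _ => hε e
  have hw : w ∈ Γ.grads := by
    refine ⟨-F, fun e => ?_⟩
    simp only [w, Pi.neg_apply]
    rw [div_mul_cancel₀ _ (Γ.d_pos e).ne']
    ring
  have h2 : y + ε • w ∈ s := by
    change y + ε • w - t ∈ Γ.grads
    rw [add_sub_right_comm]
    exact Γ.grads.add_mem hy (Γ.grads.smul_mem ε hw)
  have h3 : J y ≤ J (y + ε • w) := hmin h2
  rw [h1, ← sum_mul_bdry, hu] at h3
  have h4 : 0 ≤ ∑ e, Γ.flux y A e + ∑ v, F v * ((D v : ℝ) - ψ v) := by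
    by_contra! h
    nlinarith [mul_neg_of_pos_of_neg hpos h]
  have h5 : ∑ v, F v * ((D v : ℝ) - ψ v) = ∑ v ∈ A, (D v : ℝ) - ∑ v ∈ A, ψ v := by
    rw [← Finset.sum_sub_distrib]
    simp [F, Finset.sum_ite_mem]
  rw [h5] at h4
  linarith

theorem cut_eq_sum (A : Finset Γ.G.V) : open Classical in
    (cut A : ℝ) = ∑ e : Γ.G.E, if (tail e ∈ A ↔ head e ∈ A) then 0 else 1 := by
  classical
  rw [cut, Nat.card_eq_fintype_card, Fintype.card_subtype, Finset.card_filter]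
  push_cast
  exact Finset.sum_congr rfl fun e _ => by split_ifs <;> rfl

/-- Every edge of the cut contributes an integer plus one half, every other edge zero. -/
theorem exists_sum_flux_eq (t : Γ.G.E → ℝ) (A : Finset Γ.G.V) :
    ∃ m : ℤ, ∑ e, Γ.flux t A e = m + (cut A : ℝ) / 2 := by
  classical
  have h : ∀ e, ∃ m : ℤ, Γ.flux t A e =
      m + (if (tail e ∈ A ↔ head e ∈ A) then (0 : ℝ) else 1) / 2 := by
    intro e
    unfold flux
    by_cases h1 : head e ∈ A <;> by_cases h2 : tail e ∈ A
    · exact ⟨0, by simp [h1, h2]⟩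
    · exact ⟨⌊t e⌋, by simp [h1, h2]⟩
    · exact ⟨⌊-t e⌋, by simp [h1, h2]⟩
    · exact ⟨0, by simp [h1, h2]⟩
  choose m hm using h
  refine ⟨∑ e, m e, ?_⟩
  rw [cut_eq_sum, Finset.sum_div, Int.cast_sum, ← Finset.sum_add_distrib]
  exact Finset.sum_congr rfl fun e _ => hm e

/-- Balanced chains in the same class modulo gradients coincide. -/
theorem IsBalanced.unique {ψ : Γ.G.V → ℝ} {D : Γ.G.V → ℤ}
    (hD : ∑ v, (D v : ℝ) = ∑ v, ψ v)
    (hψ : ∀ A : Finset Γ.G.V, A.Nonempty → A ≠ Finset.univ →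
      ¬ ∃ k : ℤ, ∑ v ∈ A, ψ v + (cut A : ℝ) / 2 = k)
    {t t' : Γ.G.E → ℝ} (h : Γ.IsBalanced ψ D t) (h' : Γ.IsBalanced ψ D t')
    (htt' : t - t' ∈ Γ.grads) : t = t' := by
  classical
  obtain ⟨F, hF⟩ := htt'
  obtain ⟨⟨x⟩, -⟩ := Γ.stable.connected
  have : Nonempty Γ.G.V := ⟨root x⟩
  obtain ⟨v₀, hv₀⟩ := Finite.exists_max F
  -- The set where `F` is maximal: along each edge that leaves it, `t` and `t'` are strictly
  -- ordered.
  let A : Finset Γ.G.V := Finset.univ.filter fun v => F v = F v₀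
  have hA : ∀ v, v ∈ A ↔ F v = F v₀ := fun v => by simp [A]
  by_cases hu : A = Finset.univ
  · ext e
    have h1 : ∀ v, F v = F v₀ := fun v => (hA v).1 (hu ▸ Finset.mem_univ v)
    have h2 := hF e
    rw [h1 (tail e), h1 (head e), sub_self] at h2
    have h3 := (mul_eq_zero.1 h2).resolve_right (Γ.d_pos e).ne'
    rw [Pi.sub_apply] at h3
    linarith
  exfalso
  refine hψ A ⟨v₀, (hA v₀).2 rfl⟩ hu ?_
  -- On a cut edge the sum is `⌊a⌋ - ⌈b⌉ + 1`, where `a < b` are the coefficients of the two chains.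
  -- Since `⌊a⌋ < ⌈b⌉`, it is at most zero.
  have hle : ∀ e, Γ.flux t A e + Γ.flux t' Aᶜ e ≤ 0 := by
    intro e
    have hd := Γ.d_pos e
    have he := hF e
    rw [Pi.sub_apply] at he
    unfold flux
    simp only [Finset.mem_compl]
    by_cases h1 : head e ∈ A <;> by_cases h2 : tail e ∈ A
    · simp [h1, h2]
    · have h3 : F (tail e) < F v₀ := lt_of_le_of_ne (hv₀ _) fun h => h2 ((hA _).2 h)
      rw [(hA _).1 h1] at he
      have h4 : t e < t' e := by
        by_contra! h5
        nlinarith [mul_nonneg (sub_nonneg.2 h5) hd.le]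
      have h5 : ⌊t e⌋ < ⌈t' e⌉ := Int.cast_lt.1
        ((Int.floor_le (t e)).trans_lt (h4.trans_le (Int.le_ceil (t' e))))
      have h6 : ((⌊t e⌋ + 1 : ℤ) : ℝ) ≤ ⌈t' e⌉ := Int.cast_le.2 h5
      push_cast at h6
      simp only [h1, h2, not_true_eq_false, if_false, not_false_eq_true, and_self,
        if_true, Int.floor_neg, Int.cast_neg]
      linarith
    · have h3 : F (head e) < F v₀ := lt_of_le_of_ne (hv₀ _) fun h => h1 ((hA _).2 h)
      rw [(hA _).1 h2] at he
      have h4 : t' e < t e := by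
        by_contra! h5
        nlinarith [mul_nonneg (sub_nonneg.2 h5) hd.le]
      have h5 : ⌊t' e⌋ < ⌈t e⌉ := Int.cast_lt.1
        ((Int.floor_le (t' e)).trans_lt (h4.trans_le (Int.le_ceil (t e))))
      have h6 : ((⌊t' e⌋ + 1 : ℤ) : ℝ) ≤ ⌈t e⌉ := Int.cast_le.2 h5
      push_cast at h6
      simp only [h1, h2, not_true_eq_false, if_false, not_false_eq_true, and_self,
        if_true, Int.floor_neg, Int.cast_neg]
      linarith
    · simp [h1, h2]
  have hsum := Finset.sum_nonpos fun e (_ : e ∈ Finset.univ) => hle e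
  rw [Finset.sum_add_distrib] at hsum
  have h1 := h A
  have h2 := h' Aᶜ
  have h3 := Finset.sum_add_sum_compl A ψ
  have h4 := Finset.sum_add_sum_compl A fun v => (D v : ℝ)
  obtain ⟨m, hm⟩ := Γ.exists_sum_flux_eq t A
  -- Both balance inequalities are now equalities, so the sum of `ψ` over `A` is an integer plus
  -- half the cut. Adding the other half makes it integral.
  refine ⟨∑ v ∈ A, D v + m + cut A, ?_⟩
  push_cast
  linarith

end TropCurve

/-! ### Contraction to one vertex, which makes the total of a stability condition constant. -/

section Corolla

variable {n g : ℕ}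

theorem corolla_isVertex (v : (WGraph.corolla g n).V) : v = ⟨none, rfl⟩ := by
  obtain ⟨_ | j, hv⟩ := v
  · rfl
  · exact absurd hv.symm (Option.some_ne_none j)

theorem corolla_isStable (hgn : (0 : ℤ) < 2 * (g : ℤ) - 2 + n) :
    (WGraph.corolla g n).IsStable g := by
  have hc : (WGraph.corolla g n).Connected :=
    connected_of_center (G := (WGraph.corolla g n).toGraph) none fun x => .rel _ _ (Or.inl rfl)
  refine ⟨hc, ?_, fun v => ?_⟩
  · let P : EdgePres (WGraph.corolla g n).toGraph Empty :=
      { h := fun j => j.elim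
        conj := fun j => j.elim
        ne := fun j => j.elim
        inj := fun j => j.elim
        surj := fun x hx => absurd rfl hx }
    let f : Unit ≃ (WGraph.corolla g n).V :=
      { toFun := fun _ => ⟨none, rfl⟩
        invFun := fun _ => ()
        left_inv := fun _ => rfl
        right_inv := fun w => (corolla_isVertex w).symm }
    rw [genus_eq_of_pres hc P f]
    have h1 : ∑ w : Unit, ((WGraph.corolla g n).h (f w) : ℤ) = g := Fintype.sum_unique _
    rw [h1]
    simp
  · rw [corolla_isVertex v]
    have h1 : val (G := (WGraph.corolla g n).toGraph) ⟨none, rfl⟩ = n := by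
      refine Eq.trans ?_ (Nat.card_fin n)
      refine (Nat.card_congr (Equiv.ofBijective
        (fun j : Fin n => ⟨some j, fun h => Option.some_ne_none j (Eq.symm h), rfl⟩) ⟨?_, ?_⟩)).symm
      · intro i j h
        exact Option.some_injective _ (congrArg (fun z => z.1) h)
      · rintro ⟨_ | j, h, -⟩
        · exact absurd rfl h
        · exact ⟨j, rfl⟩
    rw [h1]
    exact hgn

variable (G : WGraph n)

open Classical in
/-- The contraction of everything but the legs. -/
noncomputable def collapse (x : G.X) : Option (Fin n) :=
  if h : G.IsLeg x then some (G.m.symm ⟨x, h⟩) else none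

variable {G}

theorem collapse_of_not_isLeg {x : G.X} (h : ¬ G.IsLeg x) : collapse G x = none := dif_neg h

theorem collapse_leg (j : Fin n) : collapse G (G.m j).1 = some j := by
  rw [collapse, dif_pos (G.m j).2, Subtype.coe_eta, Equiv.symm_apply_apply]

theorem collapse_eq_none {x : G.X} : collapse G x = none ↔ ¬ G.IsLeg x := by
  refine ⟨fun h hx => ?_, collapse_of_not_isLeg⟩
  rw [collapse, dif_pos hx] at h
  exact Option.some_ne_none _ h

theorem not_isLeg_r (x : G.X) : ¬ G.IsLeg (G.r x) := fun h => h.1 (isVertex_r x)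

theorem collapse_r (x : G.X) :
    collapse G (G.r x) = (WGraph.corolla g n).r (collapse G x) :=
  collapse_of_not_isLeg (not_isLeg_r x)

theorem collapse_i (x : G.X) :
    collapse G (G.i x) = (WGraph.corolla g n).i (collapse G x) := by
  change _ = collapse G x
  by_cases h : G.i x = x
  · rw [h]
  · rw [collapse_of_not_isLeg fun h1 => h h1.2, collapse_of_not_isLeg fun h1 => h ?_]
    have h2 := h1.2
    rw [G.i_i] at h2
    exact h2.symm

/-- The elements that are not legs. -/
noncomputable abbrev collapseFiber (G : WGraph n) (g : ℕ) : Graph :=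
  fiber (G₁ := G.toGraph) (G₂ := (WGraph.corolla g n).toGraph) (collapse G) collapse_r collapse_i
    ⟨none, rfl⟩

theorem collapseFiber_connected (hG : G.IsStable g) : (collapseFiber G g).Connected := by
  classical
  -- Retracting each leg to its root carries steps to steps, so connectedness survives the removal
  -- of the legs.
  let F : G.X → (collapseFiber G g).X := fun x => ⟨if G.IsLeg x then G.r x else x,
    collapse_of_not_isLeg (by
      split_ifs with h
      · exact not_isLeg_r x
      · exact h)⟩
  have hr : ∀ x, (F x).1 = x ∨ (F x).1 = G.r x := by
    intro x
    by_cases h : G.IsLeg x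
    · exact Or.inr (if_pos h)
    · exact Or.inl (if_neg h)
  have hF : ∀ x, ¬ G.IsLeg x → (F x).1 = x := fun x h => if_neg h
  have hmap : ∀ x y, Relation.EqvGen G.Step x y →
      Relation.EqvGen (collapseFiber G g).Step (F x) (F y) := by
    intro x y h
    induction h with
    | rel x y h =>
      rcases h with rfl | rfl
      · refine .rel _ _ (Or.inl (Subtype.ext ?_))
        rw [hF _ (not_isLeg_r x)]
        change G.r x = G.r (F x).1
        rcases hr x with h | h
        · rw [h]
        · rw [h, G.r_r]
      · by_cases h : G.IsLeg x
        · rw [h.2]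
          exact .refl _
        · refine .rel _ _ (Or.inr (Subtype.ext ?_))
          have h1 : ¬ G.IsLeg (G.i x) := by
            intro h1
            have h2 := h1.2
            rw [G.i_i] at h2
            rw [← h2] at h1
            exact h h1
          rw [hF _ h1]
          change G.i x = G.i (F x).1
          rw [hF _ h]
    | refl x => exact .refl _
    | symm x y _ ih => exact ih.symm
    | trans x y z _ _ ih1 ih2 => exact ih1.trans _ _ _ ih2
  obtain ⟨⟨x⟩, hc⟩ := hG.connected
  refine connected_of_center (F x) fun y => ?_
  have h := hmap _ _ (hc y.1 x)
  rwa [show F y.1 = y from Subtype.ext (hF _ (collapse_eq_none.1 y.2))] at h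

theorem not_isLeg_half (e : G.E) (b : Bool) : ¬ G.IsLeg (half e b) := fun h =>
  isHalfEdge_half e b h.2

/-- The edges of a graph are those of the complement of the legs. -/
noncomputable def collapseFiberPres : EdgePres (collapseFiber G g) G.E where
  h e b := ⟨half e b, collapse_of_not_isLeg (not_isLeg_half e b)⟩
  conj e b := Subtype.ext (i_half e b)
  ne e h := by
    have h1 : half e true = half e false := congrArg Subtype.val h
    simpa using (half_inj h1).2
  inj e e' b b' h := by
    have h1 : half e b = half e' b' := congrArg Subtype.val h
    exact (half_inj h1).1
  surj x hx := by
    obtain ⟨e, b, h⟩ := exists_half (G := G.toGraph) (x := x.1) fun h => hx (Subtype.ext h)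
    exact ⟨e, b, Subtype.ext h⟩

/-- The vertices of a graph are those of the complement of the legs. -/
noncomputable def collapseFiberV : G.V ≃ (collapseFiber G g).V where
  toFun v := ⟨⟨v.1, collapse_of_not_isLeg fun h => h.1 v.2⟩, Subtype.ext v.2⟩
  invFun w := ⟨w.1.1, congrArg Subtype.val w.2⟩
  left_inv _ := rfl
  right_inv _ := rfl

/-- The morphism to the graph with one vertex and no edges. -/
noncomputable def collapseHom (hG : G.IsStable g) : Hom G (WGraph.corolla g n) where
  toFun := collapse G
  map_r := collapse_r
  map_i := collapse_i
  flag_fiber f hf := by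
    obtain _ | j := f
    · exact absurd rfl hf
    · refine ⟨(G.m j).1, (G.m j).2.1, fun y => ⟨fun h => ?_, ?_⟩⟩
      · have hy : G.IsLeg y := by
          by_contra h1
          rw [collapse_of_not_isLeg h1] at h
          exact Option.some_ne_none j h.symm
        rw [collapse, dif_pos hy] at h
        have h1 := Option.some_injective _ h
        rw [← h1, Equiv.apply_symm_apply]
      · rintro rfl
        exact collapse_leg j
  map_m j := collapse_leg j
  fiber_connected v := by
    rw [corolla_isVertex v]
    exact collapseFiber_connected hG
  fiber_genus v := by
    obtain rfl := corolla_isVertex v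
    refine (genus_eq_of_pres (collapseFiber_connected hG) collapseFiberPres collapseFiberV _).trans ?_
    have h := genus_eq_of_pres hG.connected (EdgePres.self _) (Equiv.refl _) G.h
    rw [hG.genus_eq] at h
    exact h.symm

end Corolla

/-! ### Stability values, cuts and degrees on a triple. -/

namespace StabCond

variable {n g : ℕ} (φ : StabCond g n) {G : WGraph n}

/-- The total of `φ` on a stable graph is its degree. -/
theorem sum_eq_degree (hgn : (0 : ℤ) < 2 * (g : ℤ) - 2 + n) (hG : G.IsStable g) :
    ∑ v, φ.toFun G v = φ.degree := by
  classical
  have h1 : ∀ w, φ.toFun (WGraph.corolla g n) w = ∑ v, φ.toFun G v := by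
    intro w
    rw [φ.map_eq G _ hG (corolla_isStable hgn) (collapseHom hG)]
    refine Finset.sum_congr rfl fun v _ => if_pos ?_
    rw [corolla_isVertex w]
    exact collapse_of_not_isLeg fun h => h.1 v.2
  have h2 : ∑ w, φ.toFun (WGraph.corolla g n) w = ∑ v, φ.toFun G v := by
    rw [Finset.sum_eq_single ⟨none, rfl⟩]
    · exact h1 _
    · intro w _ hw
      exact absurd (corolla_isVertex w) hw
    · intro h
      exact absurd (Finset.mem_univ _) h
  obtain ⟨k, hk⟩ := φ.integral G hG
  rw [degree, h2, hk, Int.floor_intCast]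

variable {Gb : WGraph n}

/-- `o.ρ` is an isomorphism of stable graphs, so compatibility with morphisms transports the value
with a single term in the sum. -/
theorem onQuasi_embV (hG : Gb.IsStable g) (o : QD g Gb) (v : Gb.V) :
    φ.onQuasi o.qs (o.embV v) = φ.toFun Gb v := by
  classical
  have hst := hG.of_bijective o.ρ o.ρ_bij
  rw [onQuasi, dif_neg (o.not_isExc_embV v)]
  refine (φ.map_eq Gb _ hG hst o.ρ _).trans ?_
  rw [Finset.sum_eq_single v]
  · exact if_pos rfl
  · intro w _ hw
    exact if_neg fun h => hw (Subtype.ext (o.ρ_bij.1 h))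
  · simp

theorem onQuasi_excV (o : QD g Gb) {e : Gb.E} (he : o.IsExcEdge e) :
    φ.onQuasi o.qs (o.excV e) = 0 := by
  rw [onQuasi, dif_pos (o.isExc_excV he)]

end StabCond

namespace QD

variable {n g : ℕ} {Gb : WGraph n} (o : QD g Gb)

/-- The edges of the graph of `o`. -/
noncomputable def edgePres : EdgePres o.G.toGraph ({e // e ∉ o.excSet} ⊕ (o.excSet × Bool)) :=
  (subPres Gb.toGraph o.excSet).map o.subEquiv o.subEquiv_i

theorem root_edgePres_inl (e : {e // e ∉ o.excSet}) (b : Bool) :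
    root (o.edgePres.h (.inl e) b) = o.embV (root (half e.1 b)) := o.root_emb _

theorem root_edgePres_inr_true (e : o.excSet) (c : Bool) :
    root (o.edgePres.h (.inr (e, c)) true) = o.embV (root (half e.1 c)) := o.root_emb _

theorem root_edgePres_inr_false (e : o.excSet) (c : Bool) :
    root (o.edgePres.h (.inr (e, c)) false) = o.excV e.1 :=
  o.isExc_root_subMap_inr (e, some c)

open Classical in
theorem cut_eq_sum (S : Finset o.G.V) : (cut S : ℝ) = ∑ e : Gb.E, if o.IsExcEdge e then
      (if (o.embV (tail e) ∈ S ↔ o.excV e ∈ S) then 0 else 1) +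
        (if (o.embV (head e) ∈ S ↔ o.excV e ∈ S) then 0 else 1)
    else if (o.embV (tail e) ∈ S ↔ o.embV (head e) ∈ S) then 0 else 1 := by
  have : Fintype o.excSet := Fintype.ofFinite _
  rw [o.edgePres.cut_eq, Nat.card_eq_fintype_card, Fintype.card_subtype, Finset.card_filter]
  push_cast
  simp only [ite_not, Fintype.sum_sum_type, Fintype.sum_prod_type, Fintype.sum_bool,
    root_edgePres_inl, root_edgePres_inr_true, root_edgePres_inr_false, root_half_true,
    root_half_false]
  rw [← Finset.sum_filter_add_sum_filter_not Finset.univ (fun e => o.IsExcEdge e) (fun e =>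
    if o.IsExcEdge e then _ else _), add_comm]
  congr 1
  · rw [Finset.sum_subtype (p := fun e => e ∈ o.excSet) (Finset.univ.filter fun e => o.IsExcEdge e)
      (fun e => by simp [excSet])]
    exact Finset.sum_congr rfl fun e _ => (if_pos e.2).symm
  · rw [Finset.sum_subtype (p := fun e => e ∉ o.excSet) (Finset.univ.filter fun e => ¬ o.IsExcEdge e)
      (fun e => by simp [excSet])]
    exact Finset.sum_congr rfl fun e _ => (if_neg e.2).symm

open Classical in
theorem sum_finset {M : Type*} [AddCommMonoid M] (S : Finset o.G.V) (f : o.G.V → M) :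
    ∑ w ∈ S, f w = ∑ v ∈ Finset.univ.filter (fun v => o.embV v ∈ S), f (o.embV v) +
      ∑ e : Gb.E, if o.IsExcEdge e ∧ o.excV e ∈ S then f (o.excV e) else 0 := by
  have h : ∑ w ∈ S, f w = ∑ w, if w ∈ S then f w else 0 := by simp
  rw [h, sum_vertices, Finset.sum_filter]
  congr 1
  refine Finset.sum_congr rfl fun e _ => ?_
  by_cases he : o.IsExcEdge e <;> simp [he]

open Classical in
/-- The divisor on `Gb` obtained by moving all exceptional chips to the tails of their edges. -/
noncomputable def baseDeg (v : Gb.V) : ℤ :=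
  o.D (o.embV v) + ∑ e : Gb.E, if o.IsExcEdge e ∧ tail e = v then 1 else 0

open Classical in
theorem sum_baseDeg (A : Finset Gb.V) : ∑ v ∈ A, o.baseDeg v =
    ∑ v ∈ A, o.D (o.embV v) + ∑ e : Gb.E, if o.IsExcEdge e ∧ tail e ∈ A then 1 else 0 := by
  simp only [baseDeg, Finset.sum_add_distrib]
  congr 1
  rw [Finset.sum_comm]
  refine Finset.sum_congr rfl fun e _ => ?_
  by_cases he : o.IsExcEdge e <;> simp [he]

theorem sum_baseDeg_univ : ∑ v, o.baseDeg v = o.deg := by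
  classical
  rw [sum_baseDeg, deg, sum_vertices]
  congr 1
  refine Finset.sum_congr rfl fun e _ => ?_
  by_cases he : o.IsExcEdge e
  · simp [he, o.D_excV he]
  · simp [he]

open Classical in
/-- The set of vertices of the graph of `o` spanned by a set of vertices of `Gb`. -/
noncomputable def span (A : Finset Gb.V) : Finset o.G.V :=
  Finset.univ.filter fun w => (∃ v ∈ A, w = o.embV v) ∨
    ∃ e, o.IsExcEdge e ∧ tail e ∈ A ∧ head e ∈ A ∧ w = o.excV e

theorem embV_ne_excV {v : Gb.V} {e : Gb.E} (he : o.IsExcEdge e) : o.embV v ≠ o.excV e := fun h =>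
  o.not_isExc_embV v (h ▸ o.isExc_excV he)

theorem excV_inj {e e' : Gb.E} (he : o.IsExcEdge e) (he' : o.IsExcEdge e')
    (h : o.excV e = o.excV e') : e = e' := by
  have h1 : o.vEquiv (.inr ⟨e, he⟩) = o.vEquiv (.inr ⟨e', he'⟩) := h
  exact congrArg Subtype.val (Sum.inr_injective (o.vEquiv.injective h1))

theorem embV_mem_span {A : Finset Gb.V} {v : Gb.V} : o.embV v ∈ o.span A ↔ v ∈ A := by
  simp only [span, Finset.mem_filter, Finset.mem_univ, true_and]
  constructor
  · rintro (⟨w, hw, h⟩ | ⟨e, he, -, -, h⟩)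
    · rwa [o.embV_injective h]
    · exact absurd h (o.embV_ne_excV he)
  · exact fun h => Or.inl ⟨v, h, rfl⟩

theorem excV_mem_span {A : Finset Gb.V} {e : Gb.E} (he : o.IsExcEdge e) :
    o.excV e ∈ o.span A ↔ tail e ∈ A ∧ head e ∈ A := by
  simp only [span, Finset.mem_filter, Finset.mem_univ, true_and]
  constructor
  · rintro (⟨w, hw, h⟩ | ⟨e', he', h1, h2, h⟩)
    · exact absurd h.symm (o.embV_ne_excV he)
    · obtain rfl := o.excV_inj he he' h
      exact ⟨h1, h2⟩
  · exact fun h => Or.inr ⟨e, he, h.1, h.2, rfl⟩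

end QD

/-! ### Semistability of divisors as balance of chains. -/

namespace TropCurve

variable {n g : ℕ} (Γ : TropCurve g n) (o : QD g Γ.G)

/-- The exceptional vertex on `e` joins the span only if both ends of `e` do. If the ends are
separated, exactly one of the two pieces of `e` is cut; otherwise none is. -/
theorem cut_span (A : Finset Γ.G.V) : (cut (o.span A) : ℝ) = cut A := by
  classical
  rw [o.cut_eq_sum, Γ.cut_eq_sum]
  refine Finset.sum_congr rfl fun e _ => ?_
  by_cases he : o.IsExcEdge e
  · rw [if_pos he]
    simp only [o.embV_mem_span, o.excV_mem_span he]
    by_cases h1 : tail e ∈ A <;> by_cases h2 : head e ∈ A <;> simp [h1, h2]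
  · rw [if_neg he]
    simp only [o.embV_mem_span]

variable (φ : StabCond g n)

theorem sum_onQuasi (S : Finset o.G.V) : open Classical in
    ∑ w ∈ S, φ.onQuasi o.qs w =
      ∑ v ∈ Finset.univ.filter (fun v => o.embV v ∈ S), φ.toFun Γ.G v := by
  classical
  rw [o.sum_finset]
  simp only [φ.onQuasi_embV Γ.stable]
  rw [Finset.sum_eq_zero (s := (Finset.univ : Finset Γ.G.E)), add_zero]
  intro e _
  by_cases he : o.IsExcEdge e ∧ o.excV e ∈ S
  · rw [if_pos he, φ.onQuasi_excV o he.1]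
  · rw [if_neg he]

theorem sum_D (S : Finset o.G.V) : open Classical in
    ∑ w ∈ S, o.D w = ∑ v ∈ Finset.univ.filter (fun v => o.embV v ∈ S), o.D (o.embV v) +
      ∑ e : Γ.G.E, if o.IsExcEdge e ∧ o.excV e ∈ S then 1 else 0 := by
  classical
  rw [o.sum_finset]
  congr 1
  refine Finset.sum_congr rfl fun e _ => ?_
  by_cases he : o.IsExcEdge e ∧ o.excV e ∈ S
  · rw [if_pos he, if_pos he, o.D_excV he.1]
  · rw [if_neg he, if_neg he]

theorem filter_embV_span (A : Finset Γ.G.V) : open Classical in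
    Finset.univ.filter (fun v => o.embV v ∈ o.span A) = A := by
  ext v
  simp [o.embV_mem_span]

variable {φ o}

/-- A semistable divisor gives balanced chains. -/
theorem isBalanced_of_isSemistable (h : φ.IsSemistable o.qs o.D) {t : Γ.G.E → ℝ}
    (ht : ∀ e, 0 ≤ t e ∧ t e ≤ 1) (ht' : ∀ e, ¬ o.IsExcEdge e → t e = 0) :
    Γ.IsBalanced (φ.toFun Γ.G) o.baseDeg t := by
  classical
  intro A
  have h1 := (h.2 (o.span A)).1
  rw [Γ.sum_onQuasi, Γ.sum_D, filter_embV_span, cut_span, Γ.cut_eq_sum] at h1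
  have h2 := o.sum_baseDeg A
  have h3 : ∑ v ∈ A, (o.baseDeg v : ℝ) = ((∑ v ∈ A, o.baseDeg v : ℤ) : ℝ) := by push_cast; rfl
  rw [h3, h2]
  -- The comparison is made edge by edge. On an exceptional edge it needs only `⌊t e⌋ ≥ 0` and `⌊-t
  -- e⌋ ≥ -1`, so the endpoints 0 and 1 of the interval are allowed.
  have h4 : ∀ e, (if o.IsExcEdge e ∧ o.excV e ∈ o.span A then (1 : ℝ) else 0) +
      (if (tail e ∈ A ↔ head e ∈ A) then 0 else 1) / 2 ≤
      (if o.IsExcEdge e ∧ tail e ∈ A then (1 : ℝ) else 0) + Γ.flux t A e := by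
    intro e
    have hfz : 0 ≤ ⌊t e⌋ := Int.floor_nonneg.2 (ht e).1
    have hf : (0 : ℝ) ≤ ⌊t e⌋ := Int.cast_nonneg hfz
    unfold flux
    by_cases he : o.IsExcEdge e
    · have hf' : (-1 : ℝ) ≤ ⌊-t e⌋ := by
        have : (-1 : ℤ) ≤ ⌊-t e⌋ := Int.le_floor.2 (by push_cast; linarith [(ht e).2])
        exact_mod_cast this
      simp only [o.excV_mem_span he]
      by_cases h1 : tail e ∈ A <;> by_cases h2 : head e ∈ A <;> simp [h1, h2, he] <;> linarith
    · rw [ht' e he]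
      by_cases h1 : tail e ∈ A <;> by_cases h2 : head e ∈ A <;> simp [h1, h2, he]
  have h5 := Finset.sum_le_sum fun e (_ : e ∈ Finset.univ) => h4 e
  rw [Finset.sum_add_distrib, Finset.sum_add_distrib, ← Finset.sum_div] at h5
  push_cast at h1 ⊢
  linarith

/-- Balanced chains give semistable divisors. -/
theorem isSemistable_of_isBalanced (hgn : (0 : ℤ) < 2 * (g : ℤ) - 2 + n) {t : Γ.G.E → ℝ}
    (h : Γ.IsBalanced (φ.toFun Γ.G) o.baseDeg t) (hd : o.deg = φ.degree)
    (ht : ∀ e, o.IsExcEdge e → 0 < t e ∧ t e < 1) (ht' : ∀ e, ¬ o.IsExcEdge e → t e = 0) :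
    φ.IsSemistable o.qs o.D := by
  classical
  have hlow : ∀ S : Finset o.G.V, ∑ v ∈ S, φ.onQuasi o.qs v - (Graph.cut S : ℝ) / 2 ≤
      ((∑ v ∈ S, o.D v : ℤ) : ℝ) := by
    intro S
    rw [Γ.sum_onQuasi, Γ.sum_D, o.cut_eq_sum]
    set A := Finset.univ.filter (fun v => o.embV v ∈ S) with hA
    have hmem : ∀ v, o.embV v ∈ S ↔ v ∈ A := fun v => by simp [hA]
    have h1 := h A
    have h2 := o.sum_baseDeg A
    have h3 : ∑ v ∈ A, (o.baseDeg v : ℝ) = ((∑ v ∈ A, o.baseDeg v : ℤ) : ℝ) := by push_cast; rfl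
    rw [h3, h2] at h1
    -- For `t e` strictly between 0 and 1 the two floors are 0 and -1. The inequality then holds
    -- whether or not the exceptional vertex belongs to `S`.
    have h4 : ∀ e, (if o.IsExcEdge e ∧ tail e ∈ A then (1 : ℝ) else 0) + Γ.flux t A e ≤
        (if o.IsExcEdge e ∧ o.excV e ∈ S then (1 : ℝ) else 0) + (if o.IsExcEdge e then
          (if (o.embV (tail e) ∈ S ↔ o.excV e ∈ S) then (0 : ℝ) else 1) +
            (if (o.embV (head e) ∈ S ↔ o.excV e ∈ S) then 0 else 1)
        else if (o.embV (tail e) ∈ S ↔ o.embV (head e) ∈ S) then 0 else 1) / 2 := by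
      intro e
      unfold flux
      simp only [hmem]
      by_cases he : o.IsExcEdge e
      · have hf : ⌊t e⌋ = 0 := Int.floor_eq_zero_iff.2 ⟨(ht e he).1.le, (ht e he).2⟩
        have hf' : ⌊-t e⌋ = -1 := by
          rw [Int.floor_eq_iff]
          push_cast
          constructor <;> linarith [(ht e he).1, (ht e he).2]
        rw [hf, hf']
        by_cases h1 : tail e ∈ A <;> by_cases h2 : head e ∈ A <;> by_cases h3 : o.excV e ∈ S <;>
          simp [h1, h2, h3, he]
      · rw [ht' e he]
        by_cases h1 : tail e ∈ A <;> by_cases h2 : head e ∈ A <;> simp [h1, h2, he]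
    have h5 := Finset.sum_le_sum fun e (_ : e ∈ Finset.univ) => h4 e
    rw [Finset.sum_add_distrib, Finset.sum_add_distrib, ← Finset.sum_div] at h5
    push_cast at h1 ⊢
    linarith
  -- The upper bound for `S` is the lower bound for its complement, because `D` and `φ` have the
  -- same total and the two cuts agree.
  refine ⟨hd, fun S => ⟨hlow S, ?_⟩⟩
  have h1 := hlow Sᶜ
  have h2 := Finset.sum_add_sum_compl S o.D
  have h3 := Finset.sum_add_sum_compl S (φ.onQuasi o.qs)
  have h4 : ∑ w, φ.onQuasi o.qs w = φ.degree := by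
    rw [Γ.sum_onQuasi]
    simp [φ.sum_eq_degree hgn Γ.stable]
  have h5 : (cut Sᶜ : ℝ) = cut S := by
    unfold cut
    congr 1
    refine Nat.card_congr (Equiv.subtypeEquivRight fun e => ?_)
    simp only [Finset.mem_compl]
    tauto
  have h6 : ((∑ v ∈ S, o.D v : ℤ) : ℝ) + ((∑ v ∈ Sᶜ, o.D v : ℤ) : ℝ) = φ.degree := by
    rw [← Int.cast_add, h2]
    exact congrArg _ hd
  rw [h4] at h3
  rw [h5] at h1
  linarith

/-- Generality is applied to the subdivision of no edges. It has no exceptional vertices, so one of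
the two complementary sets would have to be empty. -/
theorem not_exists_of_isGeneral (hφ : φ.IsGeneral) (A : Finset Γ.G.V) (hA : A.Nonempty)
    (hA' : A ≠ Finset.univ) : ¬ ∃ k : ℤ, ∑ v ∈ A, φ.toFun Γ.G v + (cut A : ℝ) / 2 = k := by
  classical
  rintro ⟨k, hk⟩
  let o : QD g Γ.G := QD.canon ∅ Γ.stable 0
  have h := hφ o.G o.qs (o.span A) ⟨k, by
    rw [Γ.sum_onQuasi, filter_embV_span, cut_span, hk]⟩
  rcases h with h | h
  · obtain ⟨v, hv⟩ := hA
    exact o.not_isExc_embV v (h _ (o.embV_mem_span.2 hv))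
  · obtain ⟨v, hv⟩ : ∃ v, v ∉ A := by
      by_contra! h1
      exact hA' (Finset.eq_univ_iff_forall.2 h1)
    exact o.not_isExc_embV v (h _ fun h1 => hv (o.embV_mem_span.1 h1))

end TropCurve

/-! ### Points of the polytopes as chains, and their normal forms. -/

namespace TropCurve

variable {n g : ℕ} (Γ : TropCurve g n)

open Classical in
/-- The chain given by a point of a polytope. -/
noncomputable def coord (o : QD g Γ.G) (x : Γ.Poly o) (e : Γ.G.E) : ℝ :=
  if h : o.IsExcEdge e then x ⟨e, h⟩ / Γ.d e else 0

theorem coord_of_not_isExcEdge {o : QD g Γ.G} (x : Γ.Poly o) {e : Γ.G.E} (h : ¬ o.IsExcEdge e) :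
    Γ.coord o x e = 0 := dif_neg h

theorem coord_of_isExcEdge {o : QD g Γ.G} (x : Γ.Poly o) {e : Γ.G.E} (h : o.IsExcEdge e) :
    Γ.coord o x e = x ⟨e, h⟩ / Γ.d e := dif_pos h

theorem coord_mem {o : QD g Γ.G} (x : Γ.Poly o) (e : Γ.G.E) :
    0 ≤ Γ.coord o x e ∧ Γ.coord o x e ≤ 1 := by
  by_cases h : o.IsExcEdge e
  · rw [coord_of_isExcEdge _ _ h]
    exact ⟨div_nonneg (x _).2.1 (Γ.d_pos e).le, (div_le_one (Γ.d_pos e)).2 (x _).2.2⟩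
  · rw [coord_of_not_isExcEdge _ _ h]
    exact ⟨le_rfl, zero_le_one⟩

theorem continuous_coord (o : QD g Γ.G) : Continuous (Γ.coord o) := by
  refine continuous_pi fun e => ?_
  by_cases h : o.IsExcEdge e
  · have h1 : (fun x : Γ.Poly o => Γ.coord o x e) = fun x => (x ⟨e, h⟩ : ℝ) / Γ.d e :=
      funext fun x => Γ.coord_of_isExcEdge x h
    rw [h1]
    exact (continuous_subtype_val.comp (continuous_apply _)).div_const _
  · have h1 : (fun x : Γ.Poly o => Γ.coord o x e) = fun x => 0 :=
      funext fun x => Γ.coord_of_not_isExcEdge x h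
    rw [h1]
    exact continuous_const

theorem cellDiv_eq_base (o : QD g Γ.G) (x : Γ.Poly o) :
    Γ.cellDiv o x = Γ.base o.baseDeg (Γ.coord o x) := by
  classical
  rw [cellDiv_eq, base]
  simp only [QD.baseDeg, Finsupp.single_add, Finset.sum_add_distrib]
  rw [sum_single_vert, add_assoc, ← Finset.sum_add_distrib, add_comm]
  congr 1
  refine Finset.sum_congr rfl fun e _ => ?_
  by_cases he : o.IsExcEdge e
  · rw [dif_pos he, if_pos he, slide]
    have hx : Γ.coord o x e * Γ.d e = x ⟨e, he⟩ := by
      rw [coord_of_isExcEdge _ _ he, div_mul_cancel₀ _ (Γ.d_pos e).ne']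
    -- The coordinate 1 is separate: there the floor jumps to 1, and `slide` gives the head minus
    -- the tail with no fractional part.
    rcases (Γ.coord_mem x e).2.eq_or_lt with h1 | h1
    · rw [h1, one_mul] at hx
      rw [h1, ← hx, pt_d]
      simp [pt_zero]
    · rw [Int.floor_eq_zero_iff.2 ⟨(Γ.coord_mem x e).1, h1⟩,
        Int.fract_eq_self.2 ⟨(Γ.coord_mem x e).1, h1⟩, hx]
      simp
  · rw [dif_neg he, if_neg he, coord_of_not_isExcEdge _ _ he, slide]
    simp [pt_zero]

theorem sum_bdry (k : Γ.G.E → ℤ) : ∑ v, Γ.bdry k v = 0 := by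
  classical
  simp only [bdry_apply, Finset.sum_sub_distrib]
  rw [Finset.sum_comm, sub_eq_zero]
  conv_rhs => rw [Finset.sum_comm]
  simp

theorem degDiv_base (D : Γ.G.V → ℤ) (t : Γ.G.E → ℝ) : Γ.degDiv (Γ.base D t) = ∑ v, D v := by
  rw [← sum_vertDeg]
  simp only [vertDeg_base, Finset.sum_add_distrib, sum_bdry, add_zero]

theorem degDiv_cellDiv (o : QD g Γ.G) (x : Γ.Poly o) : Γ.degDiv (Γ.cellDiv o x) = o.deg := by
  rw [cellDiv_eq_base, degDiv_base, o.sum_baseDeg_univ]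

/-- Floors commute with integral translations, so subtracting `k` lowers the flux into `A` by the
net amount of `k` entering `A`. This is the sum of the boundary of `k` over `A`. -/
theorem IsBalanced.shift {ψ : Γ.G.V → ℝ} {D : Γ.G.V → ℤ} {t : Γ.G.E → ℝ}
    (h : Γ.IsBalanced ψ D t) (k : Γ.G.E → ℤ) :
    Γ.IsBalanced ψ (D + Γ.bdry k) (fun e => t e - k e) := by
  classical
  intro A
  refine (h A).trans (le_of_eq ?_)
  have h1 : ∀ e, Γ.flux (fun e => t e - k e) A e = Γ.flux t A e -
      ((if head e ∈ A then (k e : ℝ) else 0) - if tail e ∈ A then (k e : ℝ) else 0) := by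
    intro e
    have h2 : -(t e - k e) = -t e + k e := by ring
    unfold flux
    simp only [h2, Int.floor_sub_intCast, Int.floor_add_intCast]
    by_cases h1 : head e ∈ A <;> by_cases h2 : tail e ∈ A <;> simp [h1, h2] <;> ring
  have h2 : ∑ v ∈ A, ((Γ.bdry k v : ℤ) : ℝ) =
      ∑ e, ((if head e ∈ A then (k e : ℝ) else 0) - if tail e ∈ A then (k e : ℝ) else 0) := by
    simp only [bdry_apply, Int.cast_sub, Int.cast_sum, Int.cast_ite, Int.cast_zero,
      Finset.sum_sub_distrib]
    congr 1 <;>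
    · rw [Finset.sum_comm]
      refine Finset.sum_congr rfl fun e _ => ?_
      simp
  simp only [h1, Pi.add_apply, Int.cast_add, Finset.sum_add_distrib, Finset.sum_sub_distrib, h2]
  ring

open Classical in
/-- The object with a given base divisor whose exceptional edges support a given chain. -/
noncomputable def normObj (N : Γ.G.V → ℤ) (f : Γ.G.E → ℝ) : QD g Γ.G :=
  QD.canon {e | f e ≠ 0} Γ.stable
    fun v => N v - ∑ e : Γ.G.E, if f e ≠ 0 ∧ tail e = v then 1 else 0

theorem normObj_isExcEdge (N : Γ.G.V → ℤ) (f : Γ.G.E → ℝ) (e : Γ.G.E) :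
    (Γ.normObj N f).IsExcEdge e ↔ f e ≠ 0 := QD.canon_isExcEdge _ _ _ _

theorem normObj_baseDeg (N : Γ.G.V → ℤ) (f : Γ.G.E → ℝ) : (Γ.normObj N f).baseDeg = N := by
  classical
  ext v
  have h : (Γ.normObj N f).D ((Γ.normObj N f).embV v) =
      N v - ∑ e : Γ.G.E, if f e ≠ 0 ∧ tail e = v then 1 else 0 := by
    refine (QD.canon_D _ _ _ (.inl v)).trans ?_
    simp
  rw [QD.baseDeg, h]
  simp only [normObj_isExcEdge, ne_eq]
  simp

/-- The point of the polytope of `normObj` given by the chain. -/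
noncomputable def normPt (N : Γ.G.V → ℤ) (f : Γ.G.E → ℝ) (hf : ∀ e, 0 ≤ f e ∧ f e < 1) :
    Γ.Poly (Γ.normObj N f) := fun e =>
  ⟨f e.1 * Γ.d e.1, mul_nonneg (hf e.1).1 (Γ.d_pos e.1).le,
    mul_le_of_le_one_left (Γ.d_pos e.1).le (hf e.1).2.le⟩

theorem coord_normPt (N : Γ.G.V → ℤ) (f : Γ.G.E → ℝ) (hf : ∀ e, 0 ≤ f e ∧ f e < 1) :
    Γ.coord _ (Γ.normPt N f hf) = f := by
  ext e
  by_cases h : f e = 0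
  · rw [coord_of_not_isExcEdge, h]
    rw [normObj_isExcEdge]
    exact not_not.2 h
  · rw [coord_of_isExcEdge _ _ ((Γ.normObj_isExcEdge N f e).2 h)]
    exact mul_div_cancel_right₀ _ (Γ.d_pos e).ne'

theorem fract_chain_mem (t : Γ.G.E → ℝ) (e : Γ.G.E) :
    0 ≤ Int.fract (t e) ∧ Int.fract (t e) < 1 := ⟨Int.fract_nonneg _, Int.fract_lt_one _⟩

theorem cls_base_fract (D : Γ.G.V → ℤ) (t : Γ.G.E → ℝ) :
    cls (Γ.base (D + Γ.bdry fun e => ⌊t e⌋) fun e => Int.fract (t e)) = cls (Γ.base D t) := by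
  rw [cls_base_eq_iff]
  refine ⟨fun e => -⌊t e⌋, 0, fun v => ?_, fun e => ?_⟩
  · rw [show (fun e => -⌊t e⌋) = -fun e => ⌊t e⌋ from rfl, map_neg, Pi.neg_apply, Pi.add_apply]
    ring
  · have h := Int.self_sub_floor (t e)
    push_cast
    simp only [Pi.zero_apply]
    linear_combination (-Γ.d e) * h

theorem cls_cellDiv_norm (D : Γ.G.V → ℤ) (t : Γ.G.E → ℝ) :
    cls (Γ.cellDiv _ (Γ.normPt (D + Γ.bdry fun e => ⌊t e⌋) (fun e => Int.fract (t e))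
      (Γ.fract_chain_mem t))) = cls (Γ.base D t) := by
  rw [cellDiv_eq_base, normObj_baseDeg, coord_normPt, cls_base_fract]

/-- The standard object isomorphic to `o`. -/
noncomputable abbrev canonObj (o : QD g Γ.G) : QD g Γ.G :=
  QD.canon o.excSet Γ.stable fun v => o.D (o.embV v)

theorem canonObj_isExcEdge (o : QD g Γ.G) (e : Γ.G.E) :
    (Γ.canonObj o).IsExcEdge e ↔ o.IsExcEdge e := QD.canon_isExcEdge _ _ _ _

/-- The point of the polytope of the standard object. -/
noncomputable def canonPt {o : QD g Γ.G} (x : Γ.Poly o) : Γ.Poly (Γ.canonObj o) := fun e =>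
  x ⟨e.1, (Γ.canonObj_isExcEdge o e.1).1 e.2⟩

theorem polyMap_toCanon {o : QD g Γ.G} (x : Γ.Poly o) :
    Γ.polyMap (o.toCanon Γ.stable) (Γ.canonPt x) = x := by
  ext e
  rw [polyMap, dif_pos ((Γ.canonObj_isExcEdge o e.1).2 e.2)]
  rfl

theorem canonObj_baseDeg (o : QD g Γ.G) : (Γ.canonObj o).baseDeg = o.baseDeg := by
  classical
  ext v
  rw [QD.baseDeg, QD.baseDeg]
  simp only [canonObj_isExcEdge]
  congr 1
  exact QD.canon_D _ _ _ (.inl v)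

theorem canonObj_deg (o : QD g Γ.G) : (Γ.canonObj o).deg = o.deg := by
  rw [← QD.sum_baseDeg_univ, ← QD.sum_baseDeg_univ, canonObj_baseDeg]

open Classical in
/-- The contraction to the normal form of a point. -/
noncomputable def toNorm {o : QD g Γ.G} (x : Γ.Poly o) :
    QD.Mor (Γ.canonObj o) (Γ.normObj (o.baseDeg + Γ.bdry fun e => ⌊Γ.coord o x e⌋)
      fun e => Int.fract (Γ.coord o x e)) :=
  QD.contrMor Γ.stable (Ex := o.excSet) (Ex' := {e | Int.fract (Γ.coord o x e) ≠ 0})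
    (fun e he => by
      by_contra h
      refine he ?_
      rw [coord_of_not_isExcEdge _ _ h, Int.fract_zero])
    -- The tail piece is contracted where the coordinate is 0 and the head piece where it is 1. On
    -- edges with a coordinate strictly in between nothing is contracted.
    (fun e => decide (Γ.coord o x e = 0)) _ _ (fun v => by
      rw [Pi.add_apply, QD.baseDeg, bdry_apply, add_assoc, add_sub_assoc, ← Finset.sum_sub_distrib,
        ← Finset.sum_add_distrib, ← Finset.sum_sub_distrib]
      congr 1
      refine Finset.sum_congr rfl fun e _ => ?_
      by_cases he : o.IsExcEdge e
      · have he' : e ∈ o.excSet := he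
        obtain ⟨h0, h1⟩ := Γ.coord_mem x e
        rcases h0.eq_or_lt with h0 | h0
        · simp [← h0, he, he', root_half_true]
        rcases h1.eq_or_lt with h1 | h1
        · simp [h1, he, he', root_half_false]
        · have h2 : Int.fract (Γ.coord o x e) = Γ.coord o x e := Int.fract_eq_self.2 ⟨h0.le, h1⟩
          have h3 : ⌊Γ.coord o x e⌋ = 0 := Int.floor_eq_zero_iff.2 ⟨h0.le, h1⟩
          simp [h2, h3, h0.ne', he]
      · have he' : e ∉ o.excSet := he
        simp [coord_of_not_isExcEdge _ _ he, he, he'])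

/-- Coordinates inside the open interval are kept. The value at either end is recovered from which
piece was contracted, so the point of the standard polytope is a gluing image of its normal form. -/
theorem polyMap_toNorm {o : QD g Γ.G} (x : Γ.Poly o) :
    Γ.polyMap (Γ.toNorm x) (Γ.normPt _ _ (Γ.fract_chain_mem (Γ.coord o x))) =
      Γ.canonPt x := by
  classical
  funext e
  obtain ⟨e, he'⟩ := e
  have he : o.IsExcEdge e := (Γ.canonObj_isExcEdge o e).1 he'
  have hx : Γ.coord o x e * Γ.d e = x ⟨e, he⟩ := by
    rw [coord_of_isExcEdge _ _ he, div_mul_cancel₀ _ (Γ.d_pos e).ne']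
  obtain ⟨h0, h1⟩ := Γ.coord_mem x e
  refine Subtype.ext (Eq.trans ?_ hx)
  rw [polyMap]
  have hv : (Γ.normObj (o.baseDeg + Γ.bdry fun e => ⌊Γ.coord o x e⌋)
      fun e => Int.fract (Γ.coord o x e)).G.IsVertex
        ((Γ.toNorm x).π.toFun ((Γ.canonObj o).emb (rep e))) ↔
      Int.fract (Γ.coord o x e) = 0 ∧ Γ.coord o x e = 0 := by
    change (subW Γ.G _).IsVertex (contr Γ.G o.excSet {e | Int.fract (Γ.coord o x e) ≠ 0}
      (fun e => decide (Γ.coord o x e = 0)) (.inl (half e true))) ↔ _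
    by_cases h2 : Γ.coord o x e = 0
    · have h3 : decide (Γ.coord o x e = 0) = true := decide_eq_true h2
      have h4 := contr_half_self (G := Γ.G) (Ex := o.excSet)
        (Ex' := {e | Int.fract (Γ.coord o x e) ≠ 0})
        (σ := fun e => decide (Γ.coord o x e = 0)) (e := e) he (by simp [h2])
      simp only [h3] at h4
      rw [h4]
      exact iff_of_true (subGraph_isVertex_inl.2 (isVertex_r _)) ⟨by rw [h2, Int.fract_zero], h2⟩
    · have h3 : (!decide (Γ.coord o x e = 0)) = true := by simp [h2]
      have h4 := contr_half_not (G := Γ.G) (Ex := o.excSet)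
        (Ex' := {e | Int.fract (Γ.coord o x e) ≠ 0})
        (σ := fun e => decide (Γ.coord o x e = 0)) e
      simp only [h3] at h4
      rw [h4]
      exact iff_of_false (fun h => (isHalfEdge_half e true).not_isVertex
        (subGraph_isVertex_inl.1 h)) fun h => h2 h.2
  by_cases h2 : Int.fract (Γ.coord o x e) = 0
  · rw [dif_neg (by rw [normObj_isExcEdge]; exact not_not.2 h2)]
    rcases h1.eq_or_lt with h1 | h1
    · rw [if_neg (by rw [hv, h1]; simp), h1, one_mul]
    · rw [Int.fract_eq_self.2 ⟨h0, h1⟩] at h2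
      rw [if_pos (by rw [hv, h2]; simp), h2, zero_mul]
  · rw [dif_pos ((Γ.normObj_isExcEdge _ _ e).2 h2)]
    have h3 : Γ.coord o x e < 1 := lt_of_le_of_ne h1 fun h => h2 (by rw [h, Int.fract_one])
    change Int.fract (Γ.coord o x e) * Γ.d e = _
    rw [Int.fract_eq_self.2 ⟨h0, h3⟩]

theorem mk_canon_eq {C : QD g Γ.G → Prop} {o : QD g Γ.G} (x : Γ.Poly o) (ho : C o)
    (ho' : C (Γ.canonObj o)) :
    (Quot.mk _ ⟨⟨o, ho⟩, x⟩ : Γ.JacOf C) = Quot.mk _ ⟨⟨Γ.canonObj o, ho'⟩, Γ.canonPt x⟩ := by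
  have h := Quot.sound (Glue.mk (C := C) ⟨o, ho⟩ ⟨Γ.canonObj o, ho'⟩ (o.toCanon Γ.stable)
    (Γ.canonPt x))
  rw [polyMap_toCanon] at h
  exact h.symm

/-- The normal form depends only on `N` and `f`, so this replaces equality of glued points by
equality of chains. Gluing takes place in the full subcategory, which is why both objects must
satisfy `C`. -/
theorem mk_norm_eq {C : QD g Γ.G → Prop} {o : QD g Γ.G} (x : Γ.Poly o)
    (ho' : C (Γ.canonObj o)) (ho'' : C (Γ.normObj (o.baseDeg + Γ.bdry fun e => ⌊Γ.coord o x e⌋)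
      fun e => Int.fract (Γ.coord o x e))) :
    (Quot.mk _ ⟨⟨Γ.canonObj o, ho'⟩, Γ.canonPt x⟩ : Γ.JacOf C) =
      Quot.mk _ ⟨⟨_, ho''⟩, Γ.normPt _ _ (Γ.fract_chain_mem (Γ.coord o x))⟩ := by
  have h := Quot.sound (Glue.mk (C := C) ⟨Γ.canonObj o, ho'⟩ ⟨_, ho''⟩ (Γ.toNorm x)
    (Γ.normPt _ _ (Γ.fract_chain_mem (Γ.coord o x))))
  rw [polyMap_toNorm] at h
  exact h.symm

/-- The map to the Picard group from the colimit over a full subcategory. -/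
noncomputable def abelMapOf (C : QD g Γ.G → Prop) (y : Γ.JacOf C) : Γ.Pic :=
  Γ.abelMap (JacOf.toJac Γ C y)

theorem abelMapOf_mk {C : QD g Γ.G → Prop} (a : Γ.PolySum C) :
    Γ.abelMapOf C (Quot.mk _ a) = cls (Γ.cellDiv a.1.1 a.2) := rfl

theorem continuous_cls_cellDiv (o : QD g Γ.G) : Continuous fun x => cls (Γ.cellDiv o x) := by
  simp only [cellDiv_eq_base]
  exact (Γ.continuous_cls_base o.baseDeg).comp (Γ.continuous_coord o)

theorem continuous_abelMapOf (C : QD g Γ.G → Prop) : Continuous (Γ.abelMapOf C) := by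
  refine isQuotientMap_quot_mk.continuous_iff.2 (continuous_sigma fun o => ?_)
  exact Γ.continuous_cls_cellDiv o.1

theorem continuous_abelMap : Continuous Γ.abelMap := by
  refine isQuotientMap_quot_mk.continuous_iff.2 (continuous_sigma fun o => ?_)
  exact Γ.continuous_cls_cellDiv o.1

theorem surjective_abelMap : Function.Surjective Γ.abelMap := by
  intro c
  obtain ⟨C, rfl⟩ : ∃ C : Γ.Div, cls C = c := QuotientAddGroup.mk_surjective c
  rw [cls_eq_cls_base, ← cls_cellDiv_norm]
  exact ⟨Jac.mk Γ _ _, rfl⟩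

theorem abelMapOf_mem (C : QD g Γ.G → Prop) (k : ℤ) (hC : ∀ o, C o → o.deg = k) (y : Γ.JacOf C) :
    Γ.abelMapOf C y ∈ Γ.PicDeg k := by
  induction y using Quot.ind with
  | mk a => exact ⟨_, (Γ.degDiv_cellDiv _ _).trans (hC _ a.1.2), rfl⟩

/-! ### The semistable Jacobian: bijectivity and closedness. -/

section Semistable

variable {Γ} {φ : StabCond g n} (hgn : (0 : ℤ) < 2 * (g : ℤ) - 2 + n)

theorem isBalanced_coord {o : QD g Γ.G} (h : φ.IsSemistable o.qs o.D) (x : Γ.Poly o) :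
    Γ.IsBalanced (φ.toFun Γ.G) o.baseDeg (Γ.coord o x) :=
  Γ.isBalanced_of_isSemistable h (Γ.coord_mem x) fun _ he => Γ.coord_of_not_isExcEdge x he

include hgn in
theorem isSemistable_canonObj {o : QD g Γ.G} (h : φ.IsSemistable o.qs o.D) :
    φ.IsSemistable (Γ.canonObj o).qs (Γ.canonObj o).D := by
  classical
  -- The midpoints of the exceptional edges form an interior chain, for which balance and
  -- semistability imply each other. Balance depends only on `baseDeg`, which the standard object
  -- shares.
  have h1 := Γ.isBalanced_of_isSemistable h (t := fun e => if o.IsExcEdge e then 1 / 2 else 0)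
    (fun e => by split_ifs <;> norm_num) fun e he => if_neg he
  rw [← canonObj_baseDeg] at h1
  refine Γ.isSemistable_of_isBalanced hgn h1 ((Γ.canonObj_deg o).trans h.1) (fun e he => ?_)
    fun e he => ?_
  · rw [canonObj_isExcEdge] at he
    simp only [if_pos he]
    norm_num
  · rw [canonObj_isExcEdge] at he
    exact if_neg he

include hgn in
theorem isSemistable_normObj {D : Γ.G.V → ℤ} {t : Γ.G.E → ℝ}
    (h : Γ.IsBalanced (φ.toFun Γ.G) D t) (hD : ∑ v, D v = φ.degree) :
    φ.IsSemistable (Γ.normObj (D + Γ.bdry fun e => ⌊t e⌋) fun e => Int.fract (t e)).qs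
      (Γ.normObj (D + Γ.bdry fun e => ⌊t e⌋) fun e => Int.fract (t e)).D := by
  have h1 := h.shift Γ fun e => ⌊t e⌋
  rw [← Γ.normObj_baseDeg (D + Γ.bdry fun e => ⌊t e⌋) fun e => Int.fract (t e)] at h1
  refine Γ.isSemistable_of_isBalanced hgn h1 ?_ (fun e he => ?_) fun e he => ?_
  · rw [← QD.sum_baseDeg_univ, normObj_baseDeg]
    simp only [Pi.add_apply, Finset.sum_add_distrib, sum_bdry, add_zero, hD]
  · rw [normObj_isExcEdge] at he
    exact ⟨lt_of_le_of_ne (Int.fract_nonneg _) (Ne.symm he), Int.fract_lt_one _⟩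
  · rw [normObj_isExcEdge] at he
    exact not_not.1 he

include hgn in
-- A chain representing the class is made balanced by a gradient, which does not change the class.
-- The normal form of the balanced chain is a semistable point.
theorem surjective_abelMapOf {c : Γ.Pic} (hc : c ∈ Γ.PicDeg φ.degree) :
    ∃ y : Γ.JacStab φ, Γ.abelMapOf _ y = c := by
  obtain ⟨C, hC, rfl⟩ := hc
  rw [cls_eq_cls_base]
  rw [← sum_vertDeg] at hC
  set D := fun v => Γ.vertDeg v C
  set t := fun e => Γ.totalDist e C / Γ.d e
  obtain ⟨y, ⟨F, hF⟩, hy⟩ := Γ.exists_isBalanced (φ.toFun Γ.G) D (by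
    rw [φ.sum_eq_degree hgn Γ.stable, ← hC]
    push_cast
    rfl) t
  refine ⟨Quot.mk _ ⟨⟨_, isSemistable_normObj hgn hy hC⟩,
    Γ.normPt _ _ (Γ.fract_chain_mem y)⟩, ?_⟩
  rw [abelMapOf_mk]
  refine (Γ.cls_cellDiv_norm D y).trans ?_
  rw [cls_base_eq_iff]
  refine ⟨0, F, fun v => by simp, fun e => ?_⟩
  rw [← hF]
  simp

include hgn in
-- After a shift by the integral chain `k`, both points give balanced chains for the same vertex
-- degrees that differ by a gradient. By uniqueness the chains differ by `k` alone, and this leaves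
-- the normal form unchanged.
theorem injective_abelMapOf (hφ : φ.IsGeneral) :
    Function.Injective (Γ.abelMapOf fun o => φ.IsSemistable o.qs o.D) := by
  intro y y' h
  induction y using Quot.ind with
  | mk a =>
  induction y' using Quot.ind with
  | mk a' =>
  obtain ⟨⟨o, ho⟩, x⟩ := a
  obtain ⟨⟨o', ho'⟩, x'⟩ := a'
  rw [abelMapOf_mk, abelMapOf_mk] at h
  change cls (Γ.cellDiv o x) = cls (Γ.cellDiv o' x') at h
  rw [cellDiv_eq_base, cellDiv_eq_base, cls_base_eq_iff] at h
  obtain ⟨k, F, hk, hF⟩ := h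
  have hs : ∀ {o : QD g Γ.G}, φ.IsSemistable o.qs o.D → ∑ v, o.baseDeg v = φ.degree :=
    fun h => (QD.sum_baseDeg_univ _).trans h.1
  have hb := isBalanced_coord ho x
  have hb' := (isBalanced_coord ho' x').shift Γ (-k)
  have hD : o'.baseDeg + Γ.bdry (-k) = o.baseDeg := by
    ext v
    rw [map_neg, Pi.add_apply, Pi.neg_apply]
    linarith [hk v]
  rw [hD] at hb'
  have ht := hb.unique Γ (by
    rw [φ.sum_eq_degree hgn Γ.stable, ← hs ho]
    push_cast
    rfl) (Γ.not_exists_of_isGeneral hφ) hb' ⟨F, fun e => by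
      rw [← hF e]
      simp only [Pi.sub_apply, Pi.neg_apply]
      push_cast
      ring⟩
  have ht' : ∀ e, Γ.coord o x e = Γ.coord o' x' e + k e := by
    intro e
    rw [ht]
    simp
  rw [Γ.mk_canon_eq x ho (isSemistable_canonObj hgn ho),
    Γ.mk_norm_eq x (isSemistable_canonObj hgn ho) (isSemistable_normObj hgn hb (hs ho)),
    Γ.mk_canon_eq x' ho' (isSemistable_canonObj hgn ho'),
    Γ.mk_norm_eq x' (isSemistable_canonObj hgn ho')
      (isSemistable_normObj hgn (isBalanced_coord ho' x') (hs ho'))]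
  have h1 : (o.baseDeg + Γ.bdry fun e => ⌊Γ.coord o x e⌋) =
      o'.baseDeg + Γ.bdry fun e => ⌊Γ.coord o' x' e⌋ := by
    have h2 : (fun e => ⌊Γ.coord o x e⌋) = (fun e => ⌊Γ.coord o' x' e⌋) + k := by
      ext e
      rw [ht' e, Int.floor_add_intCast]
      rfl
    rw [h2, map_add, ← hD, map_neg]
    abel
  have h2 : (fun e => Int.fract (Γ.coord o x e)) = fun e => Int.fract (Γ.coord o' x' e) := by
    ext e
    rw [ht' e, Int.fract_add_intCast]
  -- The type of the polytope depends on `N` and `f`, so the equalities are substituted for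
  -- variables.
  have key : ∀ (N N' : Γ.G.V → ℤ) (f f' : Γ.G.E → ℝ) (hf : ∀ e, 0 ≤ f e ∧ f e < 1)
      (hf' : ∀ e, 0 ≤ f' e ∧ f' e < 1)
      (hN : φ.IsSemistable (Γ.normObj N f).qs (Γ.normObj N f).D)
      (hN' : φ.IsSemistable (Γ.normObj N' f').qs (Γ.normObj N' f').D), N = N' → f = f' →
      (Quot.mk _ ⟨⟨_, hN⟩, Γ.normPt N f hf⟩ : Γ.JacStab φ) =
        Quot.mk _ ⟨⟨_, hN'⟩, Γ.normPt N' f' hf'⟩ := by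
    rintro N _ f _ hf hf' hN hN' rfl rfl
    rfl
  exact key _ _ _ _ _ _ _ _ h1 h2

/-- The divisors of the semistable standard objects are bounded. -/
theorem finite_semistable : {D : Γ.G.V → ℤ | ∃ Ex : Set Γ.G.E,
    φ.IsSemistable (QD.canon Ex Γ.stable D).qs (QD.canon Ex Γ.stable D).D}.Finite := by
  classical
  have hfin : (Set.univ.pi fun v : Γ.G.V => Set.Icc
      ⌈φ.toFun Γ.G v - Fintype.card Γ.G.E⌉ ⌊φ.toFun Γ.G v + Fintype.card Γ.G.E⌋).Finite :=
    Set.Finite.pi fun v => Set.finite_Icc _ _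
  refine hfin.subset ?_
  rintro D ⟨Ex, h⟩ v -
  have h1 := h.2 {(QD.canon Ex Γ.stable D).embV v}
  rw [Finset.sum_singleton, Finset.sum_singleton, φ.onQuasi_embV Γ.stable] at h1
  have h2 : (QD.canon Ex Γ.stable D).D ((QD.canon Ex Γ.stable D).embV v) = D v :=
    QD.canon_D _ _ _ (.inl v)
  rw [h2] at h1
  -- Each edge of the stable graph carries at most two edges of the subdivision, so half the cut is
  -- at most the number of edges, and the inequality for one vertex bounds its degree.
  have h3 : (cut {(QD.canon Ex Γ.stable D).embV v} : ℝ) ≤ 2 * Fintype.card Γ.G.E := by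
    rw [QD.cut_eq_sum]
    refine (Finset.sum_le_card_nsmul _ _ 2 fun e _ => ?_).trans ?_
    · split_ifs <;> norm_num
    · rw [nsmul_eq_mul, mul_comm]
      rfl
  rw [Set.mem_Icc, Int.ceil_le, Int.le_floor]
  constructor <;> linarith [h1.1, h1.2]

include hgn in
-- A closed set meets each of the finitely many standard semistable polytopes in a compact set, and
-- these polytopes cover the space. The class map takes each compact piece to a closed set, so no
-- separation property of the Picard group is needed.
theorem isClosed_image_abelMapOf {T : Set (Γ.JacStab φ)} (hT : IsClosed T) :
    IsClosed (Γ.abelMapOf _ '' T) := by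
  let I : Set (Set Γ.G.E × (Γ.G.V → ℤ)) := {p |
    φ.IsSemistable (QD.canon p.1 Γ.stable p.2).qs (QD.canon p.1 Γ.stable p.2).D}
  have hI : I.Finite := (Set.finite_univ.prod (finite_semistable (Γ := Γ) (φ := φ))).subset
    fun p hp => ⟨trivial, p.1, hp⟩
  have : Finite I := hI
  let K : (p : I) → Set (Γ.Poly (QD.canon p.1.1 Γ.stable p.1.2)) := fun p =>
    {x | (Quot.mk _ ⟨⟨_, p.2⟩, x⟩ : Γ.JacStab φ) ∈ T}
  have himg : Γ.abelMapOf _ '' T = ⋃ p : I, (fun x => cls (Γ.cellDiv _ x)) '' K p := by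
    ext c
    rw [Set.mem_iUnion]
    constructor
    · rintro ⟨y, hy, rfl⟩
      induction y using Quot.ind with
      | mk a =>
      obtain ⟨⟨o, ho⟩, x⟩ := a
      rw [Γ.mk_canon_eq x ho (isSemistable_canonObj hgn ho)] at hy ⊢
      exact ⟨⟨(o.excSet, fun v => o.D (o.embV v)), isSemistable_canonObj hgn ho⟩, Γ.canonPt x, hy,
        rfl⟩
    · rintro ⟨p, x, hx, rfl⟩
      exact ⟨_, hx, rfl⟩
  rw [himg]
  refine isClosed_iUnion_of_finite fun p => ?_
  have hK : IsClosed (K p) := by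
    refine hT.preimage (continuous_quot_mk.comp ?_)
    exact continuous_sigmaMk (σ := fun o : {o : QD g Γ.G // φ.IsSemistable o.qs o.D} => Γ.Poly o.1)
      (i := ⟨_, p.2⟩)
  have h1 := Γ.isClosed_image_cls_base (QD.canon p.1.1 Γ.stable p.1.2).baseDeg
    (hK.isCompact.image (Γ.continuous_coord _))
  rw [Set.image_image] at h1
  simpa only [cellDiv_eq_base] using h1

end Semistable

end TropCurve

end TropJac

theorem theoremT {g n : ℕ} (hgn : (0 : ℤ) < 2 * (g : ℤ) - 2 + n) (Γ : TropJac.TropCurve g n) :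
    ∃ α : Γ.Jac → Γ.Pic,
      (∀ (o : TropJac.QD g Γ.G) (x : Γ.Poly o),
        α (TropJac.TropCurve.Jac.mk Γ o x) = TropJac.TropCurve.cls (Γ.cellDiv o x)) ∧
      Continuous α ∧
      Function.Surjective α ∧
      (∀ (k : ℤ) (y : Γ.JacDeg k), α (TropJac.TropCurve.JacOf.toJac Γ _ y) ∈ Γ.PicDeg k) ∧
      ∀ φ : TropJac.StabCond g n, φ.IsGeneral →
        ∃ Ψ : Γ.JacStab φ ≃ₜ Γ.PicDeg φ.degree,
          ∀ y, (Ψ y : Γ.Pic) = α (TropJac.TropCurve.JacOf.toJac Γ _ y) := by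
  refine ⟨Γ.abelMap, fun _ _ => rfl, Γ.continuous_abelMap, Γ.surjective_abelMap,
    fun k y => Γ.abelMapOf_mem _ k (fun _ h => h) y, fun φ hφ => ?_⟩
  let f : Γ.JacStab φ → Γ.PicDeg φ.degree := fun y =>
    ⟨Γ.abelMapOf _ y, Γ.abelMapOf_mem _ _ (fun _ h => h.1) y⟩
  have hf : Continuous f := (Γ.continuous_abelMapOf _).subtype_mk _
  have hbij : Function.Bijective f := by
    refine ⟨fun y y' h => TropJac.TropCurve.injective_abelMapOf hgn hφ (congrArg Subtype.val h),
      fun c => ?_⟩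
    obtain ⟨y, hy⟩ := TropJac.TropCurve.surjective_abelMapOf hgn c.2
    exact ⟨y, Subtype.ext hy⟩
  have hcl : IsClosedMap f := by
    intro T hT
    have h := (TropJac.TropCurve.isClosed_image_abelMapOf hgn hT).preimage
      (continuous_subtype_val : Continuous (Subtype.val : Γ.PicDeg φ.degree → Γ.Pic))
    convert h using 1
    ext c
    constructor
    · rintro ⟨y, hy, rfl⟩
      exact ⟨y, hy, rfl⟩
    · rintro ⟨y, hy, h⟩
      exact ⟨y, hy, Subtype.ext h⟩
  exact ⟨(Equiv.ofBijective f hbij).toHomeomorphOfContinuousClosed hf hcl, fun y => rfl⟩
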